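/- Let $\alpha\in(0,2)$ and let $S_\alpha$ denote the law on $\mathbb R$ with characteristic function $\theta\mapsto e^{-|\theta|^\alpha}$. Let $C_\alpha=\frac{2}{\pi}\Gamma(\alpha)\sin\frac{\pi\alpha}{2}$, which is the constant with $P(S\ge h)\sim \tfrac12 C_\alpha h^{-\alpha}$ as $h\to\infty$ for $S\sim S_\alpha$. Let $S_1,S_2$ be i.i.d. with law $S_\alpha$, and let $$X=(1,1)S_1-(0,1)S_2,\qquad E=\{x\in\mathbb R^2: x_1>1,\ x_2<1\}.$$ Let $\Lambda$ be the measure on the unit circle $\mathbb S^1$ with mass $2^{\alpha/2}/2$ at each of $\pm(1,1)/\sqrt2$ and mass $1/2$ at each of $\pm(0,1)$. For a Borel set $F\subseteq\mathbb R^2$ and $k\ge1$ put $$L(F,k,\alpha)=\frac{C_\alpha^k}{k!}\int_0^\infty\!\!\cdots\int_0^\infty \Lambda^k\Big(\Big\{(\mathbf x_1,\dots,\mathbf x_k)\in(\mathbb S^1)^k:\sum_{i=1}^k s_i\mathbf x_i\in F\Big\}\Big)\prod_{i=1}^k\alpha s_i^{-(1+\alpha)}\,ds_i\in[0,\infty].$$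 Write $F^o$ and $\bar F$ for interior and closure, and $F_{\delta,+}=\{x:d(x,F)<\delta\}$ for the Euclidean $\delta$-neighbourhood. Let $B_\varepsilon$ be the open ball of radius $\varepsilon$ around $(1,1)$ in the $L_\infty$ metric, and put $$g^+(\alpha,\varepsilon)=L(E^o\cup B_\varepsilon,1,\alpha),\qquad g^-(\alpha,\varepsilon)=L((E\setminus B_\varepsilon)^o,2,\alpha),\qquad K_\alpha=\frac{C_\alpha^2\,\alpha\,\Gamma(2\alpha)\Gamma(1-\alpha)}{4\,\Gamma(1+\alpha)}\quad(\alpha<1).$$ Then $X$ is symmetric $\alpha$-stable with spectral measure $\Lambda$; that is, $\Lambda$ is a finite measure invariant under $x\mapsto-x$ and $\mathbb E e^{i\theta\cdot X}=\exp\big(-\int_{\mathbb S^1}|\theta\cdot x|^\alpha\,d\Lambda(x)\big)$ for all $\theta\in\mathbb R^2$. Moreover: (i) If $\alpha<1$, then $\lim_{h\to\infty}h^{2\alpha}P(X\in hE)=K_\alpha<\infty$. If $\alpha=1$, then $\lim_{h\to\infty}\frac{h^2}{\log h}P(X\in hE)=\frac{C_1^2}{4}$. If $\alpha>1$, then $\mathbb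 E|S_1|<\infty$ and $\lim_{h\to\infty}h^{1+\alpha}P(X\in hE)=\frac{C_\alpha\,\alpha\,\mathbb E|S_1|}{4}$. (ii) $\lim_{\delta\to0}L(E_{\delta,+},2,\alpha)=\infty$. Moreover $L(E^o,2,\alpha)=L(\bar E,2,\alpha)$, and this common value is $\infty$ if $\alpha\in[1,2)$ and $K_\alpha$ if $\alpha\in(0,1)$. (iii) Let $\alpha\in(0,1)$. For every $\varepsilon\in(0,1)$, $$g^+(\alpha,\varepsilon)=\lim_{\delta\to0}L((E\cup B_\varepsilon)_{\delta,+},1,\alpha)\in(0,\infty),\qquad \lim_{h\to\infty}h^{\alpha}P(X\in h(E\cup B_\varepsilon))=g^+(\alpha,\varepsilon).$$ For every $\varepsilon>0$, $$g^-(\alpha,\varepsilon)=\lim_{\delta\to0}L((E\setminus B_\varepsilon)_{\delta,+},2,\alpha)\in(0,\infty),\qquad \lim_{h\to\infty}h^{2\alpha}P(X\in h(E\setminus B_\varepsilon))=g^-(\alpha,\varepsilon).$$ (iv) For every $\alpha\in(0,2)$, $g^+(\alpha,\cdot)$ is strictly increasing on $(0,1)$ with $\lim_{\varepsilon\to0}g^+(\alpha,\varepsilon)=0$,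 and $g^-(\alpha,\cdot)$ is strictly decreasing on $(0,\infty)$ with $\lim_{\varepsilon\to0}g^-(\alpha,\varepsilon)=\infty$ if $\alpha\in[1,2)$ and $\lim_{\varepsilon\to0}g^-(\alpha,\varepsilon)=K_\alpha$ if $\alpha\in(0,1)$. -/

import Mathlib

open MeasureTheory ProbabilityTheory Filter Topology Set
open scoped ENNReal Pointwise RealInnerProductSpace

noncomputable section

/-- The standard symmetric `α`-stable law `S_α` on the line: the probability measure whose
characteristic function is `exp (-|t| ^ α)`. -/
def IsStdStable (α : ℝ) (ν : Measure ℝ) : Prop :=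
  IsProbabilityMeasure ν ∧ ∀ t : ℝ, charFun ν t = Complex.exp (-((|t| ^ α : ℝ) : ℂ))

/-- The tail constant `C_α` of `S_α`, i.e. `P (S ≥ h) ~ C_α h ^ (-α) / 2` as `h → ∞`.
For `0 < α < 2` the value `(2 / π) Γ(α) sin (π α / 2)` equals
`(1 - α) / (Γ(2 - α) cos (π α / 2))` if `α ≠ 1`, and `2 / π` if `α = 1`. -/
def stableTailConst (α : ℝ) : ℝ :=
  2 / Real.pi * Real.Gamma α * Real.sin (Real.pi * α / 2)

/-- The unit sphere of `ℝⁿ` with the Euclidean norm. -/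
abbrev UnitSphere (n : ℕ) : Type :=
  Metric.sphere (0 : EuclideanSpace ℝ (Fin n)) 1

/-- `Λ` is a spectral measure of the symmetric `α`-stable law `ν` on `ℝⁿ`: it is a finite symmetric
measure on the unit sphere and the characteristic function of `ν` at `θ` is
`exp (-∫ |θ · x| ^ α dΛ(x))`. -/
def IsSpectralMeasure {n : ℕ} (α : ℝ) (Λ : Measure (UnitSphere n))
    (ν : Measure (EuclideanSpace ℝ (Fin n))) : Prop :=
  IsFiniteMeasure Λ ∧ Λ.map (fun x => -x) = Λ ∧
    ∀ θ : EuclideanSpace ℝ (Fin n),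
      charFun ν θ =
        Complex.exp (-((∫ x, |⟪θ, (x : EuclideanSpace ℝ (Fin n))⟫| ^ α ∂Λ : ℝ) : ℂ))

/-- The functional `L(E, k, α)` (for the spectral measure `Λ`), with values in `[0, ∞]`:
`C_α ^ k / k! * ∫_{(0,∞)^k} Λ^k {(x₁, …, x_k) | ∑ sᵢ xᵢ ∈ E} ∏ α sᵢ ^ (-(1 + α)) dsᵢ`. -/
def tailL {n : ℕ} (Λ : Measure (UnitSphere n)) (E : Set (EuclideanSpace ℝ (Fin n)))
    (k : ℕ) (α : ℝ) : ℝ≥0∞ :=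
  ENNReal.ofReal (stableTailConst α ^ k / (k.factorial : ℝ)) *
    ∫⁻ s : Fin k → ℝ in {s | ∀ i, 0 < s i},
      Measure.pi (fun _ : Fin k => Λ)
          {x | ∑ i, s i • (x i : EuclideanSpace ℝ (Fin n)) ∈ E} *
        ∏ i, ENNReal.ofReal (α * s i ^ (-(1 + α)))

/-- The point `(1, 1) / √2` of the unit circle. -/
def diagDir : UnitSphere 2 :=
  ⟨!₂[1 / √2, 1 / √2], by
    rw [mem_sphere_zero_iff_norm, EuclideanSpace.norm_eq]
    norm_num [Fin.sum_univ_two]⟩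

/-- The point `(0, 1)` of the unit circle. -/
def vertDir : UnitSphere 2 :=
  ⟨!₂[0, 1], by
    rw [mem_sphere_zero_iff_norm, EuclideanSpace.norm_eq]
    norm_num [Fin.sum_univ_two]⟩

/-- The measure with mass `2 ^ (α / 2) / 2` at `± (1, 1) / √2` and mass `1 / 2` at `± (0, 1)`. -/
def exampleSpectral (α : ℝ) : Measure (UnitSphere 2) :=
  ENNReal.ofReal ((2 : ℝ) ^ (α / 2) / 2) • (Measure.dirac diagDir + Measure.dirac (-diagDir)) +
    ENNReal.ofReal (1 / 2) • (Measure.dirac vertDir + Measure.dirac (-vertDir))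

/-- The random vector `X = (1, 1) S₁ - (0, 1) S₂`. -/
def exampleVector {Ω : Type*} (S₁ S₂ : Ω → ℝ) (ω : Ω) : EuclideanSpace ℝ (Fin 2) :=
  S₁ ω • !₂[1, 1] - S₂ ω • !₂[0, 1]

/-- The set `E = {x | x₁ > 1, x₂ < 1}`. -/
def exampleSet : Set (EuclideanSpace ℝ (Fin 2)) := {x | 1 < x 0 ∧ x 1 < 1}

/-- The ball `B_ε` of radius `ε` around `(1, 1)` in the sup norm. -/
def supBall (ε : ℝ) : Set (EuclideanSpace ℝ (Fin 2)) := {x | ∀ i, |x i - 1| < ε}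

/-- `g⁺(α, ε) = L(Eᵒ ∪ B_ε, 1, α)`. -/
def gPlus (α ε : ℝ) : ℝ≥0∞ :=
  tailL (exampleSpectral α) (interior exampleSet ∪ supBall ε) 1 α

/-- `g⁻(α, ε) = L((E \ B_ε)ᵒ, 2, α)`. -/
def gMinus (α ε : ℝ) : ℝ≥0∞ :=
  tailL (exampleSpectral α) (interior (exampleSet \ supBall ε)) 2 α

/-- The constant `C_α² α Γ(2α) Γ(1 - α) / (4 Γ(1 + α))`, used for `0 < α < 1`. -/
def betaConst (α : ℝ) : ℝ :=
  stableTailConst α ^ 2 * α * Real.Gamma (2 * α) * Real.Gamma (1 - α) /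
    (4 * Real.Gamma (1 + α))

end

/-! ### Exponential substitution and contour shifts -/

/-! The whole theorem rests on one analytic input: `S_α` has a continuous density `f` with `f(x) ~
(α C_α / 2) x ^ (-(1 + α))` and a global bound of the same shape. Up to the factor `1 / π`, `x f(x)`
is the real part of `∫ e^{is} exp(-y s^α) ds` over `(0, ∞)` with `y = x ^ (-α)`. In the coordinate
`s = e^w`, rotating the ray of integration is a vertical shift of a horizontal line. At angle `π /
4` the factor `e^{is}` decays and `s^α` still has positive real part because `α < 2`, so the
integral may be expanded in `y`. The term of order zero is `i`, which has no real part. The term of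
order one is a rotated Gamma integral and produces `C_α` (`tendsto_stableIntegrand_expansion`,
`tendsto_rpow_mul_stableDensity`). Fourier inversion identifies `f` as the density
(`IsStdStable.eq_withDensity`).

Consequently `h ^ (1 + α) f(h a)` converges to the Lévy density and is dominated by a multiple of
it, uniformly in `h` (`tendsto_scaledDensity`, `exists_scaledDensity_le`). By dominated convergence,
an event described by `(S₁, S₂) / h ∈ A` has probability of order `h ^ (-2α)`, with constant the
product Lévy measure of `A`, as soon as that measure is finite (`tendsto_rpow_mul_stableLaw_prod`).

The event `X ∈ hE` says that `(S₁, S₂) / h` lies in the wedge `1 < a`, `b > a - 1`. The second jump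
may be arbitrarily small when `a` is close to `1`, and the Lévy mass of the wedge is an integral
with singularity `(a - 1) ^ (-α)` at `a = 1`. For `α < 1` it is a Beta integral equal to `K_α`. For
`α ≥ 1` it diverges, and the probability is governed by `S₁` landing just beyond the corner: with
overshoot `u = S₁ - h`, it is `∫ f(h + u) P(S > u) du`. The tail is integrable for `α > 1`, which
gives `E|S₁| / 2`. For `α = 1`, substituting `u = h ^ s` shows that all scales `0 < s < 1`
contribute equally, whence the logarithm (`tendsto_wedge_cauchy`).

In polar coordinates `L(F, 1, α)` and `L(F, 2, α)` become Lévy masses of single jumps and of pairs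
of jumps along the lines spanned by `(1, 1)` and `(0, -1)` (`tailL_example_one`,
`tailL_example_two`). The diagonal misses `E` but touches its closure at `(1, 1)`. A thickening of
`E` is therefore reached by one diagonal jump of size near `1` together with any of infinitely many
small ones, and `L` becomes infinite. Adding a ball at the corner lets a single jump suffice.
Removing the ball separates the set from the diagonal and forces the second jump to exceed `ε`,
which restores finiteness and continuity. -/

theorem integrableOn_Ioi_zero_iff_comp_exp {F : Type*} [NormedAddCommGroup F] [NormedSpace ℝ F]
    (g : ℝ → F) :
    IntegrableOn g (Ioi 0) ↔ Integrable (fun u : ℝ => Real.exp u • g (Real.exp u)) := by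
  have := integrableOn_image_iff_integrableOn_abs_deriv_smul (s := univ) MeasurableSet.univ
    (fun x _ => (Real.hasDerivAt_exp x).hasDerivWithinAt) Real.exp_injective.injOn g
  simpa [image_univ, Real.range_exp] using this

theorem integral_Ioi_zero_eq_comp_exp {F : Type*} [NormedAddCommGroup F] [NormedSpace ℝ F]
    (g : ℝ → F) :
    ∫ x in Ioi (0 : ℝ), g x = ∫ u : ℝ, Real.exp u • g (Real.exp u) := by
  have := integral_image_eq_integral_abs_deriv_smul (s := univ) MeasurableSet.univ
    (fun x _ => (Real.hasDerivAt_exp x).hasDerivWithinAt) Real.exp_injective.injOn g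
  simpa [image_univ, Real.range_exp] using this

theorem lintegral_Ioi_zero_eq_comp_exp (g : ℝ → ℝ≥0∞) :
    ∫⁻ x in Ioi (0 : ℝ), g x = ∫⁻ u : ℝ, ENNReal.ofReal (Real.exp u) * g (Real.exp u) := by
  have := lintegral_image_eq_lintegral_abs_deriv_mul (s := univ) MeasurableSet.univ
    (fun x _ => (Real.hasDerivAt_exp x).hasDerivWithinAt) Real.exp_injective.injOn g
  simpa [image_univ, Real.range_exp] using this

theorem integrableOn_rpow_mul_exp_neg_mul_rpow_Ioi {p q b : ℝ} (hp : 0 < p) (hq : -1 < q)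
    (hb : 0 < b) : IntegrableOn (fun x : ℝ => x ^ q * Real.exp (-b * x ^ p)) (Ioi 0) := by
  -- The Bochner integral of a non-integrable function is zero, so the nonzero Gamma value certifies
  -- integrability.
  apply Integrable.of_integral_ne_zero
  rw [integral_rpow_mul_exp_neg_mul_rpow hp hq hb]
  have h1 : 0 < (q + 1) / p := div_pos (by linarith) hp
  have := Real.Gamma_pos_of_pos h1
  positivity

/-- Functions of this form dominate every contour integrand below. Together with the two limits that
follow, this supplies the hypotheses of `integral_horizontal_eq_of_bound`. -/
theorem integrable_exp_mul_exp_neg_exp {p q b : ℝ} (hp : 0 < p) (hq : 0 < q) (hb : 0 < b) :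
    Integrable (fun u : ℝ => Real.exp (p * u) * Real.exp (-b * Real.exp (q * u))) := by
  have := (integrableOn_Ioi_zero_iff_comp_exp _).1
    (integrableOn_rpow_mul_exp_neg_mul_rpow_Ioi hq (q := p - 1) (by linarith) hb)
  refine this.congr (ae_of_all _ fun u => ?_)
  simp only [smul_eq_mul, ← Real.exp_mul]
  rw [← mul_assoc, ← Real.exp_add]
  congr 2 <;> ring_nf

theorem tendsto_exp_mul_exp_neg_exp_atTop {p q b : ℝ} (hq : 0 < q) (hb : 0 < b) :
    Tendsto (fun u : ℝ => Real.exp (p * u) * Real.exp (-b * Real.exp (q * u))) atTop (𝓝 0) := by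
  have h := (tendsto_rpow_mul_exp_neg_mul_atTop_nhds_zero (p / q) b hb).comp
    (Real.tendsto_exp_atTop.comp (tendsto_id.const_mul_atTop hq))
  refine h.congr fun u => ?_
  simp only [Function.comp_apply, id, ← Real.exp_mul]
  congr 2
  field_simp

theorem tendsto_exp_mul_exp_neg_exp_atBot {p q b : ℝ} (hp : 0 < p) (hb : 0 < b) :
    Tendsto (fun u : ℝ => Real.exp (p * u) * Real.exp (-b * Real.exp (q * u))) atBot (𝓝 0) := by
  refine squeeze_zero (fun u => by positivity) (fun u => ?_)
    (Real.tendsto_exp_atBot.comp (tendsto_id.const_mul_atBot hp))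
  simp only [Function.comp_apply, id]
  refine mul_le_of_le_one_right (Real.exp_pos _).le (Real.exp_le_one_iff.2 ?_)
  have := Real.exp_pos (q * u)
  nlinarith

/-- An entire function decaying at both ends of a horizontal strip has the same integral along both
edges of the strip. -/
theorem integral_horizontal_eq_of_bound {f : ℂ → ℂ} (hf : Differentiable ℂ f) {c d : ℝ}
    (hcd : c ≤ d) {b : ℝ → ℝ} (hb : Integrable b) (hbt : Tendsto b atTop (𝓝 0))
    (hbb : Tendsto b atBot (𝓝 0))
    (hfb : ∀ u t : ℝ, t ∈ Icc c d → ‖f (u + t * Complex.I)‖ ≤ b u) :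
    ∫ u : ℝ, f (u + c * Complex.I) = ∫ u : ℝ, f (u + d * Complex.I) := by
  have hint : ∀ t ∈ Icc c d, Integrable (fun u : ℝ => f (u + t * Complex.I)) := fun t ht =>
    hb.mono' (by
      have := hf.continuous
      exact Continuous.aestronglyMeasurable (by fun_prop)) (ae_of_all _ fun u => hfb u t ht)
  have hvert : ∀ {l : Filter ℝ} {g : ℝ → ℝ}, Tendsto (fun T => b (g T)) l (𝓝 0) →
      Tendsto (fun T : ℝ => Complex.I • ∫ y in c..d, f ((g T : ℝ) + y * Complex.I)) l (𝓝 0) := by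
    intro l g hg
    rw [← smul_zero Complex.I]
    refine Tendsto.const_smul ?_ _
    refine squeeze_zero_norm (a := fun T => b (g T) * |d - c|) (fun T => ?_) (by simpa using hg.mul_const |d - c|)
    refine intervalIntegral.norm_integral_le_of_norm_le_const fun y hy => hfb _ _ ?_
    rw [uIoc_of_le hcd] at hy
    exact ⟨hy.1.le, hy.2⟩
  have h1 := intervalIntegral_tendsto_integral (hint c (left_mem_Icc.2 hcd))
    tendsto_neg_atTop_atBot tendsto_id
  have h2 := intervalIntegral_tendsto_integral (hint d (right_mem_Icc.2 hcd))
    tendsto_neg_atTop_atBot tendsto_id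
  have h3 := hvert (l := atTop) (g := fun T => T) hbt
  have h4 := hvert (l := atTop) (g := fun T => -T) (hbb.comp tendsto_neg_atTop_atBot)
  have h5 := ((h1.sub h2).add h3).sub h4
  -- The limit in `h5` is that of the four sides of the rectangle with corners `-T + ic` and `T +
  -- id`, whose sum vanishes for every `T` by Cauchy's theorem.
  have h6 : ∀ T : ℝ, _ := fun T => Complex.integral_boundary_rect_eq_zero_of_differentiableOn f
    (⟨-T, c⟩ : ℂ) (⟨T, d⟩ : ℂ) hf.differentiableOn
  simp only [id] at h5
  have h7 := h5.congr h6
  have := tendsto_nhds_unique h7 tendsto_const_nhds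
  rw [add_zero, sub_zero, sub_eq_zero] at this
  exact this

/-- Mean value inequality on the convex half-plane `Re ≤ 0`, where the derivative of `exp` has norm
at most one. It controls difference quotients in the damping parameter. -/
theorem norm_exp_sub_one_le_norm_of_re_nonpos {z : ℂ} (hz : z.re ≤ 0) :
    ‖Complex.exp z - 1‖ ≤ ‖z‖ := by
  have := (convex_halfSpace_re_le (0 : ℝ)).norm_image_sub_le_of_norm_deriv_le
    (f := Complex.exp) (C := 1) (x := 0) (y := z) (fun x _ => Complex.differentiableAt_exp)
    (fun x hx => by
      rw [Complex.deriv_exp, Complex.norm_exp]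
      exact Real.exp_le_one_iff.2 hx) (by simp) hz
  simpa using this

/-! ### The oscillatory integral behind the stable density -/

theorem norm_cexp_exp_horizontal (p u t : ℝ) :
    ‖Complex.exp (p * (u + t * Complex.I))‖ = Real.exp (p * u) := by
  rw [Complex.norm_exp]; simp

/-- The line at height `t` is the ray at angle `t`, and `e^{is}` decays there at rate `sin t`. -/
theorem norm_cexp_I_mul_exp_horizontal (u t : ℝ) :
    ‖Complex.exp (Complex.I * Complex.exp (u + t * Complex.I))‖ =
      Real.exp (-Real.sin t * Real.exp u) := by
  rw [Complex.norm_exp, Complex.I_mul_re, Complex.exp_im]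
  simp [mul_comm]

theorem re_cexp_horizontal (a u t : ℝ) :
    (Complex.exp (a * (u + t * Complex.I))).re = Real.exp (a * u) * Real.cos (a * t) := by
  rw [Complex.exp_re]; simp

theorem half_le_sin_of_mem {t : ℝ} (ht : t ∈ Icc (Real.pi / 4) (Real.pi / 2)) :
    1 / 2 ≤ Real.sin t := by
  rw [← Real.sin_pi_div_six]
  have := Real.pi_pos
  apply Real.sin_le_sin_of_le_of_le_pi_div_two <;> linarith [ht.1, ht.2]

theorem norm_gamma_integrand_le (p u t : ℝ) (ht : t ∈ Icc (Real.pi / 4) (Real.pi / 2)) :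
    ‖Complex.exp (p * (u + t * Complex.I)) *
        Complex.exp (Complex.I * Complex.exp (u + t * Complex.I))‖ ≤
      Real.exp (p * u) * Real.exp (-(1 / 2) * Real.exp (1 * u)) := by
  rw [norm_mul, norm_cexp_exp_horizontal, norm_cexp_I_mul_exp_horizontal, one_mul]
  gcongr
  exact half_le_sin_of_mem ht

/-- The rotated Gamma integral in exponential coordinates. -/
theorem integral_rotated_gamma {p : ℝ} (hp : 0 < p) :
    ∫ u : ℝ, Complex.exp (p * (u + (Real.pi / 4 : ℝ) * Complex.I)) *
        Complex.exp (Complex.I * Complex.exp (u + (Real.pi / 4 : ℝ) * Complex.I)) =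
      Complex.exp (p * (Real.pi / 2 : ℝ) * Complex.I) * Real.Gamma p := by
  have hpi := Real.pi_pos
  -- At height `π / 2` one has `i e^w = -e^u`, so the integrand is the real Gamma integrand times a
  -- constant phase.
  rw [integral_horizontal_eq_of_bound (c := Real.pi / 4) (d := Real.pi / 2)
    (f := fun w => Complex.exp (p * w) * Complex.exp (Complex.I * Complex.exp w))
    (by fun_prop) (by linarith)
    (integrable_exp_mul_exp_neg_exp hp one_pos (half_pos one_pos))
    (tendsto_exp_mul_exp_neg_exp_atTop one_pos (half_pos one_pos))
    (tendsto_exp_mul_exp_neg_exp_atBot hp (half_pos one_pos))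
    (fun u t ht => norm_gamma_integrand_le p u t ht)]
  rw [Real.Gamma_eq_integral hp, integral_Ioi_zero_eq_comp_exp, ← integral_complex_ofReal,
    ← integral_const_mul]
  congr 1; ext u
  have h1 : Complex.exp (u + (Real.pi / 2 : ℝ) * Complex.I) = Complex.I * Real.exp u := by
    rw [Complex.exp_add, Complex.ofReal_div, Complex.ofReal_ofNat, Complex.exp_pi_div_two_mul_I]
    push_cast; ring
  rw [h1, ← mul_assoc, Complex.I_mul_I, mul_add, Complex.exp_add]
  simp only [smul_eq_mul, ← Real.exp_mul]
  rw [mul_left_comm (Real.exp u), ← Real.exp_add]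
  push_cast
  rw [show (u : ℂ) + u * (p - 1) = p * u by ring, show (-1 : ℂ) * Complex.exp u = - Complex.exp u by ring]
  ring_nf

/-- The integrand of the oscillatory integral, in exponential coordinates. -/
noncomputable def stableIntegrand (α y : ℝ) (w : ℂ) : ℂ :=
  Complex.exp w * Complex.exp (Complex.I * Complex.exp w) *
    Complex.exp (-(y * Complex.exp (α * w)))

/-- Between the angles `0` and `π / 4` the decay must come from the damping factor, since `e^{is}`
does not decay at angle `0`. As `α π / 4 < π / 2`, the cosine `cos (α t)` stays above `cos (α π / 4)
> 0`. The bound degenerates as `y → 0`, so it serves only to move the contour. -/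
theorem norm_stableIntegrand_le {α y : ℝ} (h0 : 0 < α) (h2 : α < 2) (hy : 0 < y) (u t : ℝ)
    (ht : t ∈ Icc 0 (Real.pi / 4)) :
    ‖stableIntegrand α y (u + t * Complex.I)‖ ≤
      Real.exp (1 * u) * Real.exp (-(y * Real.cos (α * (Real.pi / 4))) * Real.exp (α * u)) := by
  have hpi := Real.pi_pos
  have hsin : 0 ≤ Real.sin t := Real.sin_nonneg_of_nonneg_of_le_pi ht.1 (by linarith [ht.2])
  have hcos : Real.cos (α * (Real.pi / 4)) ≤ Real.cos (α * t) := by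
    apply Real.cos_le_cos_of_nonneg_of_le_pi
    · exact mul_nonneg h0.le ht.1
    · nlinarith
    · exact mul_le_mul_of_nonneg_left ht.2 h0.le
  have e1 := norm_cexp_exp_horizontal 1 u t
  rw [Complex.ofReal_one, one_mul] at e1
  rw [stableIntegrand, norm_mul, norm_mul, e1, norm_cexp_I_mul_exp_horizontal, Complex.norm_exp,
    Complex.neg_re, Complex.re_ofReal_mul, re_cexp_horizontal]
  have e2 : Real.exp (-Real.sin t * Real.exp u) ≤ 1 := Real.exp_le_one_iff.2 (by
    have := Real.exp_pos u; nlinarith)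
  have e3 : Real.exp (-(y * (Real.exp (α * u) * Real.cos (α * t)))) ≤
      Real.exp (-(y * Real.cos (α * (Real.pi / 4))) * Real.exp (α * u)) := by
    apply Real.exp_le_exp.2
    have := mul_le_mul_of_nonneg_left hcos (mul_pos hy (Real.exp_pos (α * u))).le
    nlinarith
  exact mul_le_mul (mul_le_of_le_one_right (Real.exp_pos _).le e2) e3 (Real.exp_pos _).le
    (Real.exp_pos _).le

theorem cos_mul_pi_div_four_pos {α : ℝ} (h0 : 0 < α) (h2 : α < 2) :
    0 < Real.cos (α * (Real.pi / 4)) := by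
  have hpi := Real.pi_pos
  apply Real.cos_pos_of_mem_Ioo
  constructor <;> nlinarith

theorem differentiable_stableIntegrand (α y : ℝ) : Differentiable ℂ (stableIntegrand α y) := by
  unfold stableIntegrand; fun_prop

theorem integrable_stableIntegrand {α y : ℝ} (h0 : 0 < α) (h2 : α < 2) (hy : 0 < y) {t : ℝ}
    (ht : t ∈ Icc 0 (Real.pi / 4)) :
    Integrable (fun u : ℝ => stableIntegrand α y (u + t * Complex.I)) :=
  (integrable_exp_mul_exp_neg_exp one_pos h0
    (mul_pos hy (cos_mul_pi_div_four_pos h0 h2))).mono' (by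
      have := (differentiable_stableIntegrand α y).continuous
      exact Continuous.aestronglyMeasurable (by fun_prop))
    (ae_of_all _ fun u => norm_stableIntegrand_le h0 h2 hy u t ht)

theorem integral_stableIntegrand_eq {α y : ℝ} (h0 : 0 < α) (h2 : α < 2) (hy : 0 < y) :
    ∫ u : ℝ, stableIntegrand α y u =
      ∫ u : ℝ, stableIntegrand α y (u + (Real.pi / 4 : ℝ) * Complex.I) := by
  have hk := mul_pos hy (cos_mul_pi_div_four_pos h0 h2)
  have := integral_horizontal_eq_of_bound (differentiable_stableIntegrand α y) (c := 0)
    (d := Real.pi / 4) (by have := Real.pi_pos; linarith)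
    (integrable_exp_mul_exp_neg_exp one_pos h0 hk)
    (tendsto_exp_mul_exp_neg_exp_atTop h0 hk)
    (tendsto_exp_mul_exp_neg_exp_atBot one_pos hk)
    (fun u t ht => norm_stableIntegrand_le h0 h2 hy u t ht)
  simpa using this

/-- First-order expansion of the oscillatory integral as the damping parameter tends to `0`. -/
theorem tendsto_stableIntegrand_expansion {α : ℝ} (h0 : 0 < α) (h2 : α < 2) :
    Tendsto (fun y : ℝ => ((∫ u : ℝ, stableIntegrand α y u) - Complex.I) / y) (𝓝[>] 0)
      (𝓝 (-(Complex.exp ((1 + α : ℝ) * (Real.pi / 2 : ℝ) * Complex.I) *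
        Real.Gamma (1 + α)))) := by
  have hpi := Real.pi_pos
  have hmem : Real.pi / 4 ∈ Icc 0 (Real.pi / 4) := ⟨by linarith, le_rfl⟩
  have hmem' : Real.pi / 4 ∈ Icc (Real.pi / 4) (Real.pi / 2) := ⟨le_rfl, by linarith⟩
  set W : ℝ → ℂ := fun u => u + (Real.pi / 4 : ℝ) * Complex.I with hW
  have hWc : Continuous W := by fun_prop
  have hI : ∫ u : ℝ, Complex.exp (W u) * Complex.exp (Complex.I * Complex.exp (W u)) = Complex.I := by
    have := integral_rotated_gamma one_pos
    simp only [Complex.ofReal_one, one_mul, Real.Gamma_one, mul_one] at this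
    rw [this]
    push_cast
    exact Complex.exp_pi_div_two_mul_I
  have hIint : Integrable (fun u : ℝ => Complex.exp (W u) *
      Complex.exp (Complex.I * Complex.exp (W u))) :=
    (integrable_exp_mul_exp_neg_exp one_pos one_pos (half_pos one_pos)).mono'
      (Continuous.aestronglyMeasurable (by fun_prop))
      (ae_of_all _ fun u => by
        have := norm_gamma_integrand_le 1 u _ hmem'
        rwa [Complex.ofReal_one, one_mul] at this)
  -- `I` is the undamped integral along the rotated ray, so subtracting it leaves a difference
  -- quotient in `y` under the integral sign.
  have key : ∀ y : ℝ, 0 < y → ((∫ u : ℝ, stableIntegrand α y u) - Complex.I) / y =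
      ∫ u : ℝ, Complex.exp (W u) * Complex.exp (Complex.I * Complex.exp (W u)) *
        ((Complex.exp (-(y * Complex.exp (α * W u))) - 1) / y) := by
    intro y hy
    have hsub := integral_sub (integrable_stableIntegrand h0 h2 hy hmem) hIint
    rw [hI] at hsub
    rw [integral_stableIntegrand_eq h0 h2 hy, ← hsub, ← integral_div]
    congr 1; ext u
    simp only [stableIntegrand]
    ring
  have hlim : -(Complex.exp ((1 + α : ℝ) * (Real.pi / 2 : ℝ) * Complex.I) *
        Real.Gamma (1 + α)) = ∫ u : ℝ, Complex.exp (W u) *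
          Complex.exp (Complex.I * Complex.exp (W u)) * (-Complex.exp (α * W u)) := by
    rw [← integral_rotated_gamma (by linarith : 0 < 1 + α), ← integral_neg]
    congr 1; ext u
    simp only [hW]
    rw [Complex.ofReal_add, add_mul, Complex.exp_add, Complex.ofReal_one, one_mul]
    ring
  rw [hlim]
  refine Tendsto.congr' (eventually_nhdsWithin_of_forall fun y hy => (key y hy).symm) ?_
  -- On the rotated ray `e^{is}` itself decays, and the difference quotient is at most `|s|^α`. The
  -- majorant is therefore independent of `y`.
  refine tendsto_integral_filter_of_dominated_convergence
    (fun u => Real.exp ((1 + α) * u) * Real.exp (-(1 / 2) * Real.exp (1 * u))) ?_ ?_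
    (integrable_exp_mul_exp_neg_exp (by linarith) one_pos (half_pos one_pos)) ?_
  · exact Eventually.of_forall fun y => Continuous.aestronglyMeasurable (by fun_prop)
  · refine eventually_nhdsWithin_of_forall fun y hy => ae_of_all _ fun u => ?_
    have hy : 0 < y := hy
    have h1 := norm_gamma_integrand_le 1 u _ hmem'
    rw [Complex.ofReal_one, one_mul, one_mul] at h1
    have h2' : ‖(Complex.exp (-(y * Complex.exp (α * W u))) - 1) / y‖ ≤ Real.exp (α * u) := by
      rw [norm_div, Complex.norm_real, Real.norm_of_nonneg hy.le, div_le_iff₀ hy]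
      refine (norm_exp_sub_one_le_norm_of_re_nonpos ?_).trans ?_
      · rw [Complex.neg_re, Complex.re_ofReal_mul, re_cexp_horizontal]
        have := cos_mul_pi_div_four_pos h0 h2
        have := Real.exp_pos (α * u)
        rw [neg_nonpos]; positivity
      · rw [norm_neg, norm_mul, norm_cexp_exp_horizontal, Complex.norm_real,
          Real.norm_of_nonneg hy.le, mul_comm]
    rw [norm_mul]
    refine (mul_le_mul h1 h2' (norm_nonneg _) (by positivity)).trans (le_of_eq ?_)
    rw [add_mul, Real.exp_add, one_mul]; ring
  · refine ae_of_all _ fun u => Tendsto.const_mul _ ?_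
    have hd : HasDerivAt (fun y : ℝ => Complex.exp (-(y * Complex.exp (α * W u))))
        (-Complex.exp (α * W u)) 0 := by
      have h := (((hasDerivAt_id (0 : ℝ)).ofReal_comp.mul_const (Complex.exp (α * W u))).neg).cexp
      simpa using h
    have := hd.tendsto_slope_zero_right
    refine this.congr fun y => ?_
    simp [div_eq_inv_mul]

/-! ### The density of the standard symmetric stable law -/

/-- The density of `S_α`, as an inverse Fourier integral. -/
noncomputable def stableDensity (α x : ℝ) : ℝ :=
  (2 * Real.pi)⁻¹ * ∫ t : ℝ, Real.cos (t * x) * Real.exp (-|t| ^ α)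

theorem integrable_comp_abs_of_Ioi {f : ℝ → ℝ} (hf : IntegrableOn f (Ioi 0)) :
    Integrable fun x : ℝ => f |x| := by
  have h1 : IntegrableOn (fun x : ℝ => f |x|) (Ioi 0) :=
    hf.congr_fun (fun x hx => by rw [abs_of_pos hx]) measurableSet_Ioi
  have h2 : IntegrableOn (fun x : ℝ => f |x|) (Iic 0) := by
    have := ((integrableOn_Ici_iff_integrableOn_Ioi (by simp)).2 h1).comp_neg
    simpa using this
  rw [← integrableOn_univ, ← Iic_union_Ioi (a := (0 : ℝ))]
  exact h2.union h1

theorem integrable_exp_neg_abs_rpow {α : ℝ} (h0 : 0 < α) :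
    Integrable (fun t : ℝ => Real.exp (-|t| ^ α)) := by
  have h := integrableOn_rpow_mul_exp_neg_mul_rpow_Ioi h0 (q := 0) (b := 1) (by norm_num) one_pos
  simp only [Real.rpow_zero, one_mul, neg_mul] at h
  exact (integrable_comp_abs_of_Ioi (f := fun t => Real.exp (-t ^ α)) h)

theorem continuous_exp_neg_abs_rpow {α : ℝ} (h0 : 0 < α) :
    Continuous (fun t : ℝ => Real.exp (-|t| ^ α)) :=
  Real.continuous_exp.comp (continuous_abs.rpow_const fun _ => Or.inr h0.le).neg

theorem norm_cos_mul_exp_le (α t x : ℝ) :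
    ‖Real.cos (t * x) * Real.exp (-|t| ^ α)‖ ≤ Real.exp (-|t| ^ α) := by
  rw [norm_mul, Real.norm_of_nonneg (Real.exp_pos _).le]
  exact mul_le_of_le_one_left (Real.exp_pos _).le (Real.abs_cos_le_one _)

theorem stableDensity_neg (α x : ℝ) : stableDensity α (-x) = stableDensity α x := by
  simp [stableDensity]

theorem continuous_stableDensity {α : ℝ} (h0 : 0 < α) : Continuous (stableDensity α) := by
  refine continuous_const.mul (continuous_of_dominated (fun x => ?_)
    (fun x => ae_of_all _ fun t => norm_cos_mul_exp_le α t x) (integrable_exp_neg_abs_rpow h0)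
    (ae_of_all _ fun t => by fun_prop))
  have := continuous_exp_neg_abs_rpow h0
  exact Continuous.aestronglyMeasurable (by fun_prop)

/-- The scaling `s = t x` moves the dependence on `x` into the damping parameter `x ^ (-α)`, turning
`x → ∞` into a limit at zero damping. -/
theorem mul_stableDensity_eq {α x : ℝ} (h0 : 0 < α) (h2 : α < 2) (hx : 0 < x) :
    x * stableDensity α x = Real.pi⁻¹ * (∫ u : ℝ, stableIntegrand α (x ^ (-α)) u).re := by
  have hy : 0 < x ^ (-α) := Real.rpow_pos_of_pos hx _
  have h1 : (∫ t : ℝ, Real.cos (t * x) * Real.exp (-|t| ^ α)) =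
      2 * ∫ t in Ioi (0 : ℝ), Real.cos (t * x) * Real.exp (-t ^ α) := by
    rw [← integral_comp_abs]
    congr 1; ext t
    congr 1
    rcases abs_cases t with h | h <;> simp [h.1]
  have h3 : (∫ t in Ioi (0 : ℝ), Real.cos (t * x) * Real.exp (-t ^ α)) =
      x⁻¹ * ∫ s in Ioi (0 : ℝ), Real.cos s * Real.exp (-(x ^ (-α) * s ^ α)) := by
    have := integral_comp_mul_right_Ioi
      (fun s => Real.cos s * Real.exp (-(x ^ (-α) * s ^ α))) 0 hx
    rw [zero_mul, smul_eq_mul] at this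
    rw [← this]
    refine setIntegral_congr_fun measurableSet_Ioi fun t ht => ?_
    rw [Real.mul_rpow (le_of_lt ht) hx.le, mul_left_comm, ← Real.rpow_add hx]
    simp
  have h4 : (∫ u : ℝ, stableIntegrand α (x ^ (-α)) u).re =
      ∫ s in Ioi (0 : ℝ), Real.cos s * Real.exp (-(x ^ (-α) * s ^ α)) := by
    have hint := integrable_stableIntegrand h0 h2 hy (t := 0)
      ⟨le_rfl, by have := Real.pi_pos; linarith⟩
    simp only [Complex.ofReal_zero, zero_mul, add_zero] at hint
    have := integral_re hint
    simp only [RCLike.re_eq_complex_re] at this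
    rw [← this, integral_Ioi_zero_eq_comp_exp]
    congr 1; ext u
    have e1 : stableIntegrand α (x ^ (-α)) u = (Real.exp u *
        Real.exp (-(x ^ (-α) * Real.exp (α * u))) : ℝ) *
          Complex.exp ((Real.exp u : ℝ) * Complex.I) := by
      simp only [stableIntegrand]; push_cast; ring_nf
    rw [e1, Complex.re_ofReal_mul, Complex.exp_ofReal_mul_I_re, smul_eq_mul, ← Real.exp_mul,
      mul_comm α u]
    ring
  rw [stableDensity, h1, h3, h4]
  field_simp

theorem half_stableTailConst_mul {α : ℝ} (h0 : 0 < α) :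
    stableTailConst α / 2 * α = Real.pi⁻¹ * (Real.sin (Real.pi * α / 2) * Real.Gamma (1 + α)) := by
  rw [stableTailConst, add_comm, Real.Gamma_add_one h0.ne']
  field_simp

theorem stableTailConst_pos {α : ℝ} (h0 : 0 < α) (h2 : α < 2) : 0 < stableTailConst α := by
  have hpi := Real.pi_pos
  have h1 := Real.Gamma_pos_of_pos h0
  have : 0 < Real.sin (Real.pi * α / 2) := Real.sin_pos_of_pos_of_lt_pi (by positivity) (by nlinarith)
  unfold stableTailConst
  positivity

/-- The stable density is asymptotic to `(α C_α / 2) x ^ (-(1 + α))`. -/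
theorem tendsto_rpow_mul_stableDensity {α : ℝ} (h0 : 0 < α) (h2 : α < 2) :
    Tendsto (fun x : ℝ => x ^ (1 + α) * stableDensity α x) atTop
      (𝓝 (stableTailConst α / 2 * α)) := by
  have hy : Tendsto (fun x : ℝ => x ^ (-α)) atTop (𝓝[>] 0) :=
    tendsto_nhdsWithin_iff.2 ⟨tendsto_rpow_neg_atTop h0,
      (eventually_gt_atTop 0).mono fun x hx => Real.rpow_pos_of_pos hx _⟩
  have h := ((Complex.continuous_re.tendsto _).comp
    ((tendsto_stableIntegrand_expansion h0 h2).comp hy)).const_mul Real.pi⁻¹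
  -- Since `cos (πα / 2 + π / 2) = -sin (πα / 2)`, the sign of the first-order term becomes
  -- positive.
  have hval : (-(Complex.exp ((1 + α : ℝ) * (Real.pi / 2 : ℝ) * Complex.I) *
        Real.Gamma (1 + α))).re = Real.sin (Real.pi * α / 2) * Real.Gamma (1 + α) := by
    rw [Complex.neg_re, Complex.re_mul_ofReal, ← Complex.ofReal_mul, Complex.exp_ofReal_mul_I_re,
      show (1 + α) * (Real.pi / 2) = Real.pi * α / 2 + Real.pi / 2 by ring,
      Real.cos_add_pi_div_two]
    ring
  rw [hval, ← half_stableTailConst_mul h0] at h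
  refine h.congr' ((eventually_gt_atTop 0).mono fun x hx => ?_)
  simp only [Function.comp_apply]
  rw [Complex.div_ofReal_re, Complex.sub_re, Complex.I_re, sub_zero, ← mul_div_assoc,
    ← mul_stableDensity_eq h0 h2 hx, Real.rpow_add hx, Real.rpow_one, Real.rpow_neg hx.le]
  field_simp

/-- Far out the asymptotics give the power bound. Up to the threshold `N'` the uniform Fourier bound
suffices, because `N' ^ (1 + α) * x ^ (-(1 + α)) ≥ 1` there. -/
theorem exists_abs_stableDensity_le {α : ℝ} (h0 : 0 < α) (h2 : α < 2) :
    ∃ M : ℝ, 0 < M ∧ (∀ x, |stableDensity α x| ≤ M) ∧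
      ∀ x, x ≠ 0 → |stableDensity α x| ≤ M * |x| ^ (-(1 + α)) := by
  set A := (2 * Real.pi)⁻¹ * ∫ t : ℝ, Real.exp (-|t| ^ α) with hA
  have hpi := Real.pi_pos
  have hA0 : 0 ≤ A := mul_nonneg (by positivity) (integral_nonneg fun t => (Real.exp_pos _).le)
  have hbd : ∀ x, |stableDensity α x| ≤ A := fun x => by
    rw [stableDensity, abs_mul, abs_of_pos (by positivity : 0 < (2 * Real.pi)⁻¹), hA]
    gcongr
    exact norm_integral_le_of_norm_le (integrable_exp_neg_abs_rpow h0)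
      (ae_of_all _ fun t => norm_cos_mul_exp_le α t x)
  have hev := (tendsto_rpow_mul_stableDensity h0 h2).abs.eventually_le_const
    (lt_add_one |stableTailConst α / 2 * α|)
  obtain ⟨N, hN⟩ := eventually_atTop.1 hev
  set N' := max N 1
  set B := |stableTailConst α / 2 * α| + 1
  have hB : 0 < B := by positivity
  have hN'0 : 0 < N' := lt_of_lt_of_le one_pos (le_max_right _ _)
  have hpos : ∀ x, 0 < x → |stableDensity α x| ≤ (A + B + A * N' ^ (1 + α)) * x ^ (-(1 + α)) := by
    intro x hx
    have hxp : 0 < x ^ (-(1 + α)) := Real.rpow_pos_of_pos hx _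
    have hNp : 0 < N' ^ (1 + α) := Real.rpow_pos_of_pos hN'0 _
    rcases le_total N' x with h | h
    · have h3 := hN x ((le_max_left _ _).trans h)
      have hp : 0 < x ^ (1 + α) := Real.rpow_pos_of_pos hx _
      rw [abs_mul, abs_of_pos hp] at h3
      have h4 : |stableDensity α x| ≤ B * x ^ (-(1 + α)) := by
        rw [Real.rpow_neg hx.le, ← div_eq_mul_inv, le_div_iff₀ hp]; linarith
      refine h4.trans ?_
      gcongr
      nlinarith [mul_nonneg hA0 hNp.le]
    · have h4 : 1 ≤ N' ^ (1 + α) * x ^ (-(1 + α)) := by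
        rw [Real.rpow_neg hx.le, ← div_eq_mul_inv, one_le_div (Real.rpow_pos_of_pos hx _)]
        exact Real.rpow_le_rpow hx.le h (by linarith)
      calc |stableDensity α x| ≤ A * 1 := by rw [mul_one]; exact hbd x
        _ ≤ A * (N' ^ (1 + α) * x ^ (-(1 + α))) := by gcongr
        _ ≤ _ := by nlinarith [mul_nonneg hA0 hxp.le, mul_nonneg hB.le hxp.le]
  have hNp : 0 < N' ^ (1 + α) := Real.rpow_pos_of_pos hN'0 _
  refine ⟨A + B + A * N' ^ (1 + α), by positivity, fun x => (hbd x).trans ?_, fun x hx => ?_⟩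
  · nlinarith [mul_nonneg hA0 hNp.le]
  · rcases abs_cases x with h | h
    · rw [h.1]; exact hpos x (lt_of_le_of_ne h.2 hx.symm)
    · rw [h.1, ← stableDensity_neg]; exact hpos (-x) (by linarith)

theorem integrable_of_abs_le_rpow {f : ℝ → ℝ} {M s : ℝ} (hf : AEStronglyMeasurable f)
    (hs : s < -1) (h1 : ∀ x, |f x| ≤ M) (h2 : ∀ x, x ≠ 0 → |f x| ≤ M * |x| ^ s) :
    Integrable f := by
  have hg : Integrable (fun x : ℝ => if |x| ≤ 1 then M else M * |x| ^ s) := by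
    refine (integrable_comp_abs_of_Ioi (f := fun x => if x ≤ 1 then M else M * x ^ s) ?_)
    rw [← Ioc_union_Ioi_eq_Ioi (zero_le_one' ℝ)]
    refine IntegrableOn.union ?_ ?_
    · refine (integrableOn_const (C := M) (by simp)).congr_fun (fun x hx => ?_) measurableSet_Ioc
      simp [hx.2]
    · refine IntegrableOn.congr_fun (f := fun x => M * x ^ s)
        (((integrableOn_Ioi_rpow_iff one_pos).2 hs).const_mul M) (fun x hx => ?_) measurableSet_Ioi
      simp [not_le.2 (mem_Ioi.1 hx)]
  refine hg.mono' hf (ae_of_all _ fun x => ?_)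
  rw [Real.norm_eq_abs]
  split_ifs with h
  · exact h1 x
  · exact h2 x (by rintro rfl; simp at h)

theorem integrable_stableDensity {α : ℝ} (h0 : 0 < α) (h2 : α < 2) :
    Integrable (stableDensity α) := by
  obtain ⟨M, -, h3, h4⟩ := exists_abs_stableDensity_le h0 h2
  exact integrable_of_abs_le_rpow (continuous_stableDensity h0).aestronglyMeasurable
    (by linarith) h3 h4

/-- Fourier inversion for the stable density. -/
theorem integral_cexp_mul_stableDensity {α : ℝ} (h0 : 0 < α) (h2 : α < 2) (t : ℝ) :
    ∫ x : ℝ, Complex.exp (t * x * Complex.I) * stableDensity α x =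
      Complex.exp (-((|t| ^ α : ℝ) : ℂ)) := by
  have hpi := Real.pi_pos
  set φ : ℝ → ℂ := fun t => (Real.exp (-|t| ^ α) : ℝ) with hφ
  have hφi : Integrable φ := (integrable_exp_neg_abs_rpow h0).ofReal
  have hφc : Continuous φ := Complex.continuous_ofReal.comp (continuous_exp_neg_abs_rpow h0)
  have hint : ∀ a : ℝ, Integrable (fun v : ℝ => Complex.exp ((a * v : ℝ) * Complex.I) * φ v) := by
    intro a
    refine hφi.bdd_mul (c := 1) (Continuous.aestronglyMeasurable (by fun_prop))
      (ae_of_all _ fun v => ?_)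
    rw [Complex.norm_exp_ofReal_mul_I]
  have hre : ∀ a : ℝ, ∫ v : ℝ, Complex.exp ((a * v : ℝ) * Complex.I) * φ v =
      ((2 * Real.pi * stableDensity α a : ℝ) : ℂ) := by
    intro a
    set J := ∫ v : ℝ, Complex.exp ((a * v : ℝ) * Complex.I) * φ v with hJ
    -- The reflection `v ↦ -v` conjugates the exponential and preserves the even function `φ`, so
    -- the integral is real.
    have hconj : (starRingEnd ℂ) J = J := by
      rw [hJ, ← integral_conj, ← integral_neg_eq_self]
      congr 1; ext v
      simp only [hφ, map_mul, Complex.conj_ofReal, ← Complex.exp_conj, Complex.conj_I, abs_neg]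
      push_cast; ring_nf
    have hJre : J.re = 2 * Real.pi * stableDensity α a := by
      have := integral_re (hint a)
      simp only [RCLike.re_eq_complex_re] at this
      rw [hJ, ← this, stableDensity, ← mul_assoc, mul_inv_cancel₀ (by positivity), one_mul]
      congr 1; ext v
      simp only [hφ]
      rw [Complex.re_mul_ofReal, Complex.exp_ofReal_mul_I_re, mul_comm a v]
    rw [← hJre]
    exact (Complex.conj_eq_iff_re.1 hconj).symm
  have hF : FourierTransform.fourier φ =
      fun ξ : ℝ => ((2 * Real.pi * stableDensity α (2 * Real.pi * ξ) : ℝ) : ℂ) := by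
    ext ξ
    rw [Real.fourier_eq', ← stableDensity_neg, ← hre]
    congr 1; ext v
    simp only [smul_eq_mul]
    congr 4
    simp only [RCLike.inner_apply, conj_trivial]
    ring
  have hFi : Integrable (FourierTransform.fourier φ) := by
    rw [hF]
    exact (((integrable_stableDensity h0 h2).comp_mul_left'
      (by positivity : 2 * Real.pi ≠ 0)).const_mul _).ofReal
  have hinv := hφi.fourierInv_fourier_eq hFi (v := t) hφc.continuousAt
  rw [hF, Real.fourierInv_eq'] at hinv
  have hR : φ t = Complex.exp (-((|t| ^ α : ℝ) : ℂ)) := by simp [hφ]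
  rw [← hR, ← hinv]
  have := Measure.integral_comp_mul_left
    (fun x : ℝ => Complex.exp (t * x * Complex.I) * stableDensity α x) (2 * Real.pi)
  rw [abs_of_pos (by positivity), eq_inv_smul_iff₀ (by positivity)] at this
  rw [← this, ← integral_smul]
  congr 1; ext v
  simp only [smul_eq_mul, Complex.real_smul, RCLike.inner_apply, conj_trivial]
  push_cast
  ring_nf

theorem charFun_withDensity_ofReal {g : ℝ → ℝ} (hg : Measurable g) (hg0 : ∀ x, 0 ≤ g x) (t : ℝ) :
    charFun (volume.withDensity fun x => ENNReal.ofReal (g x)) t =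
      ∫ x : ℝ, Complex.exp (t * x * Complex.I) * g x := by
  rw [charFun_apply_real]
  have : (fun x => ENNReal.ofReal (g x)) = fun x => ((g x).toNNReal : ℝ≥0∞) := rfl
  rw [this, integral_withDensity_eq_integral_smul (by fun_prop)]
  congr 1; ext x
  rw [NNReal.smul_def, Real.coe_toNNReal _ (hg0 x), Complex.real_smul, mul_comm]

theorem isFiniteMeasure_withDensity_ofReal_of_integrable {g : ℝ → ℝ} (hg : Integrable g) :
    IsFiniteMeasure (volume.withDensity fun x => ENNReal.ofReal (g x)) :=
  isFiniteMeasure_withDensity_ofReal hg.2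

/-- The standard symmetric stable law has density `stableDensity α`. -/
theorem IsStdStable.eq_withDensity {α : ℝ} (h0 : 0 < α) (h2 : α < 2) {ν : Measure ℝ}
    (hν : IsStdStable α ν) :
    ν = volume.withDensity fun x => ENNReal.ofReal (stableDensity α x) := by
  obtain ⟨hprob, hchar⟩ := hν
  set f := stableDensity α
  have hfi : Integrable f := integrable_stableDensity h0 h2
  have hfc : Continuous f := continuous_stableDensity h0
  -- Nonnegativity of `f` is not known beforehand. Fourier inversion is read as the equality `ν + n
  -- dx = p dx` of finite measures. Evaluated on `{f < 0}`, where `p` vanishes, it shows that the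
  -- negative part is null.
  set p : ℝ → ℝ := fun x => max (f x) 0 with hp
  set n : ℝ → ℝ := fun x => max (-f x) 0 with hn
  have hpi : Integrable p := hfi.pos_part
  have hni : Integrable n := hfi.neg_part
  have hpm : Measurable p := by fun_prop
  have hnm : Measurable n := by fun_prop
  have := isFiniteMeasure_withDensity_ofReal_of_integrable hpi
  have := isFiniteMeasure_withDensity_ofReal_of_integrable hni
  have hexp : ∀ (t : ℝ) {g : ℝ → ℝ}, Integrable g →
      Integrable (fun x : ℝ => Complex.exp (t * x * Complex.I) * g x) := by
    intro t g hg
    refine hg.ofReal.bdd_mul (c := 1) (Continuous.aestronglyMeasurable (by fun_prop))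
      (ae_of_all _ fun v => ?_)
    rw [← Complex.ofReal_mul, Complex.norm_exp_ofReal_mul_I]
  have heq : ν + volume.withDensity (fun x => ENNReal.ofReal (n x)) =
      volume.withDensity (fun x => ENNReal.ofReal (p x)) := by
    apply Measure.ext_of_charFun
    ext t
    rw [charFun_withDensity_ofReal hpm fun x => le_max_right _ _]
    have hadd : charFun (ν + volume.withDensity (fun x => ENNReal.ofReal (n x))) t =
        charFun ν t + charFun (volume.withDensity (fun x => ENNReal.ofReal (n x))) t := by
      simp only [charFun_apply_real]
      have hbd : ∀ μ : Measure ℝ, IsFiniteMeasure μ →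
          Integrable (fun x : ℝ => Complex.exp (t * x * Complex.I)) μ := fun μ _ => by
        refine Integrable.of_bound (C := 1) (Continuous.aestronglyMeasurable (by fun_prop))
          (ae_of_all _ fun v => ?_)
        rw [← Complex.ofReal_mul, Complex.norm_exp_ofReal_mul_I]
      exact integral_add_measure (hbd _ inferInstance) (hbd _ inferInstance)
    rw [hadd, hchar, charFun_withDensity_ofReal hnm fun x => le_max_right _ _,
      ← integral_cexp_mul_stableDensity h0 h2 t, ← integral_add (hexp t hfi) (hexp t hni)]
    congr 1; ext x
    rw [← mul_add, ← Complex.ofReal_add]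
    congr 2
    simp only [hp, hn]
    rcases le_total (f x) 0 with h | h
    · rw [max_eq_left (by linarith), max_eq_right h]; ring
    · rw [max_eq_right (by linarith), max_eq_left h]; ring
  set A : Set ℝ := {x | f x < 0}
  have hA : MeasurableSet A := measurableSet_lt hfc.measurable measurable_const
  have h3 := congrArg (fun μ => μ A) heq
  simp only [Measure.add_apply] at h3
  have h4 : volume.withDensity (fun x => ENNReal.ofReal (p x)) A = 0 := by
    rw [withDensity_apply _ hA]
    refine (setLIntegral_congr_fun hA fun x hx => ?_).trans lintegral_zero
    simp only [hp]
    rw [max_eq_right (le_of_lt hx), ENNReal.ofReal_zero]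
  rw [h4, add_eq_zero] at h3
  have h5 : volume.withDensity (fun x => ENNReal.ofReal (n x)) = 0 := by
    rw [← Measure.measure_univ_eq_zero, ← union_compl_self A]
    refine measure_union_null h3.2 ?_
    rw [withDensity_apply _ hA.compl]
    refine (setLIntegral_congr_fun hA.compl fun x hx => ?_).trans lintegral_zero
    simp only [hn]
    rw [max_eq_right (by simpa [A] using hx), ENNReal.ofReal_zero]
  rw [h5, add_zero] at heq
  rw [heq]
  congr 1; ext x
  simp only [hp]
  rw [ENNReal.ofReal_max, ENNReal.ofReal_zero, max_eq_left zero_le]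

/-! ### The Lévy measure and the scaling limits of the stable law -/

/-- The density `(α C_α / 2) |a| ^ (-(1 + α))` of the Lévy measure of `S_α`. -/
noncomputable def levyDensity (α a : ℝ) : ℝ≥0∞ :=
  ENNReal.ofReal (stableTailConst α / 2 * α * |a| ^ (-(1 + α)))

/-- The Lévy measure of `S_α`. -/
noncomputable def levyMeasure (α : ℝ) : Measure ℝ := volume.withDensity (levyDensity α)

/-- The law `S_α`, given by its density. -/
noncomputable def stableLaw (α : ℝ) : Measure ℝ :=
  volume.withDensity fun x => ENNReal.ofReal (stableDensity α x)

/-- The density of `h⁻¹ S`, multiplied by `h ^ α`. -/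
noncomputable def scaledDensity (α h a : ℝ) : ℝ≥0∞ :=
  ENNReal.ofReal (h ^ (1 + α)) * ENNReal.ofReal (stableDensity α (h * a))

@[fun_prop]
theorem measurable_levyDensity (α : ℝ) : Measurable (levyDensity α) := by
  unfold levyDensity; fun_prop

theorem measurable_stableDensity {α : ℝ} (h0 : 0 < α) : Measurable (stableDensity α) :=
  (continuous_stableDensity h0).measurable

theorem measurable_scaledDensity {α : ℝ} (h0 : 0 < α) (h : ℝ) :
    Measurable (scaledDensity α h) := by
  have := measurable_stableDensity h0
  unfold scaledDensity; fun_prop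

theorem levyDensity_ne_top (α a : ℝ) : levyDensity α a ≠ ⊤ := ENNReal.ofReal_ne_top

theorem levyDensity_neg (α a : ℝ) : levyDensity α (-a) = levyDensity α a := by simp [levyDensity]

theorem levyDensity_pos {α : ℝ} (h0 : 0 < α) (h2 : α < 2) {a : ℝ} (ha : a ≠ 0) :
    0 < levyDensity α a := by
  have := stableTailConst_pos h0 h2
  have := Real.rpow_pos_of_pos (abs_pos.2 ha) (-(1 + α))
  exact ENNReal.ofReal_pos.2 (by positivity)

theorem levyDensity_one (α : ℝ) : levyDensity α 1 = ENNReal.ofReal (stableTailConst α / 2 * α) := by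
  simp [levyDensity]

theorem levyDensity_anti {α : ℝ} (h0 : 0 < α) (h2 : α < 2) {a b : ℝ} (ha : 0 < a) (hab : a ≤ b) :
    levyDensity α b ≤ levyDensity α a := by
  have := stableTailConst_pos h0 h2
  refine ENNReal.ofReal_le_ofReal (mul_le_mul_of_nonneg_left ?_ (by positivity))
  rw [abs_of_pos ha, abs_of_pos (ha.trans_le hab)]
  exact Real.rpow_le_rpow_of_nonpos ha hab (by linarith)

/-- The evaluation point is allowed to move with `h` because the overshoot arguments use `1 + u / h`
and `1 + h ^ (s - 1)`. -/
theorem tendsto_scaledDensity_of_pos {α : ℝ} (h0 : 0 < α) (h2 : α < 2) {a : ℝ → ℝ} {a₀ : ℝ}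
    (ha₀ : 0 < a₀) (ha : Tendsto a atTop (𝓝 a₀)) :
    Tendsto (fun h => scaledDensity α h (a h)) atTop (𝓝 (levyDensity α a₀)) := by
  have hpos : ∀ᶠ h in atTop, 0 < a h := ha.eventually (lt_mem_nhds ha₀)
  have h1 : Tendsto (fun h : ℝ => h * a h) atTop atTop := tendsto_id.atTop_mul_pos ha₀ ha
  have h3 := ENNReal.tendsto_ofReal (((tendsto_rpow_mul_stableDensity h0 h2).comp h1).mul
    (ha.rpow_const (p := -(1 + α)) (Or.inl ha₀.ne')))
  rw [levyDensity, abs_of_pos ha₀]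
  refine h3.congr' ?_
  filter_upwards [hpos, eventually_gt_atTop 0] with h hah hh
  rw [scaledDensity, ← ENNReal.ofReal_mul (by positivity)]
  congr 1
  simp only [Function.comp_apply]
  rw [Real.mul_rpow hh.le hah.le, Real.rpow_neg hah.le]
  have := (Real.rpow_pos_of_pos hah (1 + α)).ne'
  field_simp

theorem scaledDensity_neg (α h a : ℝ) : scaledDensity α h (-a) = scaledDensity α h a := by
  simp [scaledDensity, stableDensity_neg]

theorem tendsto_scaledDensity {α : ℝ} (h0 : 0 < α) (h2 : α < 2) {a : ℝ} (ha : a ≠ 0) :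
    Tendsto (fun h => scaledDensity α h a) atTop (𝓝 (levyDensity α a)) := by
  rcases lt_or_gt_of_ne ha with h | h
  · have := tendsto_scaledDensity_of_pos h0 h2 (neg_pos.2 h) (tendsto_const_nhds (x := -a))
    simpa only [scaledDensity_neg, levyDensity_neg] using this
  · exact tendsto_scaledDensity_of_pos h0 h2 h tendsto_const_nhds

/-- The power `|a| ^ (-(1 + α))` scales exactly like the prefactor, so the constant does not depend
on `h`. This is the domination behind the limit theorems below. -/
theorem exists_scaledDensity_le {α : ℝ} (h0 : 0 < α) (h2 : α < 2) :
    ∃ K : ℝ≥0∞, K ≠ ⊤ ∧ ∀ h, 0 < h → ∀ a, a ≠ 0 →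
      scaledDensity α h a ≤ K * levyDensity α a := by
  obtain ⟨M, hM, -, hle⟩ := exists_abs_stableDensity_le h0 h2
  have hc := stableTailConst_pos h0 h2
  refine ⟨ENNReal.ofReal (M / (stableTailConst α / 2 * α)), ENNReal.ofReal_ne_top,
    fun h hh a ha => ?_⟩
  rw [scaledDensity, levyDensity, ← ENNReal.ofReal_mul (by positivity),
    ← ENNReal.ofReal_mul (by positivity)]
  apply ENNReal.ofReal_le_ofReal
  have h1 := (le_abs_self _).trans (hle (h * a) (mul_ne_zero hh.ne' ha))
  rw [abs_mul, abs_of_pos hh, Real.mul_rpow hh.le (abs_nonneg a), Real.rpow_neg hh.le] at h1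
  have hp := Real.rpow_pos_of_pos hh (1 + α)
  calc h ^ (1 + α) * stableDensity α (h * a)
      ≤ h ^ (1 + α) * (M * ((h ^ (1 + α))⁻¹ * |a| ^ (-(1 + α)))) := by gcongr
    _ = _ := by field_simp

instance (α : ℝ) : SFinite (levyMeasure α) := by unfold levyMeasure; infer_instance

instance (α : ℝ) : SFinite (stableLaw α) := by unfold stableLaw; infer_instance

theorem levyMeasure_absolutelyContinuous (α : ℝ) : levyMeasure α ≪ volume :=
  withDensity_absolutelyContinuous _ _

instance (α : ℝ) : NullSingletonClass (levyMeasure α) :=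
  ⟨fun x => levyMeasure_absolutelyContinuous α (measure_singleton x)⟩

theorem levyMeasure_Ioi {α : ℝ} (h0 : 0 < α) (h2 : α < 2) {u : ℝ} (hu : 0 < u) :
    levyMeasure α (Ioi u) = ENNReal.ofReal (stableTailConst α / 2 * u ^ (-α)) := by
  have hc := stableTailConst_pos h0 h2
  rw [levyMeasure, withDensity_apply _ measurableSet_Ioi]
  have : ∫⁻ a in Ioi u, levyDensity α a =
      ∫⁻ a in Ioi u, ENNReal.ofReal (stableTailConst α / 2 * α * a ^ (-(1 + α))) :=
    setLIntegral_congr_fun measurableSet_Ioi fun a ha => by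
      simp only [levyDensity]
      rw [abs_of_pos (hu.trans ha)]
  rw [this, ← ofReal_integral_eq_lintegral_ofReal]
  · rw [integral_const_mul, integral_Ioi_rpow_of_lt (by linarith) hu]
    congr 1
    rw [show -(1 + α) + 1 = -α by ring]
    field_simp
  · exact ((integrableOn_Ioi_rpow_iff hu).2 (by linarith)).const_mul _
  · exact (ae_restrict_iff' measurableSet_Ioi).2 (ae_of_all _ fun a ha => by
      have := Real.rpow_pos_of_pos (hu.trans ha) (-(1 + α))
      positivity)

theorem levyMeasure_neg_preimage (α : ℝ) {s : Set ℝ} (hs : MeasurableSet s) :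
    levyMeasure α (Neg.neg ⁻¹' s) = levyMeasure α s := by
  have hm : MeasurableSet (Neg.neg ⁻¹' s) := measurable_neg hs
  rw [levyMeasure, withDensity_apply _ hs, withDensity_apply _ hm, ← lintegral_indicator hs,
    ← lintegral_indicator hm, ← lintegral_neg_eq_self]
  congr 1; ext a
  by_cases ha : a ∈ s
  · rw [indicator_of_mem ha, indicator_of_mem (show -a ∈ Neg.neg ⁻¹' s by rwa [mem_preimage, neg_neg]), levyDensity_neg]
  · rw [indicator_of_notMem ha, indicator_of_notMem (show -a ∉ Neg.neg ⁻¹' s by rwa [mem_preimage, neg_neg])]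

theorem levyMeasure_abs_gt_lt_top {α : ℝ} (h0 : 0 < α) (h2 : α < 2) {u : ℝ} (hu : 0 < u) :
    levyMeasure α {a | u < |a|} < ⊤ := by
  have h1 : levyMeasure α (Ioi u) < ⊤ := by
    rw [levyMeasure_Ioi h0 h2 hu]; exact ENNReal.ofReal_lt_top
  have h3 := levyMeasure_neg_preimage α (measurableSet_Ioi (a := u))
  have : {a | u < |a|} = Ioi u ∪ Neg.neg ⁻¹' Ioi u := by
    ext a; simp only [mem_ofPred_eq, lt_abs, mem_union, mem_preimage, mem_Ioi]
  rw [this]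
  exact (measure_union_le _ _).trans_lt (ENNReal.add_lt_top.2 ⟨h1, h3 ▸ h1⟩)

theorem levyMeasure_lt_top_of_abs_gt {α : ℝ} (h0 : 0 < α) (h2 : α < 2) {u : ℝ} (hu : 0 < u)
    {s : Set ℝ} (hs : ∀ a ∈ s, u < |a|) : levyMeasure α s < ⊤ :=
  (measure_mono hs).trans_lt (levyMeasure_abs_gt_lt_top h0 h2 hu)

theorem levyMeasure_pos_of_isOpen {α : ℝ} (h0 : 0 < α) (h2 : α < 2) {s : Set ℝ} (hs : IsOpen s)
    (hne : s.Nonempty) : 0 < levyMeasure α s := by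
  have hae : ∀ᵐ a : ℝ, levyDensity α a ≠ 0 := by
    have : ∀ᵐ a : ℝ, a ≠ 0 := by simp [ae_iff]
    exact this.mono fun a ha => (levyDensity_pos h0 h2 ha).ne'
  have hac : volume ≪ levyMeasure α :=
    withDensity_absolutelyContinuous' (measurable_levyDensity α).aemeasurable hae
  refine pos_iff_ne_zero.2 fun h => ?_
  exact (hs.measure_pos volume hne).ne' (hac h)

/-- The tail mass `u ^ (-α)` blows up at the origin while the mass beyond `r` stays finite: small
jumps have infinite intensity. -/
theorem levyMeasure_Ioo_zero {α : ℝ} (h0 : 0 < α) (h2 : α < 2) {r : ℝ} (hr : 0 < r) :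
    levyMeasure α (Ioo 0 r) = ⊤ := by
  have hc := stableTailConst_pos h0 h2
  have hlim : Tendsto (fun u : ℝ => ENNReal.ofReal (stableTailConst α / 2 * u ^ (-α)))
      (𝓝[>] 0) (𝓝 ⊤) :=
    ENNReal.tendsto_ofReal_nhds_top.2 ((tendsto_rpow_neg_nhdsGT_zero (neg_neg_of_pos h0)).const_mul_atTop (by positivity))
  have hsplit : ∀ u : ℝ, 0 < u → ENNReal.ofReal (stableTailConst α / 2 * u ^ (-α)) ≤
      levyMeasure α (Ioo 0 r) + levyMeasure α (Ici r) := fun u hu => by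
    rw [← levyMeasure_Ioi h0 h2 hu]
    refine (measure_mono fun a ha => ?_).trans (measure_union_le _ _)
    rcases lt_or_ge a r with h | h
    · exact Or.inl ⟨lt_trans hu ha, h⟩
    · exact Or.inr h
  have htop : levyMeasure α (Ioo 0 r) + levyMeasure α (Ici r) = ⊤ :=
    top_le_iff.1 (le_of_tendsto hlim (eventually_nhdsWithin_of_forall hsplit))
  have hfin : levyMeasure α (Ici r) < ⊤ :=
    levyMeasure_lt_top_of_abs_gt h0 h2 (half_pos hr) fun a ha => by
      have : r ≤ a := ha
      rw [abs_of_pos (hr.trans_le this)]; linarith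
  exact (ENNReal.add_eq_top.1 htop).resolve_right hfin.ne

theorem lintegral_eq_mul_lintegral_comp_mul {h : ℝ} (hh : 0 < h) {g : ℝ → ℝ≥0∞}
    (hg : Measurable g) : ∫⁻ x, g x = ENNReal.ofReal h * ∫⁻ a, g (h * a) := by
  conv_lhs => rw [← Real.smul_map_volume_mul_left hh.ne']
  rw [lintegral_smul_measure, lintegral_map hg (by fun_prop), abs_of_pos hh, smul_eq_mul]

theorem rpow_mul_self_eq {α h : ℝ} (hh : 0 < h) :
    ENNReal.ofReal (h ^ (1 + α)) = ENNReal.ofReal (h ^ α) * ENNReal.ofReal h := by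
  rw [← ENNReal.ofReal_mul (by positivity), add_comm, Real.rpow_add hh, Real.rpow_one]

theorem rpow_mul_lintegral_stableLaw {α h : ℝ} (h0 : 0 < α) (hh : 0 < h) {g : ℝ → ℝ≥0∞}
    (hg : Measurable g) :
    ENNReal.ofReal (h ^ α) * ∫⁻ x, g (h⁻¹ * x) ∂stableLaw α =
      ∫⁻ a, scaledDensity α h a * g a := by
  have hf := measurable_stableDensity h0
  rw [stableLaw, lintegral_withDensity_eq_lintegral_mul _ (by fun_prop) (by fun_prop),
    lintegral_eq_mul_lintegral_comp_mul hh (by fun_prop), ← mul_assoc, ← rpow_mul_self_eq hh,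
    ← lintegral_const_mul _ (by fun_prop)]
  congr 1; ext a
  simp [scaledDensity, hh.ne', mul_assoc]

/-- The limit and the bound for the scaled density are available only off the axes. -/
theorem ae_prod_ne_zero : ∀ᵐ z : ℝ × ℝ, z.1 ≠ 0 ∧ z.2 ≠ 0 := by
  have h : ∀ᵐ x : ℝ, x ≠ 0 := by simp [ae_iff]
  have h1 : ∀ᵐ z : ℝ × ℝ, z.1 ≠ 0 := Measure.quasiMeasurePreserving_fst.ae h
  have h2 : ∀ᵐ z : ℝ × ℝ, z.2 ≠ 0 := Measure.quasiMeasurePreserving_snd.ae h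
  exact h1.and h2

theorem rpow_mul_stableLaw_prod {α h : ℝ} (h0 : 0 < α) (hh : 0 < h) {A : Set (ℝ × ℝ)}
    (hA : MeasurableSet A) :
    ENNReal.ofReal (h ^ (2 * α)) *
        ((stableLaw α).prod (stableLaw α)) {z | (h⁻¹ * z.1, h⁻¹ * z.2) ∈ A} =
      ∫⁻ z in A, scaledDensity α h z.1 * scaledDensity α h z.2 := by
  have hm : MeasurableSet {z : ℝ × ℝ | (h⁻¹ * z.1, h⁻¹ * z.2) ∈ A} :=
    (by fun_prop : Measurable fun z : ℝ × ℝ => (h⁻¹ * z.1, h⁻¹ * z.2)) hA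
  have hi : Measurable (A.indicator (1 : ℝ × ℝ → ℝ≥0∞)) := measurable_one.indicator hA
  have hs := measurable_scaledDensity h0 h
  have hinner : Measurable fun a : ℝ => ∫⁻ y, A.indicator 1 (a, h⁻¹ * y) ∂stableLaw α :=
    (hi.comp (by fun_prop : Measurable fun z : ℝ × ℝ => (z.1, h⁻¹ * z.2))).lintegral_prod_right'
  rw [show h ^ (2 * α) = h ^ α * h ^ α by rw [← Real.rpow_add hh]; ring_nf,
    ENNReal.ofReal_mul (by positivity), mul_assoc, ← lintegral_indicator_one hm,
    lintegral_prod _ (measurable_one.indicator hm).aemeasurable]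
  have e1 : ∀ x y : ℝ, {z : ℝ × ℝ | (h⁻¹ * z.1, h⁻¹ * z.2) ∈ A}.indicator (1 : ℝ × ℝ → ℝ≥0∞) (x, y)
      = A.indicator 1 (h⁻¹ * x, h⁻¹ * y) := fun x y => rfl
  simp_rw [e1]
  rw [rpow_mul_lintegral_stableLaw h0 hh hinner, ← lintegral_const_mul (f := fun a => scaledDensity α h a *
      ∫⁻ y, A.indicator 1 (a, h⁻¹ * y) ∂stableLaw α) _ (hs.mul hinner),
    ← lintegral_indicator hA, Measure.volume_eq_prod, lintegral_prod _ (by fun_prop)]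
  congr 1; ext a
  rw [mul_left_comm, rpow_mul_lintegral_stableLaw h0 hh
    (g := fun b => A.indicator (1 : ℝ × ℝ → ℝ≥0∞) (a, b)) (hi.comp (by fun_prop)),
    ← lintegral_const_mul (f := fun b => scaledDensity α h b *
      A.indicator (1 : ℝ × ℝ → ℝ≥0∞) (a, b)) _ (hs.mul (hi.comp (by fun_prop)))]
  congr 1; ext b
  by_cases hab : (a, b) ∈ A <;> simp [hab]

theorem levyMeasure_prod_apply (α : ℝ) {A : Set (ℝ × ℝ)} (hA : MeasurableSet A) :
    ((levyMeasure α).prod (levyMeasure α)) A =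
      ∫⁻ z in A, levyDensity α z.1 * levyDensity α z.2 := by
  rw [levyMeasure, prod_withDensity (by fun_prop) (by fun_prop), withDensity_apply _ hA]
  rfl

/-- Large deviations caused by two jumps. -/
theorem tendsto_rpow_mul_stableLaw_prod {α : ℝ} (h0 : 0 < α) (h2 : α < 2) {A : Set (ℝ × ℝ)}
    (hA : MeasurableSet A) (hfin : ((levyMeasure α).prod (levyMeasure α)) A ≠ ⊤) :
    Tendsto (fun h : ℝ => ENNReal.ofReal (h ^ (2 * α)) *
        ((stableLaw α).prod (stableLaw α)) {z | (h⁻¹ * z.1, h⁻¹ * z.2) ∈ A})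
      atTop (𝓝 (((levyMeasure α).prod (levyMeasure α)) A)) := by
  rw [levyMeasure_prod_apply α hA] at hfin ⊢
  refine Tendsto.congr' ((eventually_gt_atTop 0).mono fun h hh =>
    (rpow_mul_stableLaw_prod h0 hh hA).symm) ?_
  obtain ⟨K, hK, hle⟩ := exists_scaledDensity_le h0 h2
  refine tendsto_lintegral_filter_of_dominated_convergence
    (fun z => K * K * (levyDensity α z.1 * levyDensity α z.2)) (Eventually.of_forall fun h => ?_)
    ((eventually_gt_atTop 0).mono fun h hh => ?_) ?_ ?_
  · have := measurable_scaledDensity h0 h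
    fun_prop
  · filter_upwards [ae_restrict_of_ae ae_prod_ne_zero] with z hz
    calc _ ≤ (K * levyDensity α z.1) * (K * levyDensity α z.2) :=
          mul_le_mul' (hle h hh _ hz.1) (hle h hh _ hz.2)
      _ = _ := by ring
  · rw [lintegral_const_mul _ (by fun_prop)]
    exact ENNReal.mul_ne_top (ENNReal.mul_ne_top hK hK) hfin
  · filter_upwards [ae_restrict_of_ae ae_prod_ne_zero] with z hz
    exact ENNReal.Tendsto.mul (tendsto_scaledDensity h0 h2 hz.1) (Or.inr (levyDensity_ne_top _ _))
      (tendsto_scaledDensity h0 h2 hz.2) (Or.inr (levyDensity_ne_top _ _))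

/-- Large deviations caused by one jump, against a convergent bounded weight. -/
theorem tendsto_lintegral_scaledDensity_mul {α : ℝ} (h0 : 0 < α) (h2 : α < 2) {B : Set ℝ}
    (hB : MeasurableSet B) (hfin : levyMeasure α B ≠ ⊤) {w : ℝ → ℝ → ℝ≥0∞}
    (hw : ∀ h, Measurable (w h)) (hw1 : ∀ h a, w h a ≤ 1)
    (hlim : ∀ a ∈ B, Tendsto (fun h => w h a) atTop (𝓝 1)) :
    Tendsto (fun h : ℝ => ∫⁻ a in B, scaledDensity α h a * w h a)
      atTop (𝓝 (levyMeasure α B)) := by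
  rw [levyMeasure, withDensity_apply _ hB] at hfin ⊢
  have hne : ∀ᵐ a ∂volume.restrict B, a ≠ 0 := ae_restrict_of_ae (by simp [ae_iff])
  obtain ⟨K, hK, hle⟩ := exists_scaledDensity_le h0 h2
  refine tendsto_lintegral_filter_of_dominated_convergence
    (fun a => K * levyDensity α a) (Eventually.of_forall fun h => ?_)
    ((eventually_gt_atTop 0).mono fun h hh => ?_) ?_ ?_
  · exact (measurable_scaledDensity h0 h).mul (hw h)
  · filter_upwards [hne] with a ha
    exact (mul_le_of_le_one_right' (hw1 h a)).trans (hle h hh a ha)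
  · rw [lintegral_const_mul _ (by fun_prop)]
    exact ENNReal.mul_ne_top hK hfin
  · filter_upwards [hne, ae_restrict_mem hB] with a ha haB
    have := ENNReal.Tendsto.mul (tendsto_scaledDensity h0 h2 ha)
      (Or.inr ENNReal.one_ne_top) (hlim a haB) (Or.inr (levyDensity_ne_top _ _))
    rwa [mul_one] at this

/-! ### Tails of the stable law and the regime `1 ≤ α` -/

theorem lintegral_stableLaw {α : ℝ} (h0 : 0 < α) {g : ℝ → ℝ≥0∞} (hg : Measurable g) :
    ∫⁻ x, g x ∂stableLaw α = ∫⁻ x, ENNReal.ofReal (stableDensity α x) * g x := by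
  have hf := measurable_stableDensity h0
  rw [stableLaw, lintegral_withDensity_eq_lintegral_mul _ (by fun_prop) hg]
  rfl

theorem rpow_mul_stableLaw_Ioi {α h : ℝ} (h0 : 0 < α) (hh : 0 < h) :
    ENNReal.ofReal (h ^ α) * stableLaw α (Ioi h) = ∫⁻ a in Ioi 1, scaledDensity α h a := by
  have h1 := rpow_mul_lintegral_stableLaw h0 hh (g := (Ioi 1).indicator 1)
    (measurable_one.indicator measurableSet_Ioi)
  have h3 : ∫⁻ x, (Ioi 1).indicator (1 : ℝ → ℝ≥0∞) (h⁻¹ * x) ∂stableLaw α = stableLaw α (Ioi h) := by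
    rw [← lintegral_indicator_one measurableSet_Ioi]
    congr 1; ext x
    have : 1 < h⁻¹ * x ↔ h < x := by rw [inv_mul_eq_div, one_lt_div hh]
    simp [indicator, this]
  rw [h3] at h1
  rw [h1, ← lintegral_indicator measurableSet_Ioi]
  congr 1; ext a
  by_cases ha : 1 < a <;> simp [ha]

theorem levyMeasure_Ioi_one {α : ℝ} (h0 : 0 < α) (h2 : α < 2) :
    levyMeasure α (Ioi 1) = ENNReal.ofReal (stableTailConst α / 2) := by
  rw [levyMeasure_Ioi h0 h2 one_pos]; simp

theorem tendsto_rpow_mul_stableLaw_Ioi {α : ℝ} (h0 : 0 < α) (h2 : α < 2) :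
    Tendsto (fun h : ℝ => ENNReal.ofReal (h ^ α) * stableLaw α (Ioi h)) atTop
      (𝓝 (ENNReal.ofReal (stableTailConst α / 2))) := by
  have hfin : levyMeasure α (Ioi 1) ≠ ⊤ := by
    rw [levyMeasure_Ioi_one h0 h2]; exact ENNReal.ofReal_ne_top
  have := tendsto_lintegral_scaledDensity_mul h0 h2 measurableSet_Ioi hfin (w := fun _ _ => 1)
    (fun _ => measurable_const) (fun _ _ => le_rfl) (fun _ _ => tendsto_const_nhds)
  rw [levyMeasure_Ioi_one h0 h2] at this
  refine this.congr' ((eventually_gt_atTop 0).mono fun h hh => ?_)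
  simp only [mul_one]
  exact (rpow_mul_stableLaw_Ioi h0 hh).symm

theorem exists_rpow_mul_stableLaw_Ioi_le {α : ℝ} (h0 : 0 < α) (h2 : α < 2) :
    ∃ K : ℝ≥0∞, K ≠ ⊤ ∧ ∀ h, 0 < h → ENNReal.ofReal (h ^ α) * stableLaw α (Ioi h) ≤ K := by
  obtain ⟨K, hK, hle⟩ := exists_scaledDensity_le h0 h2
  refine ⟨K * levyMeasure α (Ioi 1), ENNReal.mul_ne_top hK ?_, fun h hh => ?_⟩
  · rw [levyMeasure_Ioi_one h0 h2]; exact ENNReal.ofReal_ne_top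
  · rw [rpow_mul_stableLaw_Ioi h0 hh, levyMeasure, withDensity_apply _ measurableSet_Ioi,
      ← lintegral_const_mul _ (by fun_prop)]
    exact setLIntegral_mono' measurableSet_Ioi fun a ha => hle h hh a (lt_trans one_pos ha).ne'

/-- Conditioning on the overshoot `u = S₁ - h` leaves the requirement `S₂ > u`. Only the density of
`S₁` is rescaled, so this is the natural form when `S₂` need not be of order `h`. -/
theorem rpow_mul_stableLaw_prod_wedge {α h : ℝ} (h0 : 0 < α) (hh : 0 < h) :
    ENNReal.ofReal (h ^ (1 + α)) *
        ((stableLaw α).prod (stableLaw α)) {z | h < z.1 ∧ z.1 - z.2 < h} =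
      ∫⁻ u in Ioi 0, scaledDensity α h (1 + u / h) * stableLaw α (Ioi u) := by
  have hf := measurable_stableDensity h0
  have hm : MeasurableSet {z : ℝ × ℝ | h < z.1 ∧ z.1 - z.2 < h} :=
    ((isOpen_lt continuous_const continuous_fst).and
      (isOpen_lt (by fun_prop) continuous_const)).measurableSet
  have hanti : Antitone fun u : ℝ => stableLaw α (Ioi u) := fun u v huv =>
    measure_mono (Ioi_subset_Ioi huv)
  have hG : Measurable fun u : ℝ => stableLaw α (Ioi u) := hanti.measurable
  rw [Measure.prod_apply hm]
  have hsec : ∀ x : ℝ, stableLaw α (Prod.mk x ⁻¹' {z : ℝ × ℝ | h < z.1 ∧ z.1 - z.2 < h}) =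
      (Ioi h).indicator (fun x => stableLaw α (Ioi (x - h))) x := by
    intro x
    by_cases hx : h < x
    · rw [indicator_of_mem (mem_Ioi.2 hx)]
      congr 1; ext y
      simp only [mem_preimage, mem_ofPred_eq, mem_Ioi]
      constructor
      · rintro ⟨-, h⟩; linarith
      · intro h; exact ⟨hx, by linarith⟩
    · rw [indicator_of_notMem (by simpa using hx)]
      simp [hx]
  simp_rw [hsec]
  have hGi : Measurable ((Ioi h).indicator (fun x => stableLaw α (Ioi (x - h)))) :=
    (hG.comp (by fun_prop : Measurable fun x : ℝ => x - h)).indicator measurableSet_Ioi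
  rw [lintegral_stableLaw h0 hGi, ← lintegral_add_left_eq_self _ h, ← lintegral_const_mul _ (by fun_prop),
    ← lintegral_indicator measurableSet_Ioi]
  congr 1; ext u
  by_cases hu : 0 < u
  · rw [indicator_of_mem (mem_Ioi.2 hu)]
    rw [indicator_of_mem (by simpa using hu), add_sub_cancel_left, scaledDensity,
      show h * (1 + u / h) = h + u by field_simp, mul_assoc]
  · rw [indicator_of_notMem (by simpa using hu)]
    rw [indicator_of_notMem (by simpa using hu)]
    simp

theorem scaledDensity_one_add_le {α : ℝ} (h0 : 0 < α) (h2 : α < 2) {K : ℝ≥0∞} {h u : ℝ}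
    (hle : ∀ a, a ≠ 0 → scaledDensity α h a ≤ K * levyDensity α a) (hu : 0 ≤ u) :
    scaledDensity α h (1 + u) ≤ K * levyDensity α 1 :=
  (hle _ (by positivity)).trans
    (mul_le_mul_right (levyDensity_anti h0 h2 one_pos (by linarith)) K)

/-- For `α > 1` the event needs one jump which lands just beyond the corner. -/
theorem tendsto_rpow_mul_wedge_of_lintegral_tail_ne_top {α : ℝ} (h0 : 0 < α) (h2 : α < 2)
    (hfin : ∫⁻ u in Ioi 0, stableLaw α (Ioi u) ≠ ⊤) :
    Tendsto (fun h : ℝ => ENNReal.ofReal (h ^ (1 + α)) *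
        ((stableLaw α).prod (stableLaw α)) {z | h < z.1 ∧ z.1 - z.2 < h}) atTop
      (𝓝 (ENNReal.ofReal (stableTailConst α / 2 * α) *
        ∫⁻ u in Ioi 0, stableLaw α (Ioi u))) := by
  have hanti : Antitone fun u : ℝ => stableLaw α (Ioi u) := fun u v huv =>
    measure_mono (Ioi_subset_Ioi huv)
  have hG : Measurable fun u : ℝ => stableLaw α (Ioi u) := hanti.measurable
  refine Tendsto.congr' ((eventually_gt_atTop 0).mono fun h hh =>
    (rpow_mul_stableLaw_prod_wedge h0 hh).symm) ?_
  obtain ⟨K, hK, hle⟩ := exists_scaledDensity_le h0 h2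
  rw [← levyDensity_one, ← lintegral_const_mul _ hG]
  refine tendsto_lintegral_filter_of_dominated_convergence
    (fun u => K * levyDensity α 1 * stableLaw α (Ioi u)) (Eventually.of_forall fun h => ?_)
    ((eventually_gt_atTop 0).mono fun h hh => ?_) ?_ ?_
  · have := measurable_scaledDensity h0 h
    fun_prop
  · filter_upwards [ae_restrict_mem measurableSet_Ioi] with u hu
    have hu : 0 < u := hu
    gcongr
    exact scaledDensity_one_add_le h0 h2 (hle h hh) (by positivity)
  · rw [lintegral_const_mul _ hG]
    exact ENNReal.mul_ne_top (ENNReal.mul_ne_top hK (levyDensity_ne_top _ _)) hfin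
  · filter_upwards [ae_restrict_mem measurableSet_Ioi] with u hu
    refine ENNReal.Tendsto.mul_const (tendsto_scaledDensity_of_pos h0 h2 one_pos ?_)
      (Or.inl (levyDensity_pos h0 h2 one_ne_zero).ne')
    have := (tendsto_const_nhds (x := u)).div_atTop tendsto_id
    simpa using (tendsto_const_nhds (x := (1 : ℝ))).add this

theorem stableLaw_neg_preimage (α : ℝ) {s : Set ℝ} (hs : MeasurableSet s) :
    stableLaw α (Neg.neg ⁻¹' s) = stableLaw α s := by
  have hm : MeasurableSet (Neg.neg ⁻¹' s) := measurable_neg hs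
  rw [stableLaw, withDensity_apply _ hs, withDensity_apply _ hm, ← lintegral_indicator hs,
    ← lintegral_indicator hm, ← lintegral_neg_eq_self]
  congr 1; ext a
  by_cases ha : a ∈ s
  · rw [indicator_of_mem ha, indicator_of_mem (show -a ∈ Neg.neg ⁻¹' s by rwa [mem_preimage, neg_neg]),
      stableDensity_neg]
  · rw [indicator_of_notMem ha,
      indicator_of_notMem (show -a ∉ Neg.neg ⁻¹' s by rwa [mem_preimage, neg_neg])]

/-- The density bound makes `|x| f(x)` at most a multiple of `|x| ^ (-α)`, which is integrable at
infinity for `α > 1`. -/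
theorem integrable_id_stableLaw {α : ℝ} (h1 : 1 < α) (h2 : α < 2) :
    Integrable (fun x : ℝ => x) (stableLaw α) := by
  have h0 : 0 < α := one_pos.trans h1
  have hf := measurable_stableDensity h0
  obtain ⟨M, hM, hle1, hle2⟩ := exists_abs_stableDensity_le h0 h2
  rw [stableLaw, integrable_withDensity_iff (by fun_prop) (ae_of_all _ fun x => ENNReal.ofReal_lt_top)]
  have hle : ∀ x : ℝ, |x * (ENNReal.ofReal (stableDensity α x)).toReal| ≤
      |x| * |stableDensity α x| := fun x => by
    rw [abs_mul, abs_of_nonneg ENNReal.toReal_nonneg, ENNReal.toReal_ofReal']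
    gcongr
    exact max_le (le_abs_self _) (abs_nonneg _)
  have hle' : ∀ x : ℝ, x ≠ 0 → |x * (ENNReal.ofReal (stableDensity α x)).toReal| ≤
      M * |x| ^ (-α) := fun x hx => by
    refine (hle x).trans ((mul_le_mul_of_nonneg_left (hle2 x hx) (abs_nonneg x)).trans_eq ?_)
    have hx' := abs_pos.2 hx
    rw [neg_add, Real.rpow_add hx', Real.rpow_neg_one]
    field_simp
  refine integrable_of_abs_le_rpow (M := M) (s := -α)
    (Measurable.aestronglyMeasurable (by fun_prop)) (by linarith) (fun x => ?_) hle'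
  rcases le_total |x| 1 with h | h
  · calc _ ≤ 1 * M := (hle x).trans (mul_le_mul h (hle1 x) (abs_nonneg _) zero_le_one)
      _ = M := one_mul M
  · refine (hle' x (by rintro rfl; norm_num at h)).trans ?_
    exact mul_le_of_le_one_right hM.le (Real.rpow_le_one_of_one_le_of_nonpos h (by linarith))

/-- Layer-cake formula for `|x|`; the two tails are equal by symmetry, which gives the factor one
half. -/
theorem lintegral_stableLaw_Ioi {α : ℝ} (h1 : 1 < α) (h2 : α < 2) :
    ∫⁻ u in Ioi 0, stableLaw α (Ioi u) = ENNReal.ofReal ((∫ x, |x| ∂stableLaw α) / 2) := by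
  have hanti : Antitone fun u : ℝ => stableLaw α (Ioi u) := fun u v huv =>
    measure_mono (Ioi_subset_Ioi huv)
  have hG : Measurable fun u : ℝ => stableLaw α (Ioi u) := hanti.measurable
  have hint := (integrable_id_stableLaw h1 h2).abs
  have e1 := lintegral_eq_lintegral_meas_lt (stableLaw α) (f := fun x : ℝ => |x|)
    (ae_of_all _ fun x => abs_nonneg x) (by fun_prop)
  rw [← ofReal_integral_eq_lintegral_ofReal hint (ae_of_all _ fun x => abs_nonneg x)] at e1
  have e2 : ∫⁻ t in Ioi 0, stableLaw α {a | t < |a|} =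
      ∫⁻ t in Ioi 0, 2 * stableLaw α (Ioi t) := by
    refine setLIntegral_congr_fun measurableSet_Ioi fun t ht => ?_
    have ht : 0 < t := ht
    have hset : {a : ℝ | t < |a|} = Ioi t ∪ Neg.neg ⁻¹' Ioi t := by
      ext a; simp only [mem_ofPred_eq, lt_abs, mem_union, mem_preimage, mem_Ioi]
    have hdisj : Disjoint (Ioi t) (Neg.neg ⁻¹' Ioi t) := by
      rw [Set.disjoint_left]
      intro a ha hb
      simp only [mem_preimage, mem_Ioi] at ha hb
      linarith
    rw [hset, measure_union hdisj (measurable_neg measurableSet_Ioi),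
      stableLaw_neg_preimage α measurableSet_Ioi, two_mul]
  rw [e2, lintegral_const_mul _ hG] at e1
  rw [ENNReal.ofReal_div_of_pos two_pos, e1, ENNReal.ofReal_ofNat,
    mul_div_assoc, ENNReal.mul_div_cancel (by simp) (by simp)]

/-- Exponential decay in the logarithmic scale `s` of the overshoot, used with `x = 1 + h ^ (s - 1)`
in the majorant for `α = 1`. -/
theorem levyDensity_le_mul_exp {α : ℝ} (h0 : 0 < α) (h2 : α < 2) {x s : ℝ}
    (hx : 1 ≤ x) (hs : Real.exp (s - 1) ≤ x) :
    levyDensity α x ≤ levyDensity α 1 * ENNReal.ofReal (Real.exp (1 - s)) := by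
  have hc := stableTailConst_pos h0 h2
  rw [levyDensity_one, levyDensity, ← ENNReal.ofReal_mul (by positivity)]
  refine ENNReal.ofReal_le_ofReal (mul_le_mul_of_nonneg_left ?_ (by positivity))
  rw [abs_of_pos (by linarith)]
  calc x ^ (-(1 + α)) ≤ x ^ (-1 : ℝ) := Real.rpow_le_rpow_of_exponent_le hx (by linarith)
    _ = x⁻¹ := Real.rpow_neg_one x
    _ ≤ (Real.exp (s - 1))⁻¹ := inv_anti₀ (Real.exp_pos _) hs
    _ = Real.exp (1 - s) := by rw [← Real.exp_neg]; ring_nf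

theorem tendsto_levyDensity_atTop {α : ℝ} (h0 : 0 < α) :
    Tendsto (levyDensity α) atTop (𝓝 0) := by
  have h := (tendsto_rpow_neg_atTop (by linarith : 0 < 1 + α)).const_mul (stableTailConst α / 2 * α)
  rw [mul_zero] at h
  have h' := ENNReal.tendsto_ofReal h
  rw [ENNReal.ofReal_zero] at h'
  refine h'.congr' ((eventually_gt_atTop 0).mono fun x hx => ?_)
  rw [levyDensity, abs_of_pos hx]

theorem isProbabilityMeasure_stableLaw {α : ℝ} {ν : Measure ℝ} (h0 : 0 < α) (h2 : α < 2)
    (hν : IsStdStable α ν) : IsProbabilityMeasure (stableLaw α) := by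
  rw [stableLaw, ← hν.eq_withDensity h0 h2]; exact hν.1

/-- For `α = 1` the one-jump and the two-jump scenario are in balance, which gives the logarithm. -/
theorem tendsto_wedge_cauchy [IsProbabilityMeasure (stableLaw 1)] :
    Tendsto (fun h : ℝ => ENNReal.ofReal (h ^ (2 : ℝ) / Real.log h) *
        ((stableLaw 1).prod (stableLaw 1)) {z | h < z.1 ∧ z.1 - z.2 < h}) atTop
      (𝓝 (ENNReal.ofReal (stableTailConst 1 ^ 2 / 4))) := by
  have h0 : (0 : ℝ) < 1 := one_pos
  have h2 : (1 : ℝ) < 2 := one_lt_two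
  have hanti : Antitone fun u : ℝ => stableLaw 1 (Ioi u) := fun u v huv =>
    measure_mono (Ioi_subset_Ioi huv)
  have hG : Measurable fun u : ℝ => stableLaw 1 (Ioi u) := hanti.measurable
  obtain ⟨K, hK, hle⟩ := exists_scaledDensity_le h0 h2
  obtain ⟨K', hK', hle'⟩ := exists_rpow_mul_stableLaw_Ioi_le h0 h2
  simp only [Real.rpow_one] at hle'
  -- With the overshoot written as `h ^ s`, the Jacobian `h ^ s * log h` cancels the normalising
  -- logarithm. For `s < 0` the factor `h ^ s` kills the integrand, and for `s > 1` the Lévy density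
  -- does. For `0 < s < 1` the two factors tend to `levyDensity 1 1` and `C₁ / 2`, both of value `C₁
  -- / 2`.
  set F : ℝ → ℝ → ℝ≥0∞ := fun h s => scaledDensity 1 h (1 + h ^ (s - 1)) *
    (ENNReal.ofReal (h ^ s) * stableLaw 1 (Ioi (h ^ s))) with hF
  have hFm : ∀ h, 0 < h → Measurable (F h) := fun h hh => by
    have := measurable_scaledDensity h0 h
    have h3 : Measurable fun s : ℝ => h ^ s := (Real.continuous_const_rpow hh.ne').measurable
    have h4 := hG.comp h3
    exact (this.comp (by fun_prop)).mul ((by fun_prop : Measurable fun s : ℝ => _).mul h4)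
  have hkey : ∀ h : ℝ, 1 < h → ENNReal.ofReal (h ^ (2 : ℝ) / Real.log h) *
      ((stableLaw 1).prod (stableLaw 1)) {z | h < z.1 ∧ z.1 - z.2 < h} = ∫⁻ s, F h s := by
    intro h hh
    have hpos : 0 < h := one_pos.trans hh
    have hlog : 0 < Real.log h := Real.log_pos hh
    have hw := rpow_mul_stableLaw_prod_wedge h0 hpos
    rw [one_add_one_eq_two] at hw
    have hsd := measurable_scaledDensity h0 h
    rw [div_eq_inv_mul, ENNReal.ofReal_mul (by positivity), mul_assoc, hw,
      lintegral_Ioi_zero_eq_comp_exp, lintegral_eq_mul_lintegral_comp_mul hlog (by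
        have := hG.comp Real.measurable_exp
        simp only [Function.comp_def] at this
        fun_prop), ← mul_assoc, ← ENNReal.ofReal_mul (by positivity), inv_mul_cancel₀ hlog.ne',
      ENNReal.ofReal_one, one_mul]
    congr 1; ext s
    have e1 : Real.exp (Real.log h * s) = h ^ s := (Real.rpow_def_of_pos hpos s).symm
    simp only [hF]
    rw [e1, Real.rpow_sub hpos, Real.rpow_one]
    ring
  refine Tendsto.congr' ((eventually_gt_atTop 1).mono fun h hh => (hkey h hh).symm) ?_
  have hlimval : ENNReal.ofReal (stableTailConst 1 ^ 2 / 4) =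
      ∫⁻ s : ℝ, (Ioo (0 : ℝ) 1).indicator
        (fun _ => levyDensity 1 1 * ENNReal.ofReal (stableTailConst 1 / 2)) s := by
    have hc := stableTailConst_pos h0 h2
    rw [lintegral_indicator measurableSet_Ioo, lintegral_const, Measure.restrict_apply_univ,
      Real.volume_Ioo, levyDensity_one, ← ENNReal.ofReal_mul (by positivity),
      ← ENNReal.ofReal_mul (by positivity)]
    congr 1; ring
  rw [hlimval]
  -- Once `h ≥ e` one has `h ^ s ≤ e ^ s` for `s ≤ 0` and `h ^ (s - 1) ≥ e ^ (s - 1)` for `s ≥ 1`,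
  -- so a multiple of `exp (1 - |s|)` dominates for all such `h`.
  refine tendsto_lintegral_filter_of_dominated_convergence
    (fun s => K * levyDensity 1 1 * (K' + 1) * ENNReal.ofReal (Real.exp (1 - |s|)))
    ((eventually_gt_atTop 0).mono hFm)
    ((eventually_ge_atTop (Real.exp 1)).mono fun h hh => ae_of_all _ fun s => ?_) ?_ ?_
  · have hpos : 0 < h := (Real.exp_pos 1).trans_le hh
    have hlog : 1 ≤ Real.log h := (Real.le_log_iff_exp_le hpos).2 hh
    have hp : ∀ s : ℝ, 0 < h ^ s := fun s => Real.rpow_pos_of_pos hpos s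
    have hd := hle h hpos (1 + h ^ (s - 1)) (by have := hp (s - 1); positivity)
    rcases le_total s 0 with hs | hs
    · have h3 : scaledDensity 1 h (1 + h ^ (s - 1)) ≤ K * levyDensity 1 1 :=
        scaledDensity_one_add_le h0 h2 (hle h hpos) (hp _).le
      have h4 : ENNReal.ofReal (h ^ s) * stableLaw 1 (Ioi (h ^ s)) ≤
          (K' + 1) * ENNReal.ofReal (Real.exp (1 - |s|)) := by
        calc _ ≤ ENNReal.ofReal (h ^ s) * 1 := by gcongr; exact prob_le_one
          _ ≤ 1 * ENNReal.ofReal (Real.exp (1 - |s|)) := by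
            rw [mul_one, one_mul]
            apply ENNReal.ofReal_le_ofReal
            rw [Real.rpow_def_of_pos hpos, abs_of_nonpos hs]
            apply Real.exp_le_exp.2
            nlinarith
          _ ≤ _ := by gcongr; exact le_add_self
      calc F h s ≤ _ := mul_le_mul' h3 h4
        _ = _ := by ring
    · have h4 : ENNReal.ofReal (h ^ s) * stableLaw 1 (Ioi (h ^ s)) ≤ K' + 1 :=
        (hle' _ (hp s)).trans le_self_add
      have h3 : levyDensity 1 (1 + h ^ (s - 1)) ≤
          levyDensity 1 1 * ENNReal.ofReal (Real.exp (1 - |s|)) := by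
        rw [abs_of_nonneg hs]
        have := hp (s - 1)
        refine levyDensity_le_mul_exp h0 h2 (by linarith) ?_
        rcases le_total s 1 with h5 | h5
        · have : Real.exp (s - 1) ≤ 1 := Real.exp_le_one_iff.2 (by linarith)
          linarith
        · have : Real.exp (s - 1) ≤ h ^ (s - 1) := by
            rw [Real.rpow_def_of_pos hpos]
            apply Real.exp_le_exp.2
            nlinarith
          linarith
      calc F h s ≤ _ := mul_le_mul' (hd.trans (mul_le_mul_right h3 K)) h4
        _ = _ := by ring
  · have hi : Integrable fun s : ℝ => Real.exp (1 - |s|) := by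
      have := (integrable_exp_neg_abs_rpow h0).const_mul (Real.exp 1)
      refine this.congr (ae_of_all _ fun s => ?_)
      simp only [Real.rpow_one]
      rw [← Real.exp_add, sub_eq_add_neg]
    rw [lintegral_const_mul _ (by fun_prop),
      ← ofReal_integral_eq_lintegral_ofReal hi (ae_of_all _ fun s => (Real.exp_pos _).le)]
    exact ENNReal.mul_ne_top (ENNReal.mul_ne_top (ENNReal.mul_ne_top hK (levyDensity_ne_top _ _))
      (by simp [hK'])) ENNReal.ofReal_ne_top
  · have hae : ∀ᵐ s : ℝ, s ≠ 0 ∧ s ≠ 1 := by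
      have h3 : ∀ᵐ s : ℝ, s ≠ 0 := by simp [ae_iff]
      have h4 : ∀ᵐ s : ℝ, s ≠ 1 := by simp [ae_iff]
      exact h3.and h4
    filter_upwards [hae] with s hs
    have hzero : ∀ {s : ℝ}, s < 0 → Tendsto (fun h : ℝ => h ^ s) atTop (𝓝 0) := fun {s} hs => by
      have := tendsto_rpow_neg_atTop (neg_pos.2 hs)
      rwa [neg_neg] at this
    rcases lt_or_gt_of_ne hs.1 with hs0 | hs0
    · rw [indicator_of_notMem (fun h => lt_asymm hs0 h.1)]
      have h3 := ENNReal.Tendsto.const_mul (a := K * levyDensity 1 1)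
        (ENNReal.tendsto_ofReal (hzero hs0))
        (Or.inr (ENNReal.mul_ne_top hK (levyDensity_ne_top _ _)))
      rw [ENNReal.ofReal_zero, mul_zero] at h3
      refine tendsto_of_tendsto_of_tendsto_of_le_of_le' tendsto_const_nhds h3
        (Eventually.of_forall fun _ => zero_le) ((eventually_gt_atTop 0).mono fun h hh => ?_)
      refine mul_le_mul' (scaledDensity_one_add_le h0 h2 (hle h hh) (Real.rpow_nonneg hh.le _)) ?_
      exact mul_le_of_le_one_right' prob_le_one
    · rcases lt_or_gt_of_ne hs.2 with hs1 | hs1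
      · rw [indicator_of_mem (show s ∈ Ioo (0 : ℝ) 1 from ⟨hs0, hs1⟩)]
        refine ENNReal.Tendsto.mul ?_ (Or.inr ENNReal.ofReal_ne_top) ?_
          (Or.inr (levyDensity_ne_top _ _))
        · refine tendsto_scaledDensity_of_pos h0 h2 one_pos ?_
          simpa using (hzero (by linarith : s - 1 < 0)).const_add 1
        · have := (tendsto_rpow_mul_stableLaw_Ioi h0 h2).comp (tendsto_rpow_atTop hs0)
          simpa only [Real.rpow_one, Function.comp_def] using this
      · rw [indicator_of_notMem (fun h => lt_asymm hs1 h.2)]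
        have h5 : Tendsto (fun h : ℝ => 1 + h ^ (s - 1)) atTop atTop :=
          tendsto_atTop_add_const_left _ _ (tendsto_rpow_atTop (by linarith))
        have h6 := ENNReal.Tendsto.const_mul (a := K)
          ((tendsto_levyDensity_atTop h0).comp h5) (Or.inr hK)
        have h3 := ENNReal.Tendsto.mul_const (b := K') h6 (Or.inr hK')
        rw [mul_zero, zero_mul] at h3
        refine tendsto_of_tendsto_of_tendsto_of_le_of_le' tendsto_const_nhds h3
          (Eventually.of_forall fun _ => zero_le) ((eventually_gt_atTop 0).mono fun h hh => ?_)
        have hp := Real.rpow_pos_of_pos hh (s - 1)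
        exact mul_le_mul' (hle h hh _ (by positivity)) (hle' _ (Real.rpow_pos_of_pos hh s))

/-! ### The functional `L` in terms of the Lévy measure -/

/-- The radial density `α s ^ (-(1 + α))`. -/
noncomputable def radialDensity (α s : ℝ) : ℝ≥0∞ := ENNReal.ofReal (α * s ^ (-(1 + α)))

@[fun_prop]
theorem measurable_radialDensity (α : ℝ) : Measurable (radialDensity α) := by
  unfold radialDensity; fun_prop

theorem tailL_one_eq {n : ℕ} (Λ : Measure (UnitSphere n)) [IsFiniteMeasure Λ]
    (F : Set (EuclideanSpace ℝ (Fin n))) (α : ℝ) :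
    tailL Λ F 1 α = ENNReal.ofReal (stableTailConst α) *
      ∫⁻ s in Ioi 0, Λ {x | s • (x : EuclideanSpace ℝ (Fin n)) ∈ F} * radialDensity α s := by
  have hΛ : ∀ s : Fin 1 → ℝ, Measure.pi (fun _ : Fin 1 => Λ)
      {x | ∑ i, s i • (x i : EuclideanSpace ℝ (Fin n)) ∈ F} =
        Λ {x | s 0 • (x : EuclideanSpace ℝ (Fin n)) ∈ F} := fun s => by
    have h := measurePreserving_funUnique Λ (Fin 1)
    rw [← h.measure_preimage_equiv]
    simp only [Finset.univ_unique, Finset.sum_singleton]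
    rfl
  rw [tailL]
  simp_rw [hΛ]
  have hv := volume_preserving_funUnique (Fin 1) ℝ
  rw [← hv.setLIntegral_comp_preimage_emb (MeasurableEquiv.measurableEmbedding _)]
  simp only [pow_one, Nat.factorial_one, Nat.cast_one, div_one, Finset.univ_unique,
    Finset.prod_singleton, radialDensity]
  congr 2
  congr 1
  ext s
  simp [MeasurableEquiv.funUnique, Fin.forall_fin_one]

/-- The iterated form allows the polar formula to be applied first to the inner and then to the
outer variable. -/
theorem tailL_two_eq {n : ℕ} (Λ : Measure (UnitSphere n)) [IsFiniteMeasure Λ]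
    {F : Set (EuclideanSpace ℝ (Fin n))} (hF : MeasurableSet F) (α : ℝ) :
    tailL Λ F 2 α = ENNReal.ofReal (stableTailConst α ^ 2 / 2) *
      ∫⁻ s in Ioi 0, ∫⁻ t in Ioi 0, (∫⁻ x, ∫⁻ y, F.indicator 1
        (s • (x : EuclideanSpace ℝ (Fin n)) + t • (y : EuclideanSpace ℝ (Fin n))) ∂Λ ∂Λ) *
          (radialDensity α s * radialDensity α t) := by
  have hmeas : Measurable fun q : (ℝ × ℝ) × (UnitSphere n × UnitSphere n) =>
      q.1.1 • (q.2.1 : EuclideanSpace ℝ (Fin n)) + q.1.2 • (q.2.2 : EuclideanSpace ℝ (Fin n)) := by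
    fun_prop
  have hΛ : ∀ s : ℝ × ℝ, (Λ.prod Λ) {x | s.1 • (x.1 : EuclideanSpace ℝ (Fin n)) +
      s.2 • (x.2 : EuclideanSpace ℝ (Fin n)) ∈ F} = ∫⁻ x, ∫⁻ y, F.indicator 1
        (s.1 • (x : EuclideanSpace ℝ (Fin n)) + s.2 • (y : EuclideanSpace ℝ (Fin n))) ∂Λ ∂Λ := by
    intro s
    have hm : MeasurableSet {x : UnitSphere n × UnitSphere n |
        s.1 • (x.1 : EuclideanSpace ℝ (Fin n)) + s.2 • (x.2 : EuclideanSpace ℝ (Fin n)) ∈ F} :=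
      (hmeas.comp (measurable_prodMk_left (x := s))) hF
    rw [← lintegral_indicator_one hm, lintegral_prod _ (measurable_one.indicator hm).aemeasurable]
    rfl
  have hpi : ∀ s : Fin 2 → ℝ, Measure.pi (fun _ : Fin 2 => Λ)
      {x | ∑ i, s i • (x i : EuclideanSpace ℝ (Fin n)) ∈ F} =
        (Λ.prod Λ) {x | s 0 • (x.1 : EuclideanSpace ℝ (Fin n)) +
          s 1 • (x.2 : EuclideanSpace ℝ (Fin n)) ∈ F} := fun s => by
    have h := measurePreserving_finTwoArrow Λ
    rw [← h.measure_preimage_equiv]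
    simp [Set.preimage, MeasurableEquiv.finTwoArrow, Fin.sum_univ_two]
  have hq : Measurable fun s : ℝ × ℝ => ∫⁻ x, ∫⁻ y, F.indicator (1 : EuclideanSpace ℝ (Fin n) → ℝ≥0∞)
        (s.1 • (x : EuclideanSpace ℝ (Fin n)) + s.2 • (y : EuclideanSpace ℝ (Fin n))) ∂Λ ∂Λ := by
    simp_rw [← hΛ]
    exact measurable_measure_prodMk_left (hmeas hF)
  rw [tailL]
  simp_rw [hpi]
  have hv := volume_preserving_finTwoArrow ℝ
  have hset : {s : Fin 2 → ℝ | ∀ i, 0 < s i} =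
      MeasurableEquiv.finTwoArrow ⁻¹' (Ioi (0 : ℝ) ×ˢ Ioi (0 : ℝ)) := by
    ext s; simp [MeasurableEquiv.finTwoArrow, Fin.forall_fin_two]
  have hfun : ∀ s : Fin 2 → ℝ, (Λ.prod Λ) {x | s 0 • (x.1 : EuclideanSpace ℝ (Fin n)) +
          s 1 • (x.2 : EuclideanSpace ℝ (Fin n)) ∈ F} *
            ∏ i, ENNReal.ofReal (α * s i ^ (-(1 + α))) =
      (fun p : ℝ × ℝ => (∫⁻ x, ∫⁻ y, F.indicator 1
        (p.1 • (x : EuclideanSpace ℝ (Fin n)) + p.2 • (y : EuclideanSpace ℝ (Fin n))) ∂Λ ∂Λ) *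
          (radialDensity α p.1 * radialDensity α p.2)) (MeasurableEquiv.finTwoArrow s) := fun s => by
    simp only [← hΛ, Fin.prod_univ_two, radialDensity]
    rfl
  simp_rw [hfun, hset]
  refine congrArg₂ _ (by simp) ((hv.setLIntegral_comp_preimage_emb
    (MeasurableEquiv.measurableEmbedding _) (fun p : ℝ × ℝ => (∫⁻ x, ∫⁻ y, F.indicator 1
        (p.1 • (x : EuclideanSpace ℝ (Fin n)) + p.2 • (y : EuclideanSpace ℝ (Fin n))) ∂Λ ∂Λ) *
          (radialDensity α p.1 * radialDensity α p.2)) (Ioi (0 : ℝ) ×ˢ Ioi (0 : ℝ))).trans ?_)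
  rw [Measure.volume_eq_prod, ← Measure.prod_restrict, lintegral_prod _ (by fun_prop)]

/-! ### Polar coordinates for the spectral measure of the example -/

theorem lintegral_exampleSpectral (α : ℝ) (g : UnitSphere 2 → ℝ≥0∞) :
    ∫⁻ x, g x ∂exampleSpectral α =
      ENNReal.ofReal ((2 : ℝ) ^ (α / 2) / 2) * (g diagDir + g (-diagDir)) +
        ENNReal.ofReal (1 / 2) * (g vertDir + g (-vertDir)) := by
  rw [exampleSpectral, lintegral_add_measure, lintegral_smul_measure, lintegral_smul_measure,
    lintegral_add_measure, lintegral_add_measure]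
  simp only [lintegral_dirac, smul_eq_mul]

instance (α : ℝ) : IsFiniteMeasure (exampleSpectral α) := by
  constructor
  rw [← lintegral_one, lintegral_exampleSpectral]
  exact ENNReal.add_lt_top.2 ⟨ENNReal.mul_lt_top ENNReal.ofReal_lt_top (by simp),
    ENNReal.mul_lt_top ENNReal.ofReal_lt_top (by simp)⟩

/-- Evenness folds the negative half-line onto the positive one, matching a radial integral over
antipodal pairs of directions. -/
theorem lintegral_levyMeasure (α : ℝ) {g : ℝ → ℝ≥0∞} (hg : Measurable g) :
    ∫⁻ t, g t ∂levyMeasure α =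
      ∫⁻ t in Ioi 0, ENNReal.ofReal (stableTailConst α / 2 * α * t ^ (-(1 + α))) *
        (g t + g (-t)) := by
  have hg' : Measurable fun t : ℝ => levyDensity α t * g t := by fun_prop
  have hneg : ∫⁻ t in Iic 0, levyDensity α t * g t =
      ∫⁻ t in Ioi 0, levyDensity α t * g (-t) := by
    rw [← lintegral_indicator measurableSet_Iic, ← lintegral_neg_eq_self,
      setLIntegral_congr Ioi_ae_eq_Ici, ← lintegral_indicator measurableSet_Ici]
    congr 1; ext t
    by_cases ht : 0 ≤ t
    · rw [indicator_of_mem (show -t ∈ Iic (0 : ℝ) from neg_nonpos.2 ht), levyDensity_neg,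
        indicator_of_mem (show t ∈ Ici (0 : ℝ) from ht)]
    · rw [indicator_of_notMem (show -t ∉ Iic (0 : ℝ) by simpa using ht),
        indicator_of_notMem (show t ∉ Ici (0 : ℝ) from ht)]
  rw [levyMeasure, lintegral_withDensity_eq_lintegral_mul _ (measurable_levyDensity α) hg]
  simp only [Pi.mul_apply]
  rw [← lintegral_add_compl _ measurableSet_Iic (A := Iic (0 : ℝ)), compl_Iic, hneg,
    ← lintegral_add_left (by fun_prop)]
  refine setLIntegral_congr_fun measurableSet_Ioi fun t ht => ?_
  have ht : 0 < t := ht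
  simp only [levyDensity, abs_of_pos ht]
  ring

/-- The direction `(1, 1)`. -/
noncomputable def diagVec : EuclideanSpace ℝ (Fin 2) := !₂[1, 1]

/-- The direction `(0, -1)`. -/
noncomputable def vertVec : EuclideanSpace ℝ (Fin 2) := !₂[0, -1]

theorem smul_diagDir (t : ℝ) : (√2 * t) • (diagDir : EuclideanSpace ℝ (Fin 2)) = t • diagVec := by
  ext i
  fin_cases i <;> simp [diagDir, diagVec] <;> field_simp

theorem coe_vertDir : (vertDir : EuclideanSpace ℝ (Fin 2)) = -vertVec := by
  ext i
  fin_cases i <;> simp [vertDir, vertVec]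

/-- Polar coordinates for the Lévy measure of the example vector. -/
theorem lintegral_polar_exampleSpectral {α : ℝ} (h0 : 0 < α) (h2 : α < 2)
    {g : EuclideanSpace ℝ (Fin 2) → ℝ≥0∞} (hg : Measurable g) :
    ENNReal.ofReal (stableTailConst α) *
        ∫⁻ s in Ioi 0, (∫⁻ x, g (s • (x : EuclideanSpace ℝ (Fin 2))) ∂exampleSpectral α) *
          radialDensity α s =
      ∫⁻ t, g (t • diagVec) + g (t • vertVec) ∂levyMeasure α := by
  have hc := stableTailConst_pos h0 h2
  -- The rescaling `s = √2 t` replaces `(1, 1) / √2` by `(1, 1)`. The factor `2 ^ (α / 2)` in the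
  -- mass exactly cancels the Jacobian and the radial power, leaving weight `1 / 2`.
  have hdiag : ∫⁻ s in Ioi 0, ENNReal.ofReal ((2 : ℝ) ^ (α / 2) / 2) *
      (g (s • (diagDir : EuclideanSpace ℝ (Fin 2))) +
        g (s • ((-diagDir : UnitSphere 2) : EuclideanSpace ℝ (Fin 2)))) * radialDensity α s =
      ∫⁻ t in Ioi 0, ENNReal.ofReal (1 / 2) * (g (t • diagVec) + g (-t • diagVec)) *
        radialDensity α t := by
    rw [← lintegral_indicator measurableSet_Ioi, lintegral_eq_mul_lintegral_comp_mul
      (h := √2) (by positivity) (Measurable.indicator (by fun_prop) measurableSet_Ioi),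
      ← lintegral_const_mul' _ _ ENNReal.ofReal_ne_top, ← lintegral_indicator measurableSet_Ioi]
    congr 1; ext t
    by_cases ht : 0 < t
    · rw [indicator_of_mem (show √2 * t ∈ Ioi (0 : ℝ) from by simp [ht]),
        indicator_of_mem (show t ∈ Ioi (0 : ℝ) from ht)]
      simp only [coe_neg_sphere, smul_neg, smul_diagDir, neg_smul]
      have hr : ENNReal.ofReal √2 * ENNReal.ofReal ((2 : ℝ) ^ (α / 2) / 2) *
          radialDensity α (√2 * t) = ENNReal.ofReal (1 / 2) * radialDensity α t := by
        simp only [radialDensity]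
        rw [← ENNReal.ofReal_mul (by positivity), ← ENNReal.ofReal_mul (by positivity),
          ← ENNReal.ofReal_mul (by positivity)]
        congr 1
        have e : √2 * (2 : ℝ) ^ (α / 2) * (√2) ^ (-(1 + α)) = 1 := by
          rw [Real.sqrt_eq_rpow, ← Real.rpow_mul two_pos.le, ← Real.rpow_add two_pos,
            ← Real.rpow_add two_pos]
          ring_nf
          simp
        rw [Real.mul_rpow (by positivity) ht.le]
        linear_combination (α * t ^ (-(1 + α)) / 2) * e
      calc _ = ENNReal.ofReal √2 * ENNReal.ofReal ((2 : ℝ) ^ (α / 2) / 2) *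
          radialDensity α (√2 * t) * (g (t • diagVec) + g (-(t • diagVec))) := by ring
        _ = _ := by rw [hr]; ring
    · rw [indicator_of_notMem (show √2 * t ∉ Ioi (0 : ℝ) from by simpa using ht),
        indicator_of_notMem (show t ∉ Ioi (0 : ℝ) from ht), mul_zero]
  simp_rw [lintegral_exampleSpectral, add_mul]
  rw [lintegral_add_left (by fun_prop), hdiag, ← lintegral_add_left (by fun_prop),
    ← lintegral_const_mul _ (by fun_prop), lintegral_levyMeasure α (by fun_prop)]
  refine setLIntegral_congr_fun measurableSet_Ioi fun t ht => ?_
  simp only [coe_neg_sphere, coe_vertDir, smul_neg, neg_smul, neg_neg]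
  have hr : ENNReal.ofReal (stableTailConst α / 2 * α * t ^ (-(1 + α))) =
      ENNReal.ofReal (stableTailConst α) * ENNReal.ofReal (1 / 2) * radialDensity α t := by
    rw [radialDensity, ← ENNReal.ofReal_mul hc.le, ← ENNReal.ofReal_mul (by positivity)]
    congr 1; ring
  rw [hr]
  ring

/-- A single jump of `X` comes from `S₁` alone or from `S₂` alone, so it lies on one of two lines.
-/
theorem tailL_example_one {α : ℝ} (h0 : 0 < α) (h2 : α < 2) {F : Set (EuclideanSpace ℝ (Fin 2))}
    (hF : MeasurableSet F) :
    tailL (exampleSpectral α) F 1 α =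
      levyMeasure α {t | t • diagVec ∈ F} + levyMeasure α {t | t • vertVec ∈ F} := by
  have hm1 : MeasurableSet {t : ℝ | t • diagVec ∈ F} :=
    (by fun_prop : Measurable fun t : ℝ => t • diagVec) hF
  have hm2 : MeasurableSet {t : ℝ | t • vertVec ∈ F} :=
    (by fun_prop : Measurable fun t : ℝ => t • vertVec) hF
  have hi : Measurable (F.indicator (1 : EuclideanSpace ℝ (Fin 2) → ℝ≥0∞)) :=
    measurable_one.indicator hF
  have key : ∀ s : ℝ, exampleSpectral α {x | s • (x : EuclideanSpace ℝ (Fin 2)) ∈ F} =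
      ∫⁻ x, F.indicator 1 (s • (x : EuclideanSpace ℝ (Fin 2))) ∂exampleSpectral α := fun s => by
    have hm : MeasurableSet {x : UnitSphere 2 | s • (x : EuclideanSpace ℝ (Fin 2)) ∈ F} :=
      (by fun_prop : Measurable fun x : UnitSphere 2 => s • (x : EuclideanSpace ℝ (Fin 2))) hF
    rw [← lintegral_indicator_one hm]
    rfl
  rw [tailL_one_eq]
  simp_rw [key]
  rw [lintegral_polar_exampleSpectral h0 h2 hi, lintegral_add_left (by fun_prop),
    ← lintegral_indicator_one hm1, ← lintegral_indicator_one hm2]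
  rfl

/-- Each of two jumps belongs to `S₁` or `S₂`, and the mixed case occurs in both orders. The factor
two on the left clears the `1 / 2!`. -/
theorem tailL_example_two {α : ℝ} (h0 : 0 < α) (h2 : α < 2) {F : Set (EuclideanSpace ℝ (Fin 2))}
    (hF : MeasurableSet F) :
    2 * tailL (exampleSpectral α) F 2 α =
      ((levyMeasure α).prod (levyMeasure α)) {z | z.1 • diagVec + z.2 • diagVec ∈ F} +
        2 * ((levyMeasure α).prod (levyMeasure α)) {z | z.1 • diagVec + z.2 • vertVec ∈ F} +
        ((levyMeasure α).prod (levyMeasure α)) {z | z.1 • vertVec + z.2 • vertVec ∈ F} := by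
  have hc := stableTailConst_pos h0 h2
  set φ : EuclideanSpace ℝ (Fin 2) → ℝ≥0∞ := F.indicator 1 with hφ
  have hi : Measurable φ := measurable_one.indicator hF
  -- The contribution of the second jump after a first displacement `u`. The polar formula computes
  -- `ψ` and is then applied to `ψ` itself.
  set ψ : EuclideanSpace ℝ (Fin 2) → ℝ≥0∞ := fun u =>
    ∫⁻ t, φ (u + t • diagVec) + φ (u + t • vertVec) ∂levyMeasure α with hψ
  have hψm : Measurable ψ := Measurable.lintegral_prod_right' (f := fun q : _ × ℝ =>
    φ (q.1 + q.2 • diagVec) + φ (q.1 + q.2 • vertVec)) (by fun_prop)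
  have hinner : ∀ u, ENNReal.ofReal (stableTailConst α) * ∫⁻ t in Ioi 0,
      (∫⁻ y, φ (u + t • (y : EuclideanSpace ℝ (Fin 2))) ∂exampleSpectral α) *
        radialDensity α t = ψ u := fun u =>
    lintegral_polar_exampleSpectral h0 h2 (g := fun v => φ (u + v)) (by fun_prop)
  have houter := lintegral_polar_exampleSpectral h0 h2 hψm
  have hprod : ∀ v w : EuclideanSpace ℝ (Fin 2),
      ∫⁻ a, ∫⁻ b, φ (a • v + b • w) ∂levyMeasure α ∂levyMeasure α =
        ((levyMeasure α).prod (levyMeasure α)) {z | z.1 • v + z.2 • w ∈ F} := fun v w => by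
    have hm : MeasurableSet {z : ℝ × ℝ | z.1 • v + z.2 • w ∈ F} :=
      (by fun_prop : Measurable fun z : ℝ × ℝ => z.1 • v + z.2 • w) hF
    rw [← lintegral_indicator_one hm, lintegral_prod _ (measurable_one.indicator hm).aemeasurable]
    rfl
  have hmixed : ((levyMeasure α).prod (levyMeasure α)) {z | z.1 • vertVec + z.2 • diagVec ∈ F} =
      ((levyMeasure α).prod (levyMeasure α)) {z | z.1 • diagVec + z.2 • vertVec ∈ F} := by
    rw [← hprod, ← hprod, lintegral_lintegral_swap (by fun_prop)]
    simp_rw [add_comm]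
  set D : EuclideanSpace ℝ (Fin 2) → EuclideanSpace ℝ (Fin 2) → ℝ → ℝ≥0∞ := fun v w a =>
    ∫⁻ b, φ (a • v + b • w) ∂levyMeasure α with hD
  have hdbl : ∀ v w : EuclideanSpace ℝ (Fin 2), Measurable (D v w) := fun v w =>
    Measurable.lintegral_prod_right' (f := fun q : ℝ × ℝ => φ (q.1 • v + q.2 • w)) (by fun_prop)
  have hψ' : ∫⁻ t, ψ (t • diagVec) + ψ (t • vertVec) ∂levyMeasure α =
      ((levyMeasure α).prod (levyMeasure α)) {z | z.1 • diagVec + z.2 • diagVec ∈ F} +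
        2 * ((levyMeasure α).prod (levyMeasure α)) {z | z.1 • diagVec + z.2 • vertVec ∈ F} +
        ((levyMeasure α).prod (levyMeasure α)) {z | z.1 • vertVec + z.2 • vertVec ∈ F} := by
    have hs : ∀ (v : EuclideanSpace ℝ (Fin 2)) (t : ℝ),
        ψ (t • v) = D v diagVec t + D v vertVec t := fun v t => lintegral_add_left (by fun_prop) _
    have hD' : ∀ v w : EuclideanSpace ℝ (Fin 2), ∫⁻ a, D v w a ∂levyMeasure α =
        ((levyMeasure α).prod (levyMeasure α)) {z | z.1 • v + z.2 • w ∈ F} := hprod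
    simp_rw [hs]
    rw [lintegral_add_left (f := fun t => D diagVec diagVec t + D diagVec vertVec t)
        ((hdbl _ _).add (hdbl _ _)), lintegral_add_left (hdbl _ _),
      lintegral_add_left (hdbl _ _), hD', hD', hD', hD', hmixed]
    ring
  rw [← hψ', ← houter, tailL_two_eq _ hF, ← mul_assoc]
  have hC : (2 : ℝ≥0∞) * ENNReal.ofReal (stableTailConst α ^ 2 / 2) =
      ENNReal.ofReal (stableTailConst α) * ENNReal.ofReal (stableTailConst α) := by
    rw [← ENNReal.ofReal_ofNat, ← ENNReal.ofReal_mul zero_le_two, ← ENNReal.ofReal_mul hc.le]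
    congr 1; ring
  have hm3 : ∀ s : ℝ, Measurable fun q : ℝ × UnitSphere 2 =>
      ∫⁻ y, φ (s • (q.2 : EuclideanSpace ℝ (Fin 2)) + q.1 • (y : EuclideanSpace ℝ (Fin 2)))
        ∂exampleSpectral α := fun s =>
    Measurable.lintegral_prod_right' (f := fun p : (ℝ × UnitSphere 2) × UnitSphere 2 =>
      φ (s • (p.1.2 : EuclideanSpace ℝ (Fin 2)) + p.1.1 • (p.2 : EuclideanSpace ℝ (Fin 2))))
      (by fun_prop)
  rw [hC, mul_assoc, ← lintegral_const_mul']
  · congr 1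
    refine lintegral_congr fun s => ?_
    have hx : ∀ x : UnitSphere 2, ψ (s • (x : EuclideanSpace ℝ (Fin 2))) =
        ENNReal.ofReal (stableTailConst α) * ∫⁻ t in Ioi 0,
          (∫⁻ y, φ (s • (x : EuclideanSpace ℝ (Fin 2)) + t • (y : EuclideanSpace ℝ (Fin 2)))
            ∂exampleSpectral α) * radialDensity α t := fun x => (hinner _).symm
    simp_rw [hx]
    rw [lintegral_const_mul' _ _ ENNReal.ofReal_ne_top, mul_assoc]
    congr 1
    have hm4 := hm3 s
    rw [lintegral_lintegral_swap (by
      exact ((hm4.comp measurable_swap).mul (by fun_prop)).aemeasurable)]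
    rw [← lintegral_mul_const' _ _ (by simp [radialDensity])]
    refine lintegral_congr fun t => ?_
    rw [lintegral_mul_const' _ _ (by simp [radialDensity])]
    ring
  · exact ENNReal.ofReal_ne_top

/-! ### The pair of jumps and the wedge -/

/-- The intensity of a pair of independent jumps of `S₁` and `S₂`. -/
noncomputable def jumpPairMeasure (α : ℝ) : Measure (ℝ × ℝ) :=
  (levyMeasure α).prod (levyMeasure α)

/-- The pairs `(a, b)` with `(a, a - b) ∈ E`. -/
def wedge : Set (ℝ × ℝ) := {z | 1 < z.1 ∧ z.1 - z.2 < 1}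

theorem isOpen_wedge : IsOpen wedge :=
  (isOpen_lt continuous_const continuous_fst).and (isOpen_lt (by fun_prop) continuous_const)

/-- Given the first jump `x > 1`, the second must exceed `x - 1`. The resulting singularity `(x - 1)
^ (-α)` is the source of the threshold at `α = 1`. -/
theorem jumpPairMeasure_wedge_eq_lintegral {α : ℝ} (h0 : 0 < α) (h2 : α < 2) :
    jumpPairMeasure α wedge = ∫⁻ x in Ioi 1, ENNReal.ofReal
      (stableTailConst α ^ 2 * α / 4 * (x ^ (-(1 + α)) * (x - 1) ^ (-α))) := by
  have hc := stableTailConst_pos h0 h2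
  have hsec : ∀ x : ℝ, levyMeasure α (Prod.mk x ⁻¹' wedge) =
      (Ioi 1).indicator (fun x => ENNReal.ofReal (stableTailConst α / 2 * (x - 1) ^ (-α))) x := by
    intro x
    by_cases hx : 1 < x
    · rw [indicator_of_mem (mem_Ioi.2 hx), ← levyMeasure_Ioi h0 h2 (sub_pos.2 hx)]
      congr 1; ext y
      simp only [wedge, mem_preimage, mem_ofPred_eq, mem_Ioi]
      constructor
      · rintro ⟨-, h⟩; linarith
      · intro h; exact ⟨hx, by linarith⟩
    · rw [indicator_of_notMem (by simpa using hx)]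
      simp [wedge, hx]
  rw [jumpPairMeasure, Measure.prod_apply isOpen_wedge.measurableSet]
  simp_rw [hsec]
  rw [lintegral_indicator measurableSet_Ioi, levyMeasure,
    setLIntegral_withDensity_eq_setLIntegral_mul _ (by fun_prop) (by fun_prop) measurableSet_Ioi]
  refine setLIntegral_congr_fun measurableSet_Ioi fun x hx => ?_
  have hx : 1 < x := hx
  simp only [Pi.mul_apply, levyDensity]
  rw [← ENNReal.ofReal_mul (by positivity), abs_of_pos (by linarith)]
  congr 1; ring

/-- The inversion `x ↦ x⁻¹` maps the integral to a multiple of the Beta integral with parameters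
`2α` and `1 - α`, evaluated through the normalisation of the Beta density. -/
theorem jumpPairMeasure_wedge_of_lt_one {α : ℝ} (h0 : 0 < α) (h1 : α < 1) :
    jumpPairMeasure α wedge = ENNReal.ofReal (betaConst α) := by
  have hc := stableTailConst_pos h0 (by linarith)
  have hB := beta_pos (by linarith : 0 < 2 * α) (by linarith : 0 < 1 - α)
  have hone := lintegral_betaPDF_eq_one (by linarith : 0 < 2 * α) (by linarith : 0 < 1 - α)
  rw [lintegral_betaPDF] at hone
  have himg : (fun x : ℝ => x⁻¹) '' Ioo 0 1 = Ioi 1 := by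
    rw [image_inv_eq_inv, inv_Ioo_0_left one_pos, inv_one]
  have hchange := lintegral_image_eq_lintegral_abs_deriv_mul (s := Ioo (0 : ℝ) 1)
    (f := fun x => x⁻¹) (f' := fun x => -(x ^ 2)⁻¹) measurableSet_Ioo
    (fun x hx => (hasDerivAt_inv hx.1.ne').hasDerivWithinAt) inv_injective.injOn
    (fun x => ENNReal.ofReal
      (stableTailConst α ^ 2 * α / 4 * (x ^ (-(1 + α)) * (x - 1) ^ (-α))))
  rw [himg] at hchange
  have hK : betaConst α = stableTailConst α ^ 2 * α / 4 * beta (2 * α) (1 - α) := by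
    rw [betaConst, beta, show 2 * α + (1 - α) = 1 + α by ring]
    field_simp
  have hK0 : 0 ≤ betaConst α := by rw [hK]; positivity
  rw [jumpPairMeasure_wedge_eq_lintegral h0 (by linarith), hchange,
    ← mul_one (ENNReal.ofReal (betaConst α)), ← hone,
    ← lintegral_const_mul' _ _ ENNReal.ofReal_ne_top]
  refine setLIntegral_congr_fun measurableSet_Ioo fun x hx => ?_
  obtain ⟨hx0, hx1⟩ := hx
  have hx1' : 0 < 1 - x := by linarith
  rw [← ENNReal.ofReal_mul (abs_nonneg _), ← ENNReal.ofReal_mul hK0, hK, abs_neg,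
    abs_of_pos (by positivity)]
  congr 1
  have e1 : x⁻¹ - 1 = (1 - x) * x⁻¹ := by field_simp
  rw [e1, Real.mul_rpow hx1'.le (by positivity), Real.inv_rpow hx0.le, Real.inv_rpow hx0.le,
    ← Real.rpow_neg hx0.le, ← Real.rpow_neg hx0.le, ← Real.rpow_natCast, ← Real.rpow_neg hx0.le]
  have e2 : x ^ (-((2 : ℕ) : ℝ)) * x ^ (-(-(1 + α))) * x ^ (-(-α)) = x ^ (2 * α - 1) := by
    rw [← Real.rpow_add hx0, ← Real.rpow_add hx0]
    congr 1; push_cast; ring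
  rw [show (1 - α - 1) = -α by ring, ← e2]
  generalize beta (2 * α) (1 - α) = b at hB
  field_simp

theorem lintegral_Ioo_rpow_neg_eq_top {α : ℝ} (h1 : 1 ≤ α) :
    ∫⁻ u in Ioo (0 : ℝ) 1, ENNReal.ofReal (u ^ (-α)) = ⊤ := by
  by_contra hne
  have : IntegrableOn (fun u : ℝ => u ^ (-α)) (Ioo 0 1) := by
    refine ⟨(by fun_prop : Measurable fun u : ℝ => u ^ (-α)).aestronglyMeasurable, ?_⟩
    rw [hasFiniteIntegral_iff_ofReal]
    · exact lt_top_iff_ne_top.2 hne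
    · exact (ae_restrict_iff' measurableSet_Ioo).2
        (ae_of_all _ fun u hu => Real.rpow_nonneg hu.1.le _)
  rw [intervalIntegral.integrableOn_Ioo_rpow_iff one_pos] at this
  linarith

/-- On `(1, 2)` the factor `x ^ (-(1 + α))` is at least `2 ^ (-(1 + α))`, and `u ^ (-α)` is not
integrable at zero. -/
theorem jumpPairMeasure_wedge_of_one_le {α : ℝ} (h1 : 1 ≤ α) (h2 : α < 2) :
    jumpPairMeasure α wedge = ⊤ := by
  have h0 : 0 < α := by linarith
  have hc := stableTailConst_pos h0 h2
  rw [jumpPairMeasure_wedge_eq_lintegral h0 h2, ← top_le_iff]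
  set k := stableTailConst α ^ 2 * α / 4 * (2 : ℝ) ^ (-(1 + α)) with hk
  have hk0 : 0 < k := by positivity
  calc (⊤ : ℝ≥0∞) = ENNReal.ofReal k * ∫⁻ u in Ioo (0 : ℝ) 1, ENNReal.ofReal (u ^ (-α)) := by
        rw [lintegral_Ioo_rpow_neg_eq_top h1, ENNReal.mul_top (ENNReal.ofReal_pos.2 hk0).ne']
    _ = ∫⁻ x, (Ioo (0 : ℝ) 1).indicator (fun u => ENNReal.ofReal (k * u ^ (-α))) (x + -1) := by
        rw [lintegral_add_right_eq_self, lintegral_indicator measurableSet_Ioo,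
          ← lintegral_const_mul' _ _ ENNReal.ofReal_ne_top]
        simp_rw [ENNReal.ofReal_mul hk0.le]
    _ ≤ _ := by
        rw [← lintegral_indicator measurableSet_Ioi]
        refine lintegral_mono fun x => ?_
        by_cases hx : x + -1 ∈ Ioo (0 : ℝ) 1
        · have hx1 : 1 < x := by linarith [hx.1]
          rw [indicator_of_mem hx, indicator_of_mem (mem_Ioi.2 hx1)]
          apply ENNReal.ofReal_le_ofReal
          rw [hk, mul_assoc, ← sub_eq_add_neg]
          have hp : 0 ≤ (x - 1) ^ (-α) := Real.rpow_nonneg (by linarith) _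
          have : (2 : ℝ) ^ (-(1 + α)) ≤ x ^ (-(1 + α)) :=
            Real.rpow_le_rpow_of_nonpos (by linarith) (by linarith [hx.2]) (by linarith)
          gcongr
        · rw [indicator_of_notMem hx]
          exact zero_le

/-- The boundaries of the sets of jump pairs lie on lines `z.1 = c` and `z.1 - z.2 = c`, which are
null because the Lévy measure has no atoms. -/
theorem jumpPairMeasure_fst_eq (α c : ℝ) : jumpPairMeasure α {z | z.1 = c} = 0 := by
  have : {z : ℝ × ℝ | z.1 = c} = {c} ×ˢ univ := by ext z; simp
  rw [this, jumpPairMeasure, Measure.prod_prod, measure_singleton, zero_mul]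

theorem jumpPairMeasure_sub_eq (α c : ℝ) : jumpPairMeasure α {z | z.1 - z.2 = c} = 0 := by
  have hm : MeasurableSet {z : ℝ × ℝ | z.1 - z.2 = c} :=
    measurableSet_eq_fun (by fun_prop) (by fun_prop)
  rw [jumpPairMeasure, Measure.measure_prod_null hm]
  refine ae_of_all _ fun x => ?_
  have : Prod.mk x ⁻¹' {z : ℝ × ℝ | z.1 - z.2 = c} = {x - c} := by
    ext y; simp only [mem_preimage, mem_ofPred_eq, mem_singleton_iff]
    constructor <;> intro h <;> linarith
  change levyMeasure α _ = 0
  rw [this, measure_singleton]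

/-- Two diagonal jumps reach the closure of `E` only at `(1, 1)`, that is, when they sum to exactly
one. -/
theorem jumpPairMeasure_add_eq (α c : ℝ) : jumpPairMeasure α {z | z.1 + z.2 = c} = 0 := by
  have hm : MeasurableSet {z : ℝ × ℝ | z.1 + z.2 = c} :=
    measurableSet_eq_fun (by fun_prop) (by fun_prop)
  rw [jumpPairMeasure, Measure.measure_prod_null hm]
  refine ae_of_all _ fun x => ?_
  have : Prod.mk x ⁻¹' {z : ℝ × ℝ | z.1 + z.2 = c} = {c - x} := by
    ext y; simp only [mem_preimage, mem_ofPred_eq, mem_singleton_iff]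
    constructor <;> intro h <;> linarith
  change levyMeasure α _ = 0
  rw [this, measure_singleton]

theorem jumpPairMeasure_pos_of_isOpen {α : ℝ} (h0 : 0 < α) (h2 : α < 2) {s : Set (ℝ × ℝ)}
    (hs : IsOpen s) (hne : s.Nonempty) : 0 < jumpPairMeasure α s := by
  obtain ⟨⟨a, b⟩, hab⟩ := hne
  obtain ⟨u, v, hu, hv, ha, hb, huv⟩ := isOpen_prod_iff.1 hs a b hab
  refine lt_of_lt_of_le ?_ (measure_mono huv)
  rw [jumpPairMeasure, Measure.prod_prod]
  exact ENNReal.mul_pos (levyMeasure_pos_of_isOpen h0 h2 hu ⟨a, ha⟩).ne'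
    (levyMeasure_pos_of_isOpen h0 h2 hv ⟨b, hb⟩).ne'

theorem jumpPairMeasure_lt_top_of_le {α : ℝ} (h0 : 0 < α) (h2 : α < 2) {s : Set (ℝ × ℝ)} {u v : ℝ}
    (hu : 0 < u) (hv : 0 < v) (hs : ∀ z ∈ s, u < z.1 ∧ v < z.2) : jumpPairMeasure α s < ⊤ := by
  have hle : s ⊆ Ioi u ×ˢ Ioi v := fun z hz => ⟨(hs z hz).1, (hs z hz).2⟩
  refine (measure_mono hle).trans_lt ?_
  rw [jumpPairMeasure, Measure.prod_prod, levyMeasure_Ioi h0 h2 hu, levyMeasure_Ioi h0 h2 hv]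
  exact ENNReal.mul_lt_top ENNReal.ofReal_lt_top ENNReal.ofReal_lt_top

/-! ### Removing a neighbourhood of the corner from the wedge -/

theorem isOpen_setOf_or {X : Type*} [TopologicalSpace X] {p q : X → Prop} (hp : IsOpen {x | p x})
    (hq : IsOpen {x | q x}) : IsOpen {x | p x ∨ q x} := by
  convert hp.union hq using 1
  ext x; simp

/-- The pairs `(a, b)` with `(a, a - b)` in `E` and outside the closed ball around `(1, 1)`. -/
def cutWedge (ε : ℝ) : Set (ℝ × ℝ) := {z | 1 < z.1 ∧ z.1 - z.2 < 1 ∧ (1 + ε < z.1 ∨ z.1 - z.2 < 1 - ε)}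

theorem isOpen_cutWedge (ε : ℝ) : IsOpen (cutWedge ε) :=
  (isOpen_lt continuous_const continuous_fst).and ((isOpen_lt (by fun_prop) continuous_const).and
    (isOpen_setOf_or (isOpen_lt continuous_const continuous_fst)
      (isOpen_lt (by fun_prop) continuous_const)))

/-- Cutting out the corner keeps the second jump away from zero, which makes the intensity finite
for every `α`. -/
theorem lt_of_mem_cutWedge {ε : ℝ} (hε : 0 < ε) {z : ℝ × ℝ} (hz : z ∈ cutWedge ε) :
    1 < z.1 ∧ ε < z.2 := by
  obtain ⟨h1, h2, h3 | h3⟩ := hz <;> constructor <;> linarith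

theorem jumpPairMeasure_cutWedge_lt_top {α : ℝ} (h0 : 0 < α) (h2 : α < 2) {ε : ℝ} (hε : 0 < ε) :
    jumpPairMeasure α (cutWedge ε) < ⊤ :=
  jumpPairMeasure_lt_top_of_le h0 h2 one_pos hε fun _ hz => lt_of_mem_cutWedge hε hz

theorem jumpPairMeasure_cutWedge_pos {α : ℝ} (h0 : 0 < α) (h2 : α < 2) {ε : ℝ} (hε : 0 < ε) :
    0 < jumpPairMeasure α (cutWedge ε) :=
  jumpPairMeasure_pos_of_isOpen h0 h2 (isOpen_cutWedge ε)
    ⟨(2 + ε, 2 + ε), by simp only [cutWedge, mem_ofPred_eq]; exact ⟨by linarith, by linarith, Or.inl (by linarith)⟩⟩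

theorem cutWedge_anti {ε ε' : ℝ} (h : ε ≤ ε') : cutWedge ε' ⊆ cutWedge ε := by
  rintro z ⟨h1, h2, h3 | h3⟩
  · exact ⟨h1, h2, Or.inl (by linarith)⟩
  · exact ⟨h1, h2, Or.inr (by linarith)⟩

theorem jumpPairMeasure_cutWedge_strictAnti {α : ℝ} (h0 : 0 < α) (h2 : α < 2) {ε ε' : ℝ}
    (hε : 0 < ε) (h : ε < ε') :
    jumpPairMeasure α (cutWedge ε') < jumpPairMeasure α (cutWedge ε) := by
  -- A nonempty open piece of the region between the two balls, gained by passing to the smaller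
  -- radius.
  set R : Set (ℝ × ℝ) := {z | 1 < z.1 ∧ z.1 < 1 + ε' ∧ 1 - ε' < z.1 - z.2 ∧ z.1 - z.2 < 1 - ε}
  have hR : IsOpen R :=
    (isOpen_lt continuous_const continuous_fst).and ((isOpen_lt continuous_fst continuous_const).and
      ((isOpen_lt continuous_const (by fun_prop)).and (isOpen_lt (by fun_prop) continuous_const)))
  have hpos : 0 < jumpPairMeasure α R := jumpPairMeasure_pos_of_isOpen h0 h2 hR
    ⟨(1 + ε, ε + (ε + ε') / 2), by
      simp only [R, mem_ofPred_eq]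
      refine ⟨?_, ?_, ?_, ?_⟩ <;> linarith⟩
  have hdisj : Disjoint (cutWedge ε') R := by
    rw [Set.disjoint_left]
    rintro z ⟨-, -, h3 | h3⟩ ⟨-, h4, h5, -⟩ <;> linarith
  have hsub : cutWedge ε' ∪ R ⊆ cutWedge ε := by
    refine union_subset (cutWedge_anti h.le) ?_
    rintro z ⟨h3, h4, h5, h6⟩
    exact ⟨h3, by linarith, Or.inr h6⟩
  calc _ < jumpPairMeasure α (cutWedge ε') + jumpPairMeasure α R :=
        ENNReal.lt_add_right (jumpPairMeasure_cutWedge_lt_top h0 h2 (hε.trans h)).ne hpos.ne'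
    _ = jumpPairMeasure α (cutWedge ε' ∪ R) := (measure_union hdisj hR.measurableSet).symm
    _ ≤ _ := measure_mono hsub

/-- Continuity from below along `1 / (n + 1)`, extended to real radii by monotonicity. No finiteness
is needed, so the limit may be infinite. -/
theorem tendsto_jumpPairMeasure_cutWedge (α : ℝ) :
    Tendsto (fun ε => jumpPairMeasure α (cutWedge ε)) (𝓝[>] 0) (𝓝 (jumpPairMeasure α wedge)) := by
  have hunion : ⋃ n : ℕ, cutWedge (1 / ((n : ℝ) + 1)) = wedge := by
    ext z
    simp only [mem_iUnion]
    constructor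
    · rintro ⟨n, h1, h2, -⟩; exact ⟨h1, h2⟩
    · rintro ⟨h1, h2⟩
      obtain ⟨n, hn⟩ := exists_nat_one_div_lt (sub_pos.2 h1)
      exact ⟨n, h1, h2, Or.inl (by linarith)⟩
  have hmono : Monotone fun n : ℕ => cutWedge (1 / ((n : ℝ) + 1)) := fun m n hmn =>
    cutWedge_anti (one_div_le_one_div_of_le (by positivity) (by gcongr))
  have hseq := tendsto_measure_iUnion_atTop (μ := jumpPairMeasure α) hmono
  rw [hunion] at hseq
  have hle : ∀ ε, jumpPairMeasure α (cutWedge ε) ≤ jumpPairMeasure α wedge := fun ε =>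
    measure_mono fun z hz => ⟨hz.1, hz.2.1⟩
  refine tendsto_order.2 ⟨fun c hc => ?_, fun c hc => Eventually.of_forall fun ε => (hle ε).trans_lt hc⟩
  obtain ⟨n, hn⟩ := (hseq.eventually (lt_mem_nhds hc)).exists
  filter_upwards [Ioo_mem_nhdsGT (by positivity : (0 : ℝ) < 1 / ((n : ℝ) + 1))] with ε hε
  exact lt_of_lt_of_le hn (measure_mono (cutWedge_anti hε.2.le))

/-- An outer approximation of `cutWedge ε`. -/
def fatCutWedge (ε δ : ℝ) : Set (ℝ × ℝ) :=
  {z | 1 - δ < z.1 ∧ z.1 - z.2 < 1 + δ ∧ (1 + ε - δ < z.1 ∨ z.1 - z.2 < 1 - ε + δ)}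

theorem isOpen_fatCutWedge (ε δ : ℝ) : IsOpen (fatCutWedge ε δ) :=
  (isOpen_lt continuous_const continuous_fst).and ((isOpen_lt (by fun_prop) continuous_const).and
    (isOpen_setOf_or (isOpen_lt continuous_const continuous_fst)
      (isOpen_lt (by fun_prop) continuous_const)))

/-- The closed version of `cutWedge ε`. -/
def closedCutWedge (ε : ℝ) : Set (ℝ × ℝ) :=
  {z | 1 ≤ z.1 ∧ z.1 - z.2 ≤ 1 ∧ (1 + ε ≤ z.1 ∨ z.1 - z.2 ≤ 1 - ε)}

/-- The open and closed cut wedges differ by subsets of four null lines. -/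
theorem jumpPairMeasure_eq_of_between {α ε : ℝ} {s : Set (ℝ × ℝ)} (h1 : cutWedge ε ⊆ s)
    (h2 : s ⊆ closedCutWedge ε) : jumpPairMeasure α s = jumpPairMeasure α (cutWedge ε) := by
  refine le_antisymm ?_ (measure_mono h1)
  have hsub : s ⊆ cutWedge ε ∪ ({z | z.1 = 1} ∪ {z | z.1 = 1 + ε} ∪
      ({z | z.1 - z.2 = 1} ∪ {z | z.1 - z.2 = 1 - ε})) := by
    intro z hz
    obtain ⟨h3, h4, h5⟩ := h2 hz
    simp only [cutWedge, mem_union, mem_ofPred_eq]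
    rcases h3.eq_or_lt with h3 | h3
    · exact Or.inr (Or.inl (Or.inl h3.symm))
    rcases h4.eq_or_lt with h4 | h4
    · exact Or.inr (Or.inr (Or.inl h4))
    rcases h5 with h5 | h5
    · rcases h5.eq_or_lt with h5 | h5
      · exact Or.inr (Or.inl (Or.inr h5.symm))
      · exact Or.inl ⟨h3, h4, Or.inl h5⟩
    · rcases h5.eq_or_lt with h5 | h5
      · exact Or.inr (Or.inr (Or.inr h5))
      · exact Or.inl ⟨h3, h4, Or.inr h5⟩
  refine (measure_mono hsub).trans ((measure_union_le _ _).trans_eq ?_)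
  rw [measure_union_null (measure_union_null (jumpPairMeasure_fst_eq _ _)
    (jumpPairMeasure_fst_eq _ _)) (measure_union_null (jumpPairMeasure_sub_eq _ _)
    (jumpPairMeasure_sub_eq _ _)), add_zero]

theorem tendsto_jumpPairMeasure_fatCutWedge {α : ℝ} (h0 : 0 < α) (h2 : α < 2) {ε : ℝ}
    (hε : 0 < ε) :
    Tendsto (fun δ => jumpPairMeasure α (fatCutWedge ε δ)) (𝓝[>] 0)
      (𝓝 (jumpPairMeasure α (cutWedge ε))) := by
  have hinter : ⋂ δ > (0 : ℝ), fatCutWedge ε δ = closedCutWedge ε := by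
    ext z
    simp only [mem_iInter, fatCutWedge, closedCutWedge, mem_ofPred_eq]
    constructor
    · intro h
      refine ⟨le_of_forall_pos_lt_add fun δ hδ => by linarith [(h δ hδ).1],
        le_of_forall_pos_lt_add fun δ hδ => (h δ hδ).2.1, ?_⟩
      by_contra! hcon
      set δ := min (1 + ε - z.1) (z.1 - z.2 - (1 - ε)) with hδ
      have hpos : 0 < δ := lt_min (by linarith) (by linarith)
      have l1 : δ ≤ 1 + ε - z.1 := min_le_left _ _
      have l2 : δ ≤ z.1 - z.2 - (1 - ε) := min_le_right _ _
      rcases (h δ hpos).2.2 with h3 | h3 <;> linarith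
    · rintro ⟨h1, h2, h3⟩ δ hδ
      exact ⟨by linarith, by linarith, h3.imp (fun h => by linarith) fun h => by linarith⟩
  rw [← jumpPairMeasure_eq_of_between (s := closedCutWedge ε)
    (fun z hz => ⟨hz.1.le, hz.2.1.le, hz.2.2.imp le_of_lt le_of_lt⟩) subset_rfl, ← hinter]
  refine tendsto_measure_biInter_gt (fun δ _ => (isOpen_fatCutWedge ε δ).nullMeasurableSet)
    (fun i j _ hij z hz => ⟨by linarith [hz.1], by linarith [hz.2.1],
      hz.2.2.imp (fun h => by linarith) fun h => by linarith⟩) ?_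
  -- Continuity from above needs one set of finite measure. This `δ` forces the first jump above `1
  -- / 2` and the second above `ε - 2δ ≥ ε / 2`.
  set δ := min (ε / 4) (1 / 2)
  have l1 : δ ≤ ε / 4 := min_le_left _ _
  have l2 : δ ≤ 1 / 2 := min_le_right _ _
  refine ⟨δ, lt_min (by linarith) (by norm_num), (jumpPairMeasure_lt_top_of_le h0 h2
    (u := 1 / 2) (v := ε / 2) (by norm_num) (by linarith) ?_).ne⟩
  rintro z ⟨h3, h4, h5 | h5⟩ <;> constructor <;> linarith

/-! ### The one-jump set -/

theorem levyMeasure_Ioo_lt_top {α : ℝ} (h0 : 0 < α) (h2 : α < 2) {ε : ℝ} (hε1 : ε < 1) :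
    levyMeasure α (Ioo (1 - ε) (1 + ε)) < ⊤ :=
  levyMeasure_lt_top_of_abs_gt h0 h2 (u := (1 - ε) / 2) (by linarith) fun a ha => by
    rw [abs_of_pos] <;> linarith [ha.1]

theorem levyMeasure_Ioo_pos {α : ℝ} (h0 : 0 < α) (h2 : α < 2) {ε : ℝ} (hε : 0 < ε) :
    0 < levyMeasure α (Ioo (1 - ε) (1 + ε)) :=
  levyMeasure_pos_of_isOpen h0 h2 isOpen_Ioo ⟨1, by constructor <;> linarith⟩

theorem levyMeasure_Ioo_strictMono {α : ℝ} (h0 : 0 < α) (h2 : α < 2) {ε ε' : ℝ} (hε : 0 < ε)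
    (h : ε < ε') (hε' : ε' < 1) :
    levyMeasure α (Ioo (1 - ε) (1 + ε)) < levyMeasure α (Ioo (1 - ε') (1 + ε')) := by
  have hdisj : Disjoint (Ioo (1 - ε) (1 + ε)) (Ioo (1 + ε) (1 + ε')) := by
    rw [Set.disjoint_left]
    intro a ha hb; linarith [ha.2, hb.1]
  calc _ < levyMeasure α (Ioo (1 - ε) (1 + ε)) + levyMeasure α (Ioo (1 + ε) (1 + ε')) :=
        ENNReal.lt_add_right (levyMeasure_Ioo_lt_top h0 h2 (h.trans hε')).ne
          (levyMeasure_pos_of_isOpen h0 h2 isOpen_Ioo (nonempty_Ioo.2 (by linarith))).ne'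
    _ = levyMeasure α (Ioo (1 - ε) (1 + ε) ∪ Ioo (1 + ε) (1 + ε')) :=
        (measure_union hdisj measurableSet_Ioo).symm
    _ ≤ _ := measure_mono (union_subset (Ioo_subset_Ioo (by linarith) (by linarith))
        (Ioo_subset_Ioo (by linarith) le_rfl))

theorem tendsto_levyMeasure_Ioo {α : ℝ} (h0 : 0 < α) (h2 : α < 2) {ε : ℝ} (hε1 : ε < 1) :
    Tendsto (fun δ => levyMeasure α (Ioo (1 - (ε + δ)) (1 + (ε + δ)))) (𝓝[>] 0)
      (𝓝 (levyMeasure α (Ioo (1 - ε) (1 + ε)))) := by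
  have hinter : ⋂ δ > (0 : ℝ), Ioo (1 - (ε + δ)) (1 + (ε + δ)) = Icc (1 - ε) (1 + ε) := by
    ext t
    simp only [mem_iInter, mem_Ioo, mem_Icc]
    constructor
    · intro h
      exact ⟨le_of_forall_pos_lt_add fun δ hδ => by linarith [(h δ hδ).1],
        le_of_forall_pos_lt_add fun δ hδ => by linarith [(h δ hδ).2]⟩
    · rintro ⟨h3, h4⟩ δ hδ
      constructor <;> linarith
  rw [measure_congr Ioo_ae_eq_Icc, ← hinter]
  refine tendsto_measure_biInter_gt (fun δ _ => measurableSet_Ioo.nullMeasurableSet)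
    (fun i j _ hij => Ioo_subset_Ioo (by linarith) (by linarith)) ⟨(1 - ε) / 2, by
      change (0 : ℝ) < _; linarith, (levyMeasure_Ioo_lt_top h0 h2 (by linarith)).ne⟩

/-! ### Values of `L` for the example sets -/

theorem tailL_mono {n : ℕ} (Λ : Measure (UnitSphere n)) {F G : Set (EuclideanSpace ℝ (Fin n))}
    (h : F ⊆ G) (k : ℕ) (α : ℝ) : tailL Λ F k α ≤ tailL Λ G k α := by
  unfold tailL
  gcongr

theorem smul_diagVec_apply (t : ℝ) (i : Fin 2) : (t • diagVec) i = t := by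
  fin_cases i <;> simp [diagVec]

theorem smul_vertVec_zero (t : ℝ) : (t • vertVec) 0 = 0 := by simp [vertVec]

theorem smul_vertVec_one (t : ℝ) : (t • vertVec) 1 = -t := by simp [vertVec]

/-- The pairs of jumps which carry the example vector into `F`. -/
def jumpSet (F : Set (EuclideanSpace ℝ (Fin 2))) : Set (ℝ × ℝ) :=
  {z | z.1 • diagVec + z.2 • vertVec ∈ F}

theorem measurableSet_jumpSet {F : Set (EuclideanSpace ℝ (Fin 2))} (hF : MeasurableSet F) :
    MeasurableSet (jumpSet F) :=
  (by fun_prop : Measurable fun z : ℝ × ℝ => z.1 • diagVec + z.2 • vertVec) hF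

theorem mixed_apply_zero (z : ℝ × ℝ) : (z.1 • diagVec + z.2 • vertVec) 0 = z.1 := by
  rw [PiLp.add_apply, smul_diagVec_apply, smul_vertVec_zero, add_zero]

theorem mixed_apply_one (z : ℝ × ℝ) : (z.1 • diagVec + z.2 • vertVec) 1 = z.1 - z.2 := by
  rw [PiLp.add_apply, smul_diagVec_apply, smul_vertVec_one, sub_eq_add_neg]

/-- When pairs of jumps of the same component contribute nothing, only the mixed term survives and
its multiplicity cancels the `1 / 2!`. -/
theorem tailL_example_two_of_null {α : ℝ} (h0 : 0 < α) (h2 : α < 2)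
    {F : Set (EuclideanSpace ℝ (Fin 2))} (hF : MeasurableSet F)
    (hd : jumpPairMeasure α {z | (z.1 + z.2) • diagVec ∈ F} = 0)
    (hv : ∀ t : ℝ, t • vertVec ∉ F) :
    tailL (exampleSpectral α) F 2 α = jumpPairMeasure α (jumpSet F) := by
  have h := tailL_example_two h0 h2 hF
  simp_rw [← add_smul] at h
  rw [jumpPairMeasure] at hd
  rw [hd, zero_add] at h
  simp only [hv, ofPred_false, measure_empty, add_zero] at h
  exact (ENNReal.mul_right_inj two_ne_zero ENNReal.ofNat_ne_top).1 h

theorem isOpen_exampleSet : IsOpen exampleSet :=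
  (isOpen_lt continuous_const (by fun_prop)).and (isOpen_lt (by fun_prop) continuous_const)

theorem isOpen_supBall (ε : ℝ) : IsOpen (supBall ε) := by
  have : supBall ε = ⋂ i, {x : EuclideanSpace ℝ (Fin 2) | |x i - 1| < ε} := by
    ext x; simp [supBall]
  rw [this]
  exact isOpen_iInter_of_finite fun i => isOpen_lt (by fun_prop) continuous_const

theorem jumpSet_exampleSet : jumpSet exampleSet = wedge := by
  ext z
  simp only [jumpSet, exampleSet, wedge, mem_ofPred_eq, mixed_apply_zero, mixed_apply_one]

theorem closure_exampleSet_subset :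
    closure exampleSet ⊆ {x : EuclideanSpace ℝ (Fin 2) | 1 ≤ x 0 ∧ x 1 ≤ 1} :=
  closure_minimal (fun x hx => ⟨hx.1.le, hx.2.le⟩)
    ((isClosed_le (f := fun _ => (1 : ℝ)) (g := fun x : EuclideanSpace ℝ (Fin 2) => x 0)
      continuous_const (by fun_prop)).and (isClosed_le (by fun_prop) continuous_const))

theorem tailL_exampleSet {α : ℝ} (h0 : 0 < α) (h2 : α < 2) :
    tailL (exampleSpectral α) exampleSet 2 α = jumpPairMeasure α wedge := by
  rw [tailL_example_two_of_null h0 h2 isOpen_exampleSet.measurableSet, jumpSet_exampleSet]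
  · have : {z : ℝ × ℝ | (z.1 + z.2) • diagVec ∈ exampleSet} = ∅ := by
      ext z
      simp only [exampleSet, mem_ofPred_eq, smul_diagVec_apply, mem_empty_iff_false, iff_false]
      rintro ⟨h, h'⟩; linarith
    rw [this, measure_empty]
  · rintro t ⟨h, -⟩
    rw [smul_vertVec_zero] at h
    linarith

theorem tailL_closure_exampleSet {α : ℝ} (h0 : 0 < α) (h2 : α < 2) :
    tailL (exampleSpectral α) (closure exampleSet) 2 α = jumpPairMeasure α wedge := by
  refine le_antisymm ?_ (tailL_exampleSet h0 h2 ▸ tailL_mono _ subset_closure 2 α)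
  rw [tailL_example_two_of_null h0 h2 isClosed_closure.measurableSet]
  · have hsub : jumpSet (closure exampleSet) ⊆
        wedge ∪ ({z | z.1 = 1} ∪ {z | z.1 - z.2 = 1}) := by
      intro z hz
      obtain ⟨h3, h4⟩ := closure_exampleSet_subset hz
      rw [mixed_apply_zero] at h3
      rw [mixed_apply_one] at h4
      rcases h3.eq_or_lt with h3 | h3
      · exact Or.inr (Or.inl h3.symm)
      rcases h4.eq_or_lt with h4 | h4
      · exact Or.inr (Or.inr h4)
      exact Or.inl ⟨h3, h4⟩
    refine (measure_mono hsub).trans ((measure_union_le _ _).trans_eq ?_)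
    rw [measure_union_null (jumpPairMeasure_fst_eq _ _) (jumpPairMeasure_sub_eq _ _), add_zero]
  · refine measure_mono_null (fun z hz => ?_) (jumpPairMeasure_add_eq α 1)
    obtain ⟨h3, h4⟩ := closure_exampleSet_subset hz
    rw [smul_diagVec_apply] at h3 h4
    exact le_antisymm h4 h3
  · intro t ht
    have h := (closure_exampleSet_subset ht).1
    rw [smul_vertVec_zero] at h
    linarith

/-- The thickening contains a piece of the diagonal near `(1, 1)`. It is reached by one diagonal
jump slightly above `1` and any diagonal jump in `(0, δ / 4)`, an interval of infinite Lévy mass. -/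
theorem tailL_thickening_exampleSet {α : ℝ} (h0 : 0 < α) (h2 : α < 2) {δ : ℝ} (hδ : 0 < δ) :
    tailL (exampleSpectral α) (Metric.thickening δ exampleSet) 2 α = ⊤ := by
  have hsub : Ioo 0 (δ / 4) ×ˢ Ioo 1 (1 + δ / 4) ⊆
      {z : ℝ × ℝ | z.1 • diagVec + z.2 • diagVec ∈ Metric.thickening δ exampleSet} := by
    rintro z ⟨⟨h3, h4⟩, h5, h6⟩
    simp only [mem_ofPred_eq, ← add_smul, Metric.mem_thickening_iff]
    -- Going straight down from the diagonal point to height `1 - δ / 4` enters `E` after a distance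
    -- below `3δ / 4`.
    refine ⟨!₂[z.1 + z.2, 1 - δ / 4], ⟨?_, ?_⟩, ?_⟩
    · simp; linarith
    · simp; linarith
    · rw [EuclideanSpace.dist_eq, Fin.sum_univ_two, smul_diagVec_apply, smul_diagVec_apply]
      rw [Real.sqrt_lt' hδ, Real.dist_eq, Real.dist_eq, sq_abs, sq_abs]
      simp only [Matrix.cons_val_zero, Matrix.cons_val_one, sub_self]
      nlinarith
  have htop : ((levyMeasure α).prod (levyMeasure α))
      {z : ℝ × ℝ | z.1 • diagVec + z.2 • diagVec ∈ Metric.thickening δ exampleSet} = ⊤ := by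
    refine top_le_iff.1 (le_trans ?_ (measure_mono hsub))
    rw [Measure.prod_prod, levyMeasure_Ioo_zero h0 h2 (by linarith), ENNReal.top_mul]
    exact (levyMeasure_pos_of_isOpen h0 h2 isOpen_Ioo (nonempty_Ioo.2 (by linarith))).ne'
  have h := tailL_example_two h0 h2 (Metric.isOpen_thickening (δ := δ) (E := exampleSet)).measurableSet
  rw [htop, top_add, top_add] at h
  by_contra hne
  exact ENNReal.mul_ne_top ENNReal.ofNat_ne_top hne h

/-! ### Adding and removing the ball at the corner -/

theorem abs_sub_lt_of_dist_lt {n : ℕ} {x y : EuclideanSpace ℝ (Fin n)} {δ : ℝ} (h : dist x y < δ)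
    (i : Fin n) : |x i - y i| < δ := by
  have := PiLp.norm_apply_le (x - y) i
  rw [← dist_eq_norm] at this
  exact this.trans_lt h

/-- The diagonal misses `E` and meets the ball in an interval. The vertical axis misses both, the
ball because `ε < 1`. -/
theorem gPlus_eq {α : ℝ} (h0 : 0 < α) (h2 : α < 2) {ε : ℝ} (hε1 : ε < 1) :
    gPlus α ε = levyMeasure α (Ioo (1 - ε) (1 + ε)) := by
  rw [gPlus, isOpen_exampleSet.interior_eq, tailL_example_one h0 h2
    (isOpen_exampleSet.union (isOpen_supBall ε)).measurableSet]
  have e1 : {t : ℝ | t • diagVec ∈ exampleSet ∪ supBall ε} = Ioo (1 - ε) (1 + ε) := by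
    ext t
    simp only [exampleSet, supBall, mem_ofPred_eq, mem_union, smul_diagVec_apply, mem_Ioo, abs_lt]
    constructor
    · rintro (⟨h, h'⟩ | h)
      · linarith
      · constructor <;> linarith [(h 0).1, (h 0).2]
    · rintro ⟨h, h'⟩
      exact Or.inr fun _ => by constructor <;> linarith
  have e2 : {t : ℝ | t • vertVec ∈ exampleSet ∪ supBall ε} = ∅ := by
    ext t
    simp only [exampleSet, supBall, mem_ofPred_eq, mem_union, mem_empty_iff_false, iff_false,
      smul_vertVec_zero]
    rintro (⟨h, -⟩ | h)
    · linarith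
    · have := h 0
      rw [smul_vertVec_zero] at this
      norm_num at this
      linarith
  rw [e1, e2, measure_empty, add_zero]

theorem tendsto_tailL_thickening_union {α : ℝ} (h0 : 0 < α) (h2 : α < 2) {ε : ℝ} (hε : 0 < ε)
    (hε1 : ε < 1) :
    Tendsto (fun δ : ℝ =>
      tailL (exampleSpectral α) (Metric.thickening δ (exampleSet ∪ supBall ε)) 1 α)
      (𝓝[>] 0) (𝓝 (gPlus α ε)) := by
  have hup := tendsto_levyMeasure_Ioo h0 h2 hε1
  rw [← gPlus_eq h0 h2 hε1] at hup
  refine tendsto_of_tendsto_of_tendsto_of_le_of_le' tendsto_const_nhds hup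
    (eventually_nhdsWithin_of_forall fun δ hδ => ?_) ?_
  · rw [gPlus, isOpen_exampleSet.interior_eq]
    exact tailL_mono _ (Metric.self_subset_thickening hδ _) 1 α
  · filter_upwards [Ioo_mem_nhdsGT (sub_pos.2 hε1)] with δ hδ
    obtain ⟨hδ0, hδ1⟩ := hδ
    rw [tailL_example_one h0 h2 Metric.isOpen_thickening.measurableSet]
    have e2 : {t : ℝ | t • vertVec ∈ Metric.thickening δ (exampleSet ∪ supBall ε)} = ∅ := by
      ext t
      simp only [mem_ofPred_eq, mem_empty_iff_false, iff_false, Metric.mem_thickening_iff]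
      rintro ⟨y, hy, hd⟩
      have h3 := abs_lt.1 (abs_sub_lt_of_dist_lt hd 0)
      rw [smul_vertVec_zero] at h3
      rcases hy with hy | hy
      · linarith [hy.1, h3.1]
      · linarith [(abs_lt.1 (hy 0)).1, h3.1]
    rw [e2, measure_empty, add_zero]
    refine measure_mono fun t ht => ?_
    obtain ⟨y, hy, hd⟩ := Metric.mem_thickening_iff.1 ht
    have h3 := abs_lt.1 (abs_sub_lt_of_dist_lt hd 0)
    have h4 := abs_lt.1 (abs_sub_lt_of_dist_lt hd 1)
    rw [smul_diagVec_apply] at h3 h4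
    rcases hy with hy | hy
    · constructor <;> linarith [hy.1, hy.2, h3.1, h4.2]
    · have := abs_lt.1 (hy 0)
      constructor <;> linarith [h3.1, h3.2, this.1, this.2]

theorem cutWedge_subset_jumpSet_diff (ε : ℝ) : cutWedge ε ⊆ jumpSet (exampleSet \ supBall ε) := by
  rintro z ⟨h1, h2, h3⟩
  refine ⟨⟨by rwa [mixed_apply_zero], by rwa [mixed_apply_one]⟩, fun h => ?_⟩
  have h4 := abs_lt.1 (h 0)
  have h5 := abs_lt.1 (h 1)
  rw [mixed_apply_zero] at h4
  rw [mixed_apply_one] at h5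
  rcases h3 with h3 | h3 <;> linarith [h4.1, h4.2, h5.1, h5.2]

theorem or_of_mem_diff {ε : ℝ} {x : EuclideanSpace ℝ (Fin 2)}
    (hx : x ∈ exampleSet \ supBall ε) : 1 < x 0 ∧ x 1 < 1 ∧ (1 + ε ≤ x 0 ∨ x 1 ≤ 1 - ε) := by
  obtain ⟨⟨h1, h2⟩, h3⟩ := hx
  refine ⟨h1, h2, ?_⟩
  by_contra! hcon
  refine h3 fun i => abs_lt.2 ?_
  fin_cases i
  · simp only [Fin.zero_eta]; constructor <;> linarith
  · simp only [Fin.mk_one]; constructor <;> linarith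

theorem jumpSet_diff_subset (ε : ℝ) :
    jumpSet (exampleSet \ supBall ε) ⊆ closedCutWedge ε := by
  intro z hz
  obtain ⟨h1, h2, h3⟩ := or_of_mem_diff hz
  rw [mixed_apply_zero] at h1 h3
  rw [mixed_apply_one] at h2 h3
  exact ⟨h1.le, h2.le, h3⟩

theorem cutWedge_subset_jumpSet_interior_diff (ε : ℝ) :
    cutWedge ε ⊆ jumpSet (interior (exampleSet \ supBall ε)) := by
  have hopen : IsOpen {x : EuclideanSpace ℝ (Fin 2) |
      1 < x 0 ∧ x 1 < 1 ∧ (1 + ε < x 0 ∨ x 1 < 1 - ε)} :=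
    (isOpen_lt continuous_const (by fun_prop)).and ((isOpen_lt (by fun_prop) continuous_const).and
      (isOpen_setOf_or (isOpen_lt continuous_const (by fun_prop))
        (isOpen_lt (by fun_prop) continuous_const)))
  have hsub : {x : EuclideanSpace ℝ (Fin 2) |
      1 < x 0 ∧ x 1 < 1 ∧ (1 + ε < x 0 ∨ x 1 < 1 - ε)} ⊆ exampleSet \ supBall ε := by
    rintro x ⟨h1, h2, h3⟩
    refine ⟨⟨h1, h2⟩, fun h => ?_⟩
    have h4 := abs_lt.1 (h 0)
    have h5 := abs_lt.1 (h 1)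
    rcases h3 with h3 | h3 <;> linarith [h4.1, h4.2, h5.1, h5.2]
  rintro z ⟨h1, h2, h3⟩
  refine interior_maximal hsub hopen ?_
  simp only [mem_ofPred_eq, mixed_apply_zero, mixed_apply_one]
  exact ⟨h1, h2, h3⟩

/-- Both lines miss `E`, so only mixed pairs count, and these are trapped between the open and
closed cut wedges. -/
theorem gMinus_eq {α : ℝ} (h0 : 0 < α) (h2 : α < 2) (ε : ℝ) :
    gMinus α ε = jumpPairMeasure α (cutWedge ε) := by
  rw [gMinus, tailL_example_two_of_null h0 h2 isOpen_interior.measurableSet]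
  · exact jumpPairMeasure_eq_of_between (cutWedge_subset_jumpSet_interior_diff ε)
      (Subset.trans (fun z hz =>
        interior_subset (s := exampleSet \ supBall ε) hz) (jumpSet_diff_subset ε))
  · have : {z : ℝ × ℝ | (z.1 + z.2) • diagVec ∈ interior (exampleSet \ supBall ε)} = ∅ := by
      ext z
      simp only [mem_ofPred_eq, mem_empty_iff_false, iff_false]
      intro h
      have := (interior_subset h).1
      simp only [exampleSet, mem_ofPred_eq, smul_diagVec_apply] at this
      linarith [this.1, this.2]
    rw [this, measure_empty]
  · intro t ht
    have := (interior_subset ht).1.1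
    rw [smul_vertVec_zero] at this
    linarith

theorem tendsto_tailL_thickening_diff {α : ℝ} (h0 : 0 < α) (h2 : α < 2) {ε : ℝ} (hε : 0 < ε) :
    Tendsto (fun δ : ℝ =>
      tailL (exampleSpectral α) (Metric.thickening δ (exampleSet \ supBall ε)) 2 α)
      (𝓝[>] 0) (𝓝 (gMinus α ε)) := by
  have hup := tendsto_jumpPairMeasure_fatCutWedge h0 h2 hε
  rw [← gMinus_eq h0 h2 ε] at hup
  refine tendsto_of_tendsto_of_tendsto_of_le_of_le' tendsto_const_nhds hup
    (eventually_nhdsWithin_of_forall fun δ hδ => ?_) ?_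
  · exact tailL_mono _ (interior_subset.trans (Metric.self_subset_thickening hδ _)) 2 α
  · have hmin : 0 < min (ε / 2) 1 := lt_min (by linarith) one_pos
    filter_upwards [Ioo_mem_nhdsGT hmin] with δ hδ
    obtain ⟨hδ0, hδ1⟩ := hδ
    have l1 := hδ1.trans_le (min_le_left _ _)
    have l2 := hδ1.trans_le (min_le_right _ _)
    have hthick : ∀ x ∈ Metric.thickening δ (exampleSet \ supBall ε),
        1 - δ < x 0 ∧ x 1 < 1 + δ ∧ (1 + ε - δ < x 0 ∨ x 1 < 1 - ε + δ) := by
      intro x hx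
      obtain ⟨y, hy, hd⟩ := Metric.mem_thickening_iff.1 hx
      obtain ⟨h1, h2, h3⟩ := or_of_mem_diff hy
      have h4 := abs_lt.1 (abs_sub_lt_of_dist_lt hd 0)
      have h5 := abs_lt.1 (abs_sub_lt_of_dist_lt hd 1)
      exact ⟨by linarith [h4.1], by linarith [h5.2],
        h3.imp (fun h => by linarith [h4.1]) fun h => by linarith [h5.2]⟩
    rw [tailL_example_two_of_null h0 h2 Metric.isOpen_thickening.measurableSet]
    · refine measure_mono fun z hz => ?_
      have := hthick _ hz
      rwa [mixed_apply_zero, mixed_apply_one] at this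
    · have : {z : ℝ × ℝ | (z.1 + z.2) • diagVec ∈
          Metric.thickening δ (exampleSet \ supBall ε)} = ∅ := by
        ext z
        simp only [mem_ofPred_eq, mem_empty_iff_false, iff_false]
        intro h
        have := hthick _ h
        rw [smul_diagVec_apply, smul_diagVec_apply] at this
        rcases this with ⟨h3, h4, h5 | h5⟩ <;> linarith
      rw [this, measure_empty]
    · intro t ht
      have := (hthick _ ht).1
      rw [smul_vertVec_zero] at this
      linarith

/-! ### The law of the example vector -/

theorem exampleVector_eq {Ω : Type*} (S₁ S₂ : Ω → ℝ) (ω : Ω) :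
    exampleVector S₁ S₂ ω = S₁ ω • diagVec + S₂ ω • vertVec := by
  ext i
  fin_cases i <;> simp [exampleVector, diagVec, vertVec, sub_eq_add_neg]

theorem exampleVector_mem_smul_iff {Ω : Type*} (S₁ S₂ : Ω → ℝ) (ω : Ω) {h : ℝ} (hh : 0 < h)
    (F : Set (EuclideanSpace ℝ (Fin 2))) :
    exampleVector S₁ S₂ ω ∈ h • F ↔ (h⁻¹ * S₁ ω, h⁻¹ * S₂ ω) ∈ jumpSet F := by
  rw [mem_smul_set_iff_inv_smul_mem₀ hh.ne', exampleVector_eq, smul_add, smul_smul, smul_smul]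
  rfl

theorem map_prodMk_eq_stableLaw_prod {Ω : Type*} [MeasurableSpace Ω] {P : Measure Ω}
    [IsProbabilityMeasure P] {α : ℝ} (h0 : 0 < α) (h2 : α < 2) {S₁ S₂ : Ω → ℝ}
    (hS₁ : Measurable S₁) (hS₂ : Measurable S₂) (hindep : IndepFun S₁ S₂ P)
    (hlaw₁ : IsStdStable α (P.map S₁)) (hlaw₂ : IsStdStable α (P.map S₂)) :
    P.map (fun ω => (S₁ ω, S₂ ω)) = (stableLaw α).prod (stableLaw α) := by
  rw [(indepFun_iff_map_prod_eq_prod_map_map hS₁.aemeasurable hS₂.aemeasurable).1 hindep,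
    hlaw₁.eq_withDensity h0 h2, hlaw₂.eq_withDensity h0 h2]
  rfl

theorem measure_exampleVector_mem_smul {Ω : Type*} [MeasurableSpace Ω] {P : Measure Ω} {α : ℝ}
    {S₁ S₂ : Ω → ℝ} (hS₁ : Measurable S₁) (hS₂ : Measurable S₂)
    (hmap : P.map (fun ω => (S₁ ω, S₂ ω)) = (stableLaw α).prod (stableLaw α))
    {F : Set (EuclideanSpace ℝ (Fin 2))} (hF : MeasurableSet F) {h : ℝ} (hh : 0 < h) :
    P {ω | exampleVector S₁ S₂ ω ∈ h • F} =
      ((stableLaw α).prod (stableLaw α)) {z | (h⁻¹ * z.1, h⁻¹ * z.2) ∈ jumpSet F} := by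
  have hm : MeasurableSet {z : ℝ × ℝ | (h⁻¹ * z.1, h⁻¹ * z.2) ∈ jumpSet F} :=
    (by fun_prop : Measurable fun z : ℝ × ℝ => (h⁻¹ * z.1, h⁻¹ * z.2)) (measurableSet_jumpSet hF)
  rw [← hmap, Measure.map_apply (hS₁.prodMk hS₂) hm]
  simp only [exampleVector_mem_smul_iff S₁ S₂ _ hh]
  rfl

theorem inner_diagDir (θ : EuclideanSpace ℝ (Fin 2)) :
    ⟪θ, (diagDir : EuclideanSpace ℝ (Fin 2))⟫ = (θ 0 + θ 1) / √2 := by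
  simp [diagDir, PiLp.inner_apply, Fin.sum_univ_two]
  ring

theorem inner_vertDir (θ : EuclideanSpace ℝ (Fin 2)) :
    ⟪θ, (vertDir : EuclideanSpace ℝ (Fin 2))⟫ = θ 1 := by
  simp [vertDir, PiLp.inner_apply, Fin.sum_univ_two]

theorem exampleSpectral_map_neg (α : ℝ) :
    (exampleSpectral α).map (fun x => -x) = exampleSpectral α := by
  have hm : Measurable fun x : UnitSphere 2 => -x := measurable_neg
  simp only [exampleSpectral, Measure.map_add _ _ hm, Measure.map_smul, Measure.map_dirac' hm,
    neg_neg]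
  rw [add_comm (Measure.dirac (-diagDir)), add_comm (Measure.dirac (-vertDir))]

theorem integral_abs_inner_rpow_exampleSpectral (α : ℝ)
    (θ : EuclideanSpace ℝ (Fin 2)) :
    ∫ x, |⟪θ, (x : EuclideanSpace ℝ (Fin 2))⟫| ^ α ∂exampleSpectral α =
      |θ 0 + θ 1| ^ α + |θ 1| ^ α := by
  have hm : Measurable fun x : UnitSphere 2 => |⟪θ, (x : EuclideanSpace ℝ (Fin 2))⟫| ^ α := by
    fun_prop
  rw [integral_eq_lintegral_of_nonneg_ae (ae_of_all _ fun x => by positivity)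
    hm.aestronglyMeasurable, lintegral_exampleSpectral]
  simp only [coe_neg_sphere, inner_neg_right, abs_neg, inner_diagDir, inner_vertDir]
  rw [← ENNReal.ofReal_add (by positivity) (by positivity),
    ← ENNReal.ofReal_add (by positivity) (by positivity), ← ENNReal.ofReal_mul (by positivity),
    ← ENNReal.ofReal_mul (by positivity), ← ENNReal.ofReal_add (by positivity) (by positivity),
    ENNReal.toReal_ofReal (by positivity), abs_div, abs_of_pos (by positivity : 0 < √2),
    Real.div_rpow (abs_nonneg _) (by positivity), Real.sqrt_eq_rpow, ← Real.rpow_mul two_pos.le,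
    show 1 / 2 * α = α / 2 by ring]
  have : 0 < (2 : ℝ) ^ (α / 2) := by positivity
  field_simp
  ring

theorem isSpectralMeasure_exampleSpectral {Ω : Type*} [MeasurableSpace Ω] {P : Measure Ω}
    [IsProbabilityMeasure P] {α : ℝ} {S₁ S₂ : Ω → ℝ}
    (hS₁ : Measurable S₁) (hS₂ : Measurable S₂) (hindep : IndepFun S₁ S₂ P)
    (hlaw₁ : IsStdStable α (P.map S₁)) (hlaw₂ : IsStdStable α (P.map S₂)) :
    IsSpectralMeasure α (exampleSpectral α) (P.map (exampleVector S₁ S₂)) := by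
  refine ⟨inferInstance, exampleSpectral_map_neg α, fun θ => ?_⟩
  have hX : Measurable (exampleVector S₁ S₂) := by
    have : exampleVector S₁ S₂ = fun ω => S₁ ω • diagVec + S₂ ω • vertVec :=
      funext (exampleVector_eq S₁ S₂)
    rw [this]; fun_prop
  have := hlaw₁.1
  have := hlaw₂.1
  have hprod := (indepFun_iff_map_prod_eq_prod_map_map hS₁.aemeasurable hS₂.aemeasurable).1 hindep
  have hinner : ∀ ω, ⟪exampleVector S₁ S₂ ω, θ⟫ = (θ 0 + θ 1) * S₁ ω + (-θ 1) * S₂ ω := fun ω => by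
    rw [exampleVector_eq]
    simp [diagVec, vertVec, PiLp.inner_apply, Fin.sum_univ_two]
    ring
  have hc : charFun (P.map (exampleVector S₁ S₂)) θ =
      charFun (P.map S₁) (θ 0 + θ 1) * charFun (P.map S₂) (-θ 1) := by
    rw [charFun_apply, charFun_apply_real, charFun_apply_real, ← integral_prod_mul, ← hprod,
      integral_map hX.aemeasurable (Continuous.aestronglyMeasurable (by fun_prop)),
      integral_map (hS₁.prodMk hS₂).aemeasurable (Continuous.aestronglyMeasurable (by fun_prop))]
    congr 1; ext ω
    rw [hinner, ← Complex.exp_add]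
    push_cast
    ring_nf
  rw [hc, hlaw₁.2, hlaw₂.2, ← Complex.exp_add, integral_abs_inner_rpow_exampleSpectral α, abs_neg]
  push_cast
  ring_nf

/-! ### Probability asymptotics -/

/-- One jump of `S₁` lands in the ball while `S₂` stays negligible at scale `h`. The weight `w h a`
is the probability that `S₂` does not push the second coordinate out, and it tends to one. -/
theorem tendsto_rpow_mul_stableLaw_prod_supBall {α : ℝ} (h0 : 0 < α) (h2 : α < 2)
    [IsProbabilityMeasure (stableLaw α)] {ε : ℝ} (hε1 : ε < 1) :
    Tendsto (fun h : ℝ => ENNReal.ofReal (h ^ α) *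
        ((stableLaw α).prod (stableLaw α)) {z | (h⁻¹ * z.1, h⁻¹ * z.2) ∈ jumpSet (supBall ε)})
      atTop (𝓝 (levyMeasure α (Ioo (1 - ε) (1 + ε)))) := by
  have hA := measurableSet_jumpSet (isOpen_supBall ε).measurableSet
  have hmem : ∀ z, z ∈ jumpSet (supBall ε) ↔ |z.1 - 1| < ε ∧ |z.1 - z.2 - 1| < ε := fun z => by
    simp only [jumpSet, supBall, mem_ofPred_eq, Fin.forall_fin_two, mixed_apply_zero,
      mixed_apply_one]
  set w : ℝ → ℝ → ℝ≥0∞ := fun h a => stableLaw α {y | |a - h⁻¹ * y - 1| < ε} with hw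
  have hwset : ∀ h : ℝ, MeasurableSet {z : ℝ × ℝ | |z.1 - h⁻¹ * z.2 - 1| < ε} := fun h =>
    measurableSet_lt (by fun_prop) (by fun_prop)
  have hwm : ∀ h, Measurable (w h) := fun h => measurable_measure_prodMk_left (hwset h)
  have hlim := tendsto_lintegral_scaledDensity_mul h0 h2 (measurableSet_Ioo (a := 1 - ε) (b := 1 + ε))
    (levyMeasure_Ioo_lt_top h0 h2 hε1).ne hwm (fun h a => prob_le_one) (fun a ha => by
      have h3 := tendsto_measure_of_tendsto_indicator (μ := stableLaw α) (L := atTop)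
        (As := fun h : ℝ => {y : ℝ | |a - h⁻¹ * y - 1| < ε}) (A := univ)
        (fun h : ℝ => measurableSet_lt (by fun_prop) (by fun_prop))
        MeasurableSet.univ (measure_ne_top _ _) (Eventually.of_forall fun _ => subset_univ _)
        (fun y => by
          have h4 : Tendsto (fun h : ℝ => |a - h⁻¹ * y - 1|) atTop (𝓝 |a - 0 * y - 1|) :=
            ((tendsto_const_nhds.sub (tendsto_inv_atTop_zero.mul_const y)).sub_const 1).abs
          have h5 : |a - 0 * y - 1| < ε := by
            rw [zero_mul, sub_zero, abs_lt]; constructor <;> linarith [ha.1, ha.2]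
          filter_upwards [h4.eventually_lt_const h5] with h h6
          exact ⟨fun _ => mem_univ _, fun _ => h6⟩)
      rwa [measure_univ] at h3)
  refine hlim.congr' ((eventually_gt_atTop 0).mono fun h hh => ?_)
  have hm : MeasurableSet {z : ℝ × ℝ | (h⁻¹ * z.1, h⁻¹ * z.2) ∈ jumpSet (supBall ε)} :=
    (by fun_prop : Measurable fun z : ℝ × ℝ => (h⁻¹ * z.1, h⁻¹ * z.2)) hA
  have hsec : ∀ x : ℝ, stableLaw α
      (Prod.mk x ⁻¹' {z : ℝ × ℝ | (h⁻¹ * z.1, h⁻¹ * z.2) ∈ jumpSet (supBall ε)}) =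
        (Ioo (1 - ε) (1 + ε)).indicator (w h) (h⁻¹ * x) := fun x => by
    have hiff : h⁻¹ * x ∈ Ioo (1 - ε) (1 + ε) ↔ |h⁻¹ * x - 1| < ε := by
      rw [abs_lt, mem_Ioo]; constructor <;> rintro ⟨h3, h4⟩ <;> constructor <;> linarith
    by_cases hx : |h⁻¹ * x - 1| < ε
    · rw [indicator_of_mem (hiff.2 hx), hw]
      congr 1; ext y
      simp only [mem_preimage, mem_ofPred_eq, hmem, hx, true_and]
    · rw [indicator_of_notMem (fun h => hx (hiff.1 h))]
      simp [hmem, hx]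
  beta_reduce
  rw [Measure.prod_apply hm]
  simp_rw [hsec]
  rw [rpow_mul_lintegral_stableLaw h0 hh ((hwm h).indicator measurableSet_Ioo),
    ← lintegral_indicator measurableSet_Ioo]
  congr 1; ext a
  by_cases ha : a ∈ Ioo (1 - ε) (1 + ε)
  · rw [indicator_of_mem ha, indicator_of_mem ha]
  · rw [indicator_of_notMem ha, indicator_of_notMem ha, mul_zero]

theorem scaled_wedge_eq {h : ℝ} (hh : 0 < h) :
    {z : ℝ × ℝ | (h⁻¹ * z.1, h⁻¹ * z.2) ∈ wedge} = {z | h < z.1 ∧ z.1 - z.2 < h} := by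
  ext z
  simp only [wedge, mem_ofPred_eq]
  rw [← mul_sub, inv_mul_eq_div, inv_mul_eq_div, one_lt_div hh, div_lt_one hh]

theorem tendsto_mul_measureReal_of_tendsto {Ω : Type*} [MeasurableSpace Ω] {P : Measure Ω}
    {f : ℝ → ℝ} (hf : ∀ᶠ h in atTop, 0 ≤ f h) {A : ℝ → Set Ω} {c : ℝ} (hc : 0 ≤ c)
    (h : Tendsto (fun h => ENNReal.ofReal (f h) * P (A h)) atTop (𝓝 (ENNReal.ofReal c))) :
    Tendsto (fun h => f h * P.real (A h)) atTop (𝓝 c) := by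
  have := (ENNReal.tendsto_toReal ENNReal.ofReal_ne_top).comp h
  rw [ENNReal.toReal_ofReal hc] at this
  refine this.congr' (hf.mono fun x hx => ?_)
  simp [Measure.real, ENNReal.toReal_ofReal hx]

theorem betaConst_pos {α : ℝ} (h0 : 0 < α) (h1 : α < 1) : 0 < betaConst α := by
  have hc := stableTailConst_pos h0 (by linarith)
  have := Real.Gamma_pos_of_pos (by linarith : 0 < 2 * α)
  have := Real.Gamma_pos_of_pos (by linarith : 0 < 1 - α)
  have := Real.Gamma_pos_of_pos (by linarith : 0 < 1 + α)
  unfold betaConst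
  positivity

/-- For `α < 1` the wedge has finite intensity and contributes order `h ^ (-2α)`, negligible against
the order `h ^ (-α)` of the ball. -/
theorem tendsto_rpow_mul_stableLaw_prod_union {α : ℝ} (h0 : 0 < α) (h1 : α < 1)
    [IsProbabilityMeasure (stableLaw α)] {ε : ℝ} (hε1 : ε < 1) :
    Tendsto (fun h : ℝ => ENNReal.ofReal (h ^ α) * ((stableLaw α).prod (stableLaw α))
        {z | (h⁻¹ * z.1, h⁻¹ * z.2) ∈ jumpSet (exampleSet ∪ supBall ε)})
      atTop (𝓝 (levyMeasure α (Ioo (1 - ε) (1 + ε)))) := by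
  have h2 : α < 2 := by linarith
  have hball := tendsto_rpow_mul_stableLaw_prod_supBall h0 h2 hε1
  have hfin : jumpPairMeasure α wedge ≠ ⊤ := by
    rw [jumpPairMeasure_wedge_of_lt_one h0 h1]; exact ENNReal.ofReal_ne_top
  have hwedge := tendsto_rpow_mul_stableLaw_prod h0 h2 isOpen_wedge.measurableSet hfin
  have hsmall : Tendsto (fun h : ℝ => ENNReal.ofReal (h ^ (-α))) atTop (𝓝 0) := by
    have := ENNReal.tendsto_ofReal (tendsto_rpow_neg_atTop h0)
    rwa [ENNReal.ofReal_zero] at this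
  have hw0 : Tendsto (fun h : ℝ => ENNReal.ofReal (h ^ α) * ((stableLaw α).prod (stableLaw α))
      {z | (h⁻¹ * z.1, h⁻¹ * z.2) ∈ wedge}) atTop (𝓝 0) := by
    have := ENNReal.Tendsto.mul hsmall (Or.inr hfin) hwedge (Or.inr ENNReal.zero_ne_top)
    rw [zero_mul] at this
    refine this.congr' ((eventually_gt_atTop 0).mono fun h hh => ?_)
    beta_reduce
    rw [← mul_assoc, ← ENNReal.ofReal_mul (by positivity), ← Real.rpow_add hh]
    congr 3; ring
  have hup := hball.add hw0
  rw [add_zero] at hup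
  refine tendsto_of_tendsto_of_tendsto_of_le_of_le hball hup (fun h => ?_) (fun h => ?_)
  · exact mul_le_mul_right (measure_mono fun z hz => Or.inr hz) _
  · beta_reduce
    rw [← mul_add]
    refine mul_le_mul_right ((measure_mono ?_).trans (measure_union_le _ _)) _
    rintro z (hz | hz)
    · refine Or.inr ?_
      have : (h⁻¹ * z.1, h⁻¹ * z.2) ∈ jumpSet exampleSet := hz
      rwa [jumpSet_exampleSet] at this
    · exact Or.inl hz

theorem mainTheorem3 {Ω : Type*} [MeasurableSpace Ω] (P : Measure Ω) [IsProbabilityMeasure P]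
    (α : ℝ) (hα0 : 0 < α) (hα2 : α < 2) (S₁ S₂ : Ω → ℝ)
    (hS₁ : Measurable S₁) (hS₂ : Measurable S₂) (hindep : IndepFun S₁ S₂ P)
    (hlaw₁ : IsStdStable α (P.map S₁)) (hlaw₂ : IsStdStable α (P.map S₂)) :
    -- the spectral measure of `X`
    IsSpectralMeasure α (exampleSpectral α) (P.map (exampleVector S₁ S₂)) ∧
    -- decay rate of `P (X ∈ hE)`
    ((α < 1 →
        Tendsto (fun h : ℝ => h ^ (2 * α) * P.real {ω | exampleVector S₁ S₂ ω ∈ h • exampleSet})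
          atTop (𝓝 (betaConst α))) ∧
      (α = 1 →
        Tendsto (fun h : ℝ =>
            h ^ 2 / Real.log h * P.real {ω | exampleVector S₁ S₂ ω ∈ h • exampleSet})
          atTop (𝓝 (stableTailConst 1 ^ 2 / 4))) ∧
      (1 < α →
        Integrable S₁ P ∧
        Tendsto (fun h : ℝ => h ^ (1 + α) * P.real {ω | exampleVector S₁ S₂ ω ∈ h • exampleSet})
          atTop (𝓝 (stableTailConst α * α * (∫ ω, |S₁ ω| ∂P) / 4)))) ∧
    -- values of `L` for `E`
    (Tendsto (fun δ : ℝ => tailL (exampleSpectral α) (Metric.thickening δ exampleSet) 2 α)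
        (𝓝[>] 0) (𝓝 ⊤) ∧
      tailL (exampleSpectral α) (interior exampleSet) 2 α =
        tailL (exampleSpectral α) (closure exampleSet) 2 α ∧
      (1 ≤ α → tailL (exampleSpectral α) (interior exampleSet) 2 α = ⊤) ∧
      (α < 1 →
        tailL (exampleSpectral α) (interior exampleSet) 2 α = ENNReal.ofReal (betaConst α))) ∧
    -- adding or removing a ball around `(1, 1)`
    (α < 1 →
      (∀ ε : ℝ, 0 < ε → ε < 1 →
        0 < gPlus α ε ∧ gPlus α ε < ⊤ ∧
        Tendsto (fun δ : ℝ =>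
            tailL (exampleSpectral α) (Metric.thickening δ (exampleSet ∪ supBall ε)) 1 α)
          (𝓝[>] 0) (𝓝 (gPlus α ε)) ∧
        Tendsto (fun h : ℝ => ENNReal.ofReal (h ^ α) *
            P {ω | exampleVector S₁ S₂ ω ∈ h • (exampleSet ∪ supBall ε)})
          atTop (𝓝 (gPlus α ε))) ∧
      (∀ ε : ℝ, 0 < ε →
        0 < gMinus α ε ∧ gMinus α ε < ⊤ ∧
        Tendsto (fun δ : ℝ =>
            tailL (exampleSpectral α) (Metric.thickening δ (exampleSet \ supBall ε)) 2 α)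
          (𝓝[>] 0) (𝓝 (gMinus α ε)) ∧
        Tendsto (fun h : ℝ => ENNReal.ofReal (h ^ (2 * α)) *
            P {ω | exampleVector S₁ S₂ ω ∈ h • (exampleSet \ supBall ε)})
          atTop (𝓝 (gMinus α ε)))) ∧
    -- dependence on the radius of the ball
    (StrictMonoOn (gPlus α) (Ioo 0 1) ∧
      Tendsto (gPlus α) (𝓝[>] 0) (𝓝 0) ∧
      StrictAntiOn (gMinus α) (Ioi 0) ∧
      (1 ≤ α → Tendsto (gMinus α) (𝓝[>] 0) (𝓝 ⊤)) ∧
      (α < 1 → Tendsto (gMinus α) (𝓝[>] 0) (𝓝 (ENNReal.ofReal (betaConst α))))) := by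
  have hmap := map_prodMk_eq_stableLaw_prod hα0 hα2 hS₁ hS₂ hindep hlaw₁ hlaw₂
  have hprob : IsProbabilityMeasure (stableLaw α) := isProbabilityMeasure_stableLaw hα0 hα2 hlaw₁
  have hE := isOpen_exampleSet
  have hball := isOpen_supBall
  have hlawE : ∀ h : ℝ, 0 < h → P {ω | exampleVector S₁ S₂ ω ∈ h • exampleSet} =
      ((stableLaw α).prod (stableLaw α)) {z | h < z.1 ∧ z.1 - z.2 < h} := fun h hh => by
    rw [measure_exampleVector_mem_smul hS₁ hS₂ hmap hE.measurableSet hh, jumpSet_exampleSet,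
      scaled_wedge_eq hh]
  have hc := stableTailConst_pos hα0 hα2
  refine ⟨isSpectralMeasure_exampleSpectral hS₁ hS₂ hindep hlaw₁ hlaw₂,
    ⟨fun h1 => ?_, fun h1 => ?_, fun h1 => ?_⟩, ⟨?_, ?_, fun h1 => ?_, fun h1 => ?_⟩,
    fun h1 => ⟨fun ε hε hε1 => ⟨?_, ?_, ?_, ?_⟩, fun ε hε => ⟨?_, ?_, ?_, ?_⟩⟩,
    ?_, ?_, ?_, fun h1 => ?_, fun h1 => ?_⟩
  · have hfin : jumpPairMeasure α wedge ≠ ⊤ := by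
      rw [jumpPairMeasure_wedge_of_lt_one hα0 h1]; exact ENNReal.ofReal_ne_top
    have hw := tendsto_rpow_mul_stableLaw_prod hα0 hα2 isOpen_wedge.measurableSet hfin
    rw [← jumpPairMeasure, jumpPairMeasure_wedge_of_lt_one hα0 h1] at hw
    refine tendsto_mul_measureReal_of_tendsto
      ((eventually_ge_atTop 0).mono fun h hh => Real.rpow_nonneg hh _) (betaConst_pos hα0 h1).le
      (hw.congr' ((eventually_gt_atTop 0).mono fun h hh => ?_))
    beta_reduce
    rw [hlawE h hh, scaled_wedge_eq hh]
  · subst h1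
    refine tendsto_mul_measureReal_of_tendsto
      ((eventually_ge_atTop 1).mono fun h hh => div_nonneg (sq_nonneg h) (Real.log_nonneg hh))
      (by positivity) (tendsto_wedge_cauchy.congr' ((eventually_gt_atTop 0).mono fun h hh => ?_))
    beta_reduce
    rw [hlawE h hh, Real.rpow_two]
  · have hS : P.map S₁ = stableLaw α := hlaw₁.eq_withDensity hα0 hα2
    have hint : Integrable (fun x : ℝ => x) (P.map S₁) := hS ▸ integrable_id_stableLaw h1 hα2
    have habs : ∫ ω, |S₁ ω| ∂P = ∫ x, |x| ∂stableLaw α := by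
      rw [← hS, integral_map hS₁.aemeasurable (Continuous.aestronglyMeasurable (by fun_prop))]
    refine ⟨hint.comp_measurable hS₁, ?_⟩
    have hfin : ∫⁻ u in Ioi 0, stableLaw α (Ioi u) ≠ ⊤ := by
      rw [lintegral_stableLaw_Ioi h1 hα2]; exact ENNReal.ofReal_ne_top
    have hw := tendsto_rpow_mul_wedge_of_lintegral_tail_ne_top hα0 hα2 hfin
    have hval : stableTailConst α / 2 * α * ((∫ ω, |S₁ ω| ∂P) / 2) =
        stableTailConst α * α * (∫ ω, |S₁ ω| ∂P) / 4 := by ring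
    have hnn : 0 ≤ ∫ ω, |S₁ ω| ∂P := integral_nonneg fun ω => abs_nonneg _
    rw [lintegral_stableLaw_Ioi h1 hα2, ← habs, ← ENNReal.ofReal_mul (by positivity), hval] at hw
    refine tendsto_mul_measureReal_of_tendsto
      ((eventually_ge_atTop 0).mono fun h hh => Real.rpow_nonneg hh _) (by positivity)
      (hw.congr' ((eventually_gt_atTop 0).mono fun h hh => ?_))
    beta_reduce
    rw [hlawE h hh]
  · exact tendsto_const_nhds.congr' (eventually_nhdsWithin_of_forall fun δ hδ =>
      (tailL_thickening_exampleSet hα0 hα2 hδ).symm)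
  · rw [hE.interior_eq, tailL_exampleSet hα0 hα2, tailL_closure_exampleSet hα0 hα2]
  · rw [hE.interior_eq, tailL_exampleSet hα0 hα2, jumpPairMeasure_wedge_of_one_le h1 hα2]
  · rw [hE.interior_eq, tailL_exampleSet hα0 hα2, jumpPairMeasure_wedge_of_lt_one hα0 h1]
  · rw [gPlus_eq hα0 hα2 hε1]; exact levyMeasure_Ioo_pos hα0 hα2 hε
  · rw [gPlus_eq hα0 hα2 hε1]; exact levyMeasure_Ioo_lt_top hα0 hα2 hε1
  · exact tendsto_tailL_thickening_union hα0 hα2 hε hε1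
  · rw [gPlus_eq hα0 hα2 hε1]
    refine (tendsto_rpow_mul_stableLaw_prod_union hα0 h1 hε1).congr'
      ((eventually_gt_atTop 0).mono fun h hh => ?_)
    beta_reduce
    rw [measure_exampleVector_mem_smul hS₁ hS₂ hmap (hE.union (hball ε)).measurableSet hh]
  · rw [gMinus_eq hα0 hα2 ε]; exact jumpPairMeasure_cutWedge_pos hα0 hα2 hε
  · rw [gMinus_eq hα0 hα2 ε]; exact jumpPairMeasure_cutWedge_lt_top hα0 hα2 hε
  · exact tendsto_tailL_thickening_diff hα0 hα2 hε
  · have hmeas := hE.measurableSet.diff (hball ε).measurableSet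
    have heq := jumpPairMeasure_eq_of_between (α := α) (cutWedge_subset_jumpSet_diff ε)
      (jumpSet_diff_subset ε)
    rw [gMinus_eq hα0 hα2 ε, ← heq]
    have hfin : jumpPairMeasure α (jumpSet (exampleSet \ supBall ε)) ≠ ⊤ := by
      rw [heq]; exact (jumpPairMeasure_cutWedge_lt_top hα0 hα2 hε).ne
    refine (tendsto_rpow_mul_stableLaw_prod hα0 hα2 (measurableSet_jumpSet hmeas) hfin).congr'
      ((eventually_gt_atTop 0).mono fun h hh => ?_)
    beta_reduce
    rw [measure_exampleVector_mem_smul hS₁ hS₂ hmap hmeas hh]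
  · intro ε hε ε' hε' h
    rw [gPlus_eq hα0 hα2 hε.2, gPlus_eq hα0 hα2 hε'.2]
    exact levyMeasure_Ioo_strictMono hα0 hα2 hε.1 h hε'.2
  -- Taken at base radius zero, where the limiting interval `Ioo 1 1` is empty.
  · have h := tendsto_levyMeasure_Ioo hα0 hα2 zero_lt_one
    simp only [sub_zero, add_zero, zero_add, Ioo_self, measure_empty] at h
    refine h.congr' ?_
    filter_upwards [Ioo_mem_nhdsGT (zero_lt_one' ℝ)] with ε hε
    rw [gPlus_eq hα0 hα2 hε.2]
  · intro ε hε ε' hε' h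
    rw [gMinus_eq hα0 hα2 ε, gMinus_eq hα0 hα2 ε']
    exact jumpPairMeasure_cutWedge_strictAnti hα0 hα2 hε h
  · have h := tendsto_jumpPairMeasure_cutWedge α
    rw [jumpPairMeasure_wedge_of_one_le h1 hα2] at h
    exact h.congr' (eventually_nhdsWithin_of_forall fun ε hε => (gMinus_eq hα0 hα2 ε).symm)
  · have h := tendsto_jumpPairMeasure_cutWedge α
    rw [jumpPairMeasure_wedge_of_lt_one hα0 h1] at h
    exact h.congr' (eventually_nhdsWithin_of_forall fun ε hε => (gMinus_eq hα0 hα2 ε).symm)
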